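/- **Setting.** Let $p=(\alpha_-,\alpha_+',\alpha_+,\alpha_-')\in\mathbb R^4$, put $a_1=a_2=\alpha_--\alpha_+'$, $a_3=a_4=\alpha_-+\alpha_+'$, $a_5=\alpha_+-\alpha_+'$, $a_6=\dots=a_9=\alpha_++\alpha_+'$ and $B=-\mathrm{diag}(a_1^2,\dots,a_9^2)$. Let $M_B=\mathbb R^{11}$ be the Cahen–Wallach space with metric $2dx^+dx^--\sum_iB_i(x^i)^2(dx^-)^2+\sum_i(dx^i)^2$. With $e_\pm$ a null basis of $\mathbb R^{1,1}$, $V=\mathbb R^9$ and $W=\mathbb R^{1,1}\oplus V$, it is called decomposable if $W$ has a subspace $\ne 0,W$ on which the Lorentzian product is non-degenerate and which is invariant under all $Bv\wedge e_+$, $v\in V$. Use the Clifford convention $vw+wv=-2\langle v,w\rangle$, an irreducible representation $\gamma_i$ of $\mathrm{C\ell}(V)$ on $S(V)=\mathbb C^{16}$ with symmetric charge conjugation $C_V$, $\gamma_i^tC_V=C_V\gamma_i$, and on $S=S(V)\oplus S(V)\ni(\xi_1,\xi_2)$ the matrices $\Gamma_+=\sqrt2\begin{pmatrix}0&1\\0&0\end{pmatrix}$,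 $\Gamma_-=\sqrt2\begin{pmatrix}0&0\\-1&0\end{pmatrix}$, $\Gamma_i=\begin{pmatrix}-\gamma_i&0\\0&\gamma_i\end{pmatrix}$ and the form $C=\sigma_2\otimes C_V$. Put $X^\pm=\frac12(1\pm\gamma_{1234})$, $\bar c=(\alpha_+X^++\alpha_-X^-)\gamma_{125}$, $d=(\alpha_+'X^++\alpha_-'X^-)\gamma_{125}$, $s_{\bar c,d}(x)=\bar cx-xd$, $s_{d,\bar c}(x)=dx-x\bar c$. Let $\nabla$ be the Levi-Civita spin connection and let $D=\nabla+\rho$ with $\rho(e_+)=0$, $\rho(e_-)=\mathrm{diag}(\bar c,d)$, $\rho(e_i)(\xi_1,\xi_2)=(-\frac1{\sqrt2}s_{\bar c,d}(e_i)\xi_2,0)$. * $\mathcal K_0$ is the complex span of $\partial_+$, $\partial_-$, $K_{(i)}=\cosh(a_ix^-)\partial_i-a_i\sinh(a_ix^-)x^i\partial_+$, $K_{(i^*)}=-a_i\sinh(a_ix^-)\partial_i+a_i^2\cosh(a_ix^-)x^i\partial_+$ for $1\le i\le 9$, and $K_{(ij)}=x^j\partial_i-x^i\partial_j$ for $(ij)\in\{1,2\}^2\cup\{3,4\}^2\cup\{6,7,8,9\}^2$.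 * $\mathcal K_1$ is the space of the spinor fields $\xi=\big(e^{-x^-\bar c}\xi_1^0+\frac1{\sqrt2}\sum_ix^is_{\bar c,d}(e_i)e^{-x^-d}\xi_2^0,\ e^{-x^-d}\xi_2^0\big)$ with constants $\xi_1^0,\xi_2^0\in S(V)$, $X^-\xi_2^0=0$. * The brackets are the commutator on $\mathcal K_0$, the spinorial Lie derivative $\mathcal L_K\xi=\nabla_K\xi-\frac14\sum\nabla_\mu K_\nu\Gamma^{\mu\nu}\xi$ of $K\in\mathcal K_0$ on $\mathcal K_1$, and $\{\xi,\eta\}=C(\xi_1^0,\Gamma_-\eta_1^0)\partial_++C(\xi_2^0,\Gamma_+\eta_2^0)\partial_-+\sum_i\{\xi,\eta\}^iK_{(i)}+\sum_i\{\xi,\eta\}^{i^*}K_{(i^*)}+\frac12\sum_{ij}\{\xi,\eta\}^{ij}K_{(ij)}$, where $\{\xi,\eta\}^i=C(\xi_1^0,\Gamma_i\eta_2^0)+C(\eta_1^0,\Gamma_i\xi_2^0)$, $\{\xi,\eta\}^{i^*}=B_i^{-1}\big(C(\xi_1^0,s_{\bar c,d}(e_i)\eta_2^0)-C(s_{\bar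 c,d}(e_i)\xi_2^0,\eta_1^0)\big)$, $\{\xi,\eta\}^{ij}=-\frac12C\big(\xi_2^0,\Gamma_+(s_{d,\bar c}(e_j)\gamma_i+\gamma_is_{\bar c,d}(e_j))\eta_2^0\big)$. In the terms with $s_{\bar c,d}$ and $s_{d,\bar c}$, $S(V)$ is identified with the second summand of $S$ for the arguments containing $\xi_2^0,\eta_2^0$ and with the first for $\xi_1^0,\eta_1^0$. The parameter $p$ defines a *geometric superalgebra* if $\mathcal K_0$ is a Lie algebra of Killing fields, $\mathcal K_1$ consists of $D$-parallel spinors, $\mathcal L$ is a representation of $\mathcal K_0$ on $\mathcal K_1$, and $\{\cdot,\cdot\}$ is a symmetric $\mathcal K_0$-equivariant map $\mathcal K_1\times\mathcal K_1\to\mathcal K_0$; it defines a *geometric supersymmetry* if moreover $\mathcal K_0\oplus\mathcal K_1$ is a Lie superalgebra. On $\mathbb R^4\setminus\{0\}$ let $\sim$ be the equivalence relation generated by $p\sim cp$ $(c>0)$ and $(\alpha_-,\alpha_+',\alpha_+,\alpha_-')\sim(-\alpha_-,\alpha_+',\alpha_+,\alpha_-')$, and let $\widehat{\mathcal C}=(\mathbb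 R^4\setminus\{0\})/\!\sim$ with the quotient topology. Let $\mathcal C_0\subset\widehat{\mathcal C}$ be the set of classes of those $p$ for which $M_B$ is indecomposable and $p$ defines a geometric supersymmetry, and let the compactified moduli space of geometric supersymmetries $\widehat{\mathcal C}_0$ be the closure of $\mathcal C_0$ in $\widehat{\mathcal C}$. **Proposition.** The map $[p]\mapsto(\alpha_+',\alpha_+,\alpha_-')/|p|$ is a homeomorphism from $\widehat{\mathcal C}$ onto the closed unit ball $D^3\subset\mathbb R^3$. In the coordinates $(\alpha_+',\alpha_+,\alpha_-')$ of $D^3$ it maps $\mathcal C_0$ onto $$\{\alpha_+=-3\alpha_+',\ \alpha_+\neq\pm\alpha_+',\ \alpha_+^2+2\alpha_+'^2+\alpha_-'^2\neq1\}$$ and it maps $\widehat{\mathcal C}_0$ onto the disc $\{\alpha_+=-3\alpha_+'\}\subset D^3$. In particular $\widehat{\mathcal C}_0$ is homeomorphic to the closed 2-disc. -/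

import Mathlib

open scoped Kronecker Topology

noncomputable section

namespace CahenWallach

/-! ## Parameters, coordinates and the metric -/

/-- The parameter space `ℝ⁴` with coordinates `(α₋, α₊', α₊, α₋')`. -/
abbrev Param := EuclideanSpace ℝ (Fin 4)

/-- Index set of the coordinates `x⁺, x⁻, x¹, …, x⁹` of an eleven dimensional Cahen-Wallach space
and of the frame `e₊, e₋, e₁, …, e₉` of `W = ℝ^{1,1} ⊕ ℝ⁹`. -/
abbrev Idx := Fin 2 ⊕ Fin 9

/-- The index `+`. -/
abbrev ip : Idx := Sum.inl 0

/-- The index `-`. -/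
abbrev im : Idx := Sum.inl 1

/-- Points of the manifold `M_B` (diffeomorphic to `ℝ¹¹`) in the global coordinates. -/
abbrev Pt := Idx → ℝ

/-- The numbers `a_i = i λ_i`, for which `B = diag(λ_i²) = -diag(a_i²)`. -/
def a (p : Param) : Fin 9 → ℝ :=
  ![p 0 - p 1, p 0 - p 1, p 0 + p 1, p 0 + p 1, p 2 - p 1,
    p 2 + p 1, p 2 + p 1, p 2 + p 1, p 2 + p 1]

/-- The diagonal entries `λ_i² = -a_i²` of the symmetric map
`B = -diag((α₋-α₊')² 1₂, (α₋+α₊')² 1₂, (α₊-α₊')² 1₁, (α₊+α₊')² 1₄)`. -/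
def B (p : Param) (i : Fin 9) : ℝ := -(a p i) ^ 2

/-- The metric `2 dx⁺dx⁻ - ∑ B_i (xⁱ)² (dx⁻)² + ∑ (dxⁱ)²` as a matrix. -/
def metric (p : Param) (x : Pt) : Matrix Idx Idx ℝ :=
  Matrix.fromBlocks !![0, 1; 1, -∑ i, B p i * (x (Sum.inr i)) ^ 2] 0 0 1

/-- The partial derivative with respect to the coordinate `x^μ`. -/
def pd {E : Type*} [NormedAddCommGroup E] [NormedSpace ℝ E] (μ : Idx) (f : Pt → E) (x : Pt) : E :=
  deriv (fun t : ℝ => f (Function.update x μ t)) (x μ)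

/-- The Christoffel symbols `Γ^κ_{μν}` of the Levi-Civita connection. -/
def christoffel (p : Param) (x : Pt) (κ μ ν : Idx) : ℝ :=
  (1 / 2) * ∑ σ, (metric p x)⁻¹ κ σ *
    (pd μ (fun y => metric p y σ ν) x + pd ν (fun y => metric p y σ μ) x
      - pd σ (fun y => metric p y μ ν) x)

/-! ## (In)decomposability -/

/-- The Lorentzian scalar product on `W = ℝ^{1,1} ⊕ ℝ⁹`. -/
def lorentz (u w : Idx → ℝ) : ℝ :=
  u ip * w im + u im * w ip + ∑ i, u (Sum.inr i) * w (Sum.inr i)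

/-- The action `Bv ∧ e₊` on `W` of the element `v^*` of the holonomy algebra `V^*`. -/
def holonomy (p : Param) (v : Fin 9 → ℝ) (w : Idx → ℝ) : Idx → ℝ :=
  Sum.elim ![-∑ i, B p i * v i * w (Sum.inr i), 0] (fun i => w im * (B p i * v i))

/-- `M_B` is decomposable if `W` has a proper non-zero `V^*`-invariant subspace on which the
scalar product is non-degenerate. -/
def Decomposable (p : Param) : Prop :=
  ∃ U : Submodule ℝ (Idx → ℝ), U ≠ ⊥ ∧ U ≠ ⊤ ∧
    (∀ v, ∀ u ∈ U, holonomy p v u ∈ U) ∧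
    (∀ u ∈ U, (∀ u' ∈ U, lorentz u u' = 0) → u = 0)

/-! ## Vector fields and the even part -/

/-- Complexified vector fields, by their components. -/
abbrev VF := Pt → Idx → ℂ

/-- The commutator of vector fields. -/
def lieBr (X Y : VF) : VF := fun x ν =>
  ∑ μ, (X x μ * pd μ (fun y => Y y ν) x - Y x μ * pd μ (fun y => X y ν) x)

/-- Killing's equation `L_X g_B = 0`. -/
def IsKilling (p : Param) (X : VF) : Prop :=
  ∀ x μ ν, ∑ σ, (X x σ * (pd σ (fun y => metric p y μ ν) x : ℂ)
    + (metric p x σ ν : ℂ) * pd μ (fun y => X y σ) x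
    + (metric p x μ σ : ℂ) * pd ν (fun y => X y σ) x) = 0

/-- The coordinate vector field `∂_μ`. -/
def coordField (μ : Idx) : VF := fun _ => Pi.single μ 1

/-- `K_(i) = cos(λ_i x⁻) ∂_i + λ_i sin(λ_i x⁻) xⁱ ∂₊`, with `λ_i = -i a_i`. -/
def killV (p : Param) (i : Fin 9) : VF := fun x =>
  ((Real.cosh (a p i * x im) : ℝ) : ℂ) • Pi.single (Sum.inr i) 1
    + ((-a p i * Real.sinh (a p i * x im) * x (Sum.inr i) : ℝ) : ℂ) • Pi.single ip 1

/-- `K_(i*) = λ_i sin(λ_i x⁻) ∂_i - λ_i² cos(λ_i x⁻) xⁱ ∂₊`, with `λ_i = -i a_i`. -/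
def killVstar (p : Param) (i : Fin 9) : VF := fun x =>
  ((-a p i * Real.sinh (a p i * x im) : ℝ) : ℂ) • Pi.single (Sum.inr i) 1
    + (((a p i) ^ 2 * Real.cosh (a p i * x im) * x (Sum.inr i) : ℝ) : ℂ) • Pi.single ip 1

/-- `K_(ij) = x^j ∂_i - x^i ∂_j`. -/
def killSO (i j : Fin 9) : VF := fun x =>
  (x (Sum.inr j) : ℂ) • Pi.single (Sum.inr i) 1 - (x (Sum.inr i) : ℂ) • Pi.single (Sum.inr j) 1

/-- The blocks `{1,2}, {3,4}, {5}, {6,7,8,9}` of the eigenvalues of `B`. -/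
def block : Fin 9 → Fin 4 := ![0, 0, 1, 1, 2, 3, 3, 3, 3]

/-- The even part `𝒦₀`, spanned by `K_(±)`, `K_(i)`, `K_(i*)` and the `K_(ij)` with
`(ij) ∈ {1,2}² ∪ {3,4}² ∪ {6,7,8,9}²`. -/
def K0 (p : Param) : Submodule ℂ VF :=
  Submodule.span ℂ ({coordField ip, coordField im} ∪ Set.range (killV p) ∪
    Set.range (killVstar p) ∪ {X | ∃ i j, block i = block j ∧ X = killSO i j})

/-! ## Clifford matrices -/

/-- Left multiplications by the seven imaginary octonion units. -/
def octL : Fin 7 → Matrix (Fin 8) (Fin 8) ℤ := ![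
  !![0, -1, 0, 0, 0, 0, 0, 0; 1, 0, 0, 0, 0, 0, 0, 0; 0, 0, 0, -1, 0, 0, 0, 0;
     0, 0, 1, 0, 0, 0, 0, 0; 0, 0, 0, 0, 0, -1, 0, 0; 0, 0, 0, 0, 1, 0, 0, 0;
     0, 0, 0, 0, 0, 0, 0, 1; 0, 0, 0, 0, 0, 0, -1, 0],
  !![0, 0, -1, 0, 0, 0, 0, 0; 0, 0, 0, 1, 0, 0, 0, 0; 1, 0, 0, 0, 0, 0, 0, 0;
     0, -1, 0, 0, 0, 0, 0, 0; 0, 0, 0, 0, 0, 0, -1, 0; 0, 0, 0, 0, 0, 0, 0, -1;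
     0, 0, 0, 0, 1, 0, 0, 0; 0, 0, 0, 0, 0, 1, 0, 0],
  !![0, 0, 0, -1, 0, 0, 0, 0; 0, 0, -1, 0, 0, 0, 0, 0; 0, 1, 0, 0, 0, 0, 0, 0;
     1, 0, 0, 0, 0, 0, 0, 0; 0, 0, 0, 0, 0, 0, 0, -1; 0, 0, 0, 0, 0, 0, 1, 0;
     0, 0, 0, 0, 0, -1, 0, 0; 0, 0, 0, 0, 1, 0, 0, 0],
  !![0, 0, 0, 0, -1, 0, 0, 0; 0, 0, 0, 0, 0, 1, 0, 0; 0, 0, 0, 0, 0, 0, 1, 0;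
     0, 0, 0, 0, 0, 0, 0, 1; 1, 0, 0, 0, 0, 0, 0, 0; 0, -1, 0, 0, 0, 0, 0, 0;
     0, 0, -1, 0, 0, 0, 0, 0; 0, 0, 0, -1, 0, 0, 0, 0],
  !![0, 0, 0, 0, 0, -1, 0, 0; 0, 0, 0, 0, -1, 0, 0, 0; 0, 0, 0, 0, 0, 0, 0, 1;
     0, 0, 0, 0, 0, 0, -1, 0; 0, 1, 0, 0, 0, 0, 0, 0; 1, 0, 0, 0, 0, 0, 0, 0;
     0, 0, 0, 1, 0, 0, 0, 0; 0, 0, -1, 0, 0, 0, 0, 0],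
  !![0, 0, 0, 0, 0, 0, -1, 0; 0, 0, 0, 0, 0, 0, 0, -1; 0, 0, 0, 0, -1, 0, 0, 0;
     0, 0, 0, 0, 0, 1, 0, 0; 0, 0, 1, 0, 0, 0, 0, 0; 0, 0, 0, -1, 0, 0, 0, 0;
     1, 0, 0, 0, 0, 0, 0, 0; 0, 1, 0, 0, 0, 0, 0, 0],
  !![0, 0, 0, 0, 0, 0, 0, -1; 0, 0, 0, 0, 0, 0, 1, 0; 0, 0, 0, 0, 0, -1, 0, 0;
     0, 0, 0, 0, -1, 0, 0, 0; 0, 0, 0, 1, 0, 0, 0, 0; 0, 0, 1, 0, 0, 0, 0, 0;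
     0, -1, 0, 0, 0, 0, 0, 0; 1, 0, 0, 0, 0, 0, 0, 0]]

/-- Index set of the 16-dimensional spinor space `S(V)`, `V = ℝ⁹`. -/
abbrev SV := Fin 2 × Fin 8

/-- The Clifford matrices `γ_a = σ₁ ⊗ L_a` (`1 ≤ a ≤ 7`), `γ₈ = -iσ₂ ⊗ 1`, `γ₉ = -iσ₃ ⊗ 1` of
`V = ℝ⁹`, with `γ_iγ_j + γ_jγ_i = -2δ_{ij}`. Indices in the code start at `0`. -/
def γ (i : Fin 9) : Matrix SV SV ℂ :=
  if h : (i : ℕ) < 7 then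
    (!![0, 1; 1, 0] : Matrix (Fin 2) (Fin 2) ℂ) ⊗ₖ (octL ⟨i, h⟩).map (fun n : ℤ => (n : ℂ))
  else if (i : ℕ) = 7 then
    (!![0, -1; 1, 0] : Matrix (Fin 2) (Fin 2) ℂ) ⊗ₖ (1 : Matrix (Fin 8) (Fin 8) ℂ)
  else
    (!![-Complex.I, 0; 0, Complex.I] : Matrix (Fin 2) (Fin 2) ℂ) ⊗ₖ
      (1 : Matrix (Fin 8) (Fin 8) ℂ)

/-- The charge conjugation `C_V = σ₃ ⊗ 1` of `V`. -/
def CV : Matrix SV SV ℂ :=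
  (!![1, 0; 0, -1] : Matrix (Fin 2) (Fin 2) ℂ) ⊗ₖ (1 : Matrix (Fin 8) (Fin 8) ℂ)

/-- `γ₁₂₅`. -/
def γ125 : Matrix SV SV ℂ := γ 0 * γ 1 * γ 4

/-- The projection `X⁺ = ½(1 + γ₁₂₃₄)`. -/
def Xplus : Matrix SV SV ℂ := (1 / 2 : ℂ) • (1 + γ 0 * γ 1 * γ 2 * γ 3)

/-- The projection `X⁻ = ½(1 - γ₁₂₃₄)`. -/
def Xminus : Matrix SV SV ℂ := (1 / 2 : ℂ) • (1 - γ 0 * γ 1 * γ 2 * γ 3)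

/-- The spinor space `S(W) = S⁻ ⊕ S⁺ = S(V) ⊕ S(V)`, of dimension 32; a spinor is written
`(ξ₁, ξ₂)`. -/
abbrev Spinor := SV ⊕ SV → ℂ

/-- The Clifford matrices of `W`: `Γ₊ = γ₊ ⊗ 1`, `Γ₋ = γ₋ ⊗ 1`, `Γ_i = σ ⊗ γ_i`. -/
def Γ : Idx → Matrix (SV ⊕ SV) (SV ⊕ SV) ℂ :=
  Sum.elim
    ![Matrix.fromBlocks 0 (((Real.sqrt 2 : ℝ) : ℂ) • 1) 0 0,
      Matrix.fromBlocks 0 0 (-((Real.sqrt 2 : ℝ) : ℂ) • 1) 0]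
    (fun i => Matrix.fromBlocks (-γ i) 0 0 (γ i))

/-- The charge conjugation `C_W = σ₂ ⊗ C_V` as a bilinear form on `S(W)`. -/
def C (ξ η : Spinor) : ℂ :=
  ξ ⬝ᵥ (Matrix.fromBlocks 0 (-Complex.I • CV) (Complex.I • CV) 0).mulVec η

/-- The component `ξ₁ ∈ S⁻` of a spinor. -/
def fst (ξ : Spinor) : Spinor := Sum.elim (fun k => ξ (Sum.inl k)) 0

/-- The component `ξ₂ ∈ S⁺` of a spinor. -/
def snd (ξ : Spinor) : Spinor := Sum.elim 0 (fun k => ξ (Sum.inr k))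

/-- The action of an element of the Clifford algebra of `V` on `S⁺`, extended by `0` to `S⁻`. -/
def onPlus (m : Matrix SV SV ℂ) : Matrix (SV ⊕ SV) (SV ⊕ SV) ℂ := Matrix.fromBlocks 0 0 0 m

/-! ## The spinor connection and the odd part -/

/-- `c̄ = (α₊ X⁺ + α₋ X⁻) γ₁₂₅`. -/
def cbar (p : Param) : Matrix SV SV ℂ :=
  (((p 2 : ℝ) : ℂ) • Xplus + ((p 0 : ℝ) : ℂ) • Xminus) * γ125

/-- `d = (α₊' X⁺ + α₋' X⁻) γ₁₂₅`. -/
def dd (p : Param) : Matrix SV SV ℂ :=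
  (((p 1 : ℝ) : ℂ) • Xplus + ((p 3 : ℝ) : ℂ) • Xminus) * γ125

/-- `s_{c̄,d}(e_i) = c̄ e_i - e_i d`. -/
def s (p : Param) (i : Fin 9) : Matrix SV SV ℂ := cbar p * γ i - γ i * dd p

/-- `s_{d,c̄}(e_i) = d e_i - e_i c̄`. -/
def sdc (p : Param) (i : Fin 9) : Matrix SV SV ℂ := dd p * γ i - γ i * cbar p

/-- Spinor fields; the spinor bundle is trivialized by the frame dual to
`dx⁺ - ½ ∑ B_i (xⁱ)² dx⁻, dx⁻, dxⁱ`. -/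
abbrev SF := Pt → Spinor

/-- The Clifford matrix of the coordinate vector `∂_μ` at `x`:
`∂₊ = e₊`, `∂_i = e_i`, `∂₋ = e₋ - ½ ∑ B_i (xⁱ)² e₊`. -/
def Γcoord (p : Param) (x : Pt) : Idx → Matrix (SV ⊕ SV) (SV ⊕ SV) ℂ :=
  Sum.elim
    ![Γ ip, Γ im - ((1 / 2 * ∑ i, B p i * (x (Sum.inr i)) ^ 2 : ℝ) : ℂ) • Γ ip]
    (fun i => Γ (Sum.inr i))

/-- The Levi-Civita spin connection `∇₊ = ∂₊`, `∇_i = ∂_i`,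
`∇₋ = ∂₋ + ½ ∑ x^j Γ₊ B(e_j)`. -/
def nabla (p : Param) (μ : Idx) (ξ : SF) : SF := fun x =>
  pd μ ξ x + if μ = im then
    (1 / 2 : ℂ) • (∑ j, ((x (Sum.inr j) * B p j : ℝ) : ℂ) • (Γ ip * Γ (Sum.inr j))).mulVec (ξ x)
  else 0

/-- The equivariant map `ρ` on the frame: `ρ(e₊) = 0`, `ρ(e₋) = diag(c̄, d)`,
`ρ(e_i) = -(1/√2) s_{c̄,d}(e_i)` from `S⁺` to `S⁻`. -/
def ρ (p : Param) : Idx → Matrix (SV ⊕ SV) (SV ⊕ SV) ℂ :=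
  Sum.elim ![0, Matrix.fromBlocks (cbar p) 0 0 (dd p)]
    (fun i => Matrix.fromBlocks 0 (-(((Real.sqrt 2 : ℝ) : ℂ)⁻¹ • s p i)) 0 0)

/-- The connection `D = ∇ + ρ`. (As `ρ(e₊) = 0`, the values on `∂_μ` and `e_μ` agree.) -/
def D (p : Param) (μ : Idx) (ξ : SF) : SF := fun x => nabla p μ ξ x + (ρ p μ).mulVec (ξ x)

/-- The matrix that maps the constants `(ξ₁⁰, ξ₂⁰)` to the value at `x` of
`exp(-x⁻c̄) ξ₁⁰ + (1 + ½ ∑ x^i Γ₊ s_{c̄,d}(e_i)) exp(-x⁻d) ξ₂⁰`. -/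
def transport (p : Param) (x : Pt) : Matrix (SV ⊕ SV) (SV ⊕ SV) ℂ :=
  Matrix.fromBlocks (NormedSpace.exp (-(x im : ℂ) • cbar p))
    (((Real.sqrt 2 : ℝ) : ℂ)⁻¹ • (∑ i, (x (Sum.inr i) : ℂ) • s p i) *
      NormedSpace.exp (-(x im : ℂ) • dd p))
    0 (NormedSpace.exp (-(x im : ℂ) • dd p))

/-- The spinor field `ξ(ξ₁⁰, ξ₂⁰)` with constants `(ξ₁⁰, ξ₂⁰)`; these are its components at the
origin. -/
def parallelSpinor (p : Param) : Spinor →ₗ[ℂ] SF where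
  toFun v := fun x => (transport p x).mulVec v
  map_add' v w := by funext x; exact Matrix.mulVec_add _ v w
  map_smul' c v := by funext x; exact Matrix.mulVec_smul _ c v

/-- The odd part `𝒦₁`: the spinor fields `ξ(ξ₁⁰, ξ₂⁰)` with `X⁻ ξ₂⁰ = 0`. -/
def K1 (p : Param) : Submodule ℂ SF :=
  Submodule.map (parallelSpinor p) (LinearMap.ker (Matrix.mulVecLin (onPlus Xminus)))

/-! ## Brackets -/

/-- The covariant derivative `∇_μ X^ν` of a vector field. -/
def covD (p : Param) (X : VF) (x : Pt) (μ ν : Idx) : ℂ :=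
  pd μ (fun y => X y ν) x + ∑ κ, (christoffel p x ν μ κ : ℂ) * X x κ

/-- The spinorial Lie derivative `L_X ξ = ∇_X ξ - ¼ ∑ ∇_μ X_ν Γ^{μν} ξ`, where
`∇_μ X_ν Γ^{μν} = ∇_μ X^ν · ½ [Γ^μ, Γ_ν]`. -/
def spinLie (p : Param) (X : VF) (ξ : SF) : SF := fun x =>
  (∑ μ, X x μ • nabla p μ ξ x)
    - (1 / 4 : ℂ) • (∑ μ, ∑ ν, (covD p X x μ ν * (1 / 2)) •
        ((∑ κ, ((metric p x)⁻¹ μ κ : ℂ) • Γcoord p x κ) * Γcoord p x ν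
          - Γcoord p x ν * (∑ κ, ((metric p x)⁻¹ μ κ : ℂ) • Γcoord p x κ))).mulVec (ξ x)

/-- The coefficient `C(ξ₁⁰, Γ_i η₂⁰) + C(η₁⁰, Γ_i ξ₂⁰)` of `K_(i)`. -/
def coefV (v w : Spinor) (i : Fin 9) : ℂ :=
  C (fst v) ((Γ (Sum.inr i)).mulVec (snd w)) + C (fst w) ((Γ (Sum.inr i)).mulVec (snd v))

/-- The coefficient `C(ξ₁⁰, s(B⁻¹e_i) η₂⁰) - C(s(B⁻¹e_i) ξ₂⁰, η₁⁰)` of `K_(i*)`. -/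
def coefVstar (p : Param) (v w : Spinor) (i : Fin 9) : ℂ :=
  ((B p i)⁻¹ : ℂ) * (C (fst v) ((onPlus (s p i)).mulVec (snd w))
    - C ((onPlus (s p i)).mulVec (snd v)) (fst w))

/-- The coefficient `-½ C(ξ₂⁰, Γ₊ (s_{d,c̄}(e_j) Γ_i + Γ_i s_{c̄,d}(e_j)) η₂⁰)` of `K_(ij)`. -/
def coefSO (p : Param) (v w : Spinor) (i j : Fin 9) : ℂ :=
  -(1 / 2) * C (snd v) ((Γ ip * onPlus (sdc p j * γ i + γ i * s p j)).mulVec (snd w))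

/-- The odd-odd bracket, in terms of the constants of the two parallel spinors. -/
def oddBr (p : Param) (ξ η : SF) : VF :=
  C (fst (ξ 0)) ((Γ im).mulVec (fst (η 0))) • coordField ip
    + C (snd (ξ 0)) ((Γ ip).mulVec (snd (η 0))) • coordField im
    + ∑ i, coefV (ξ 0) (η 0) i • killV p i
    + ∑ i, coefVstar p (ξ 0) (η 0) i • killVstar p i
    + (1 / 2 : ℂ) • ∑ i, ∑ j,
        if block i = block j then coefSO p (ξ 0) (η 0) i j • killSO i j else 0

/-! ## Geometric superalgebra and geometric supersymmetry -/

/-- `𝒦₀ ⊕ 𝒦₁` is a geometric superalgebra: `𝒦₀` is a Lie algebra of Killing vector fields, `𝒦₁`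
consists of `D`-parallel spinors, the spinorial Lie derivative is a representation of `𝒦₀` on
`𝒦₁`, and the odd-odd bracket is a symmetric `𝒦₀`-equivariant map into `𝒦₀`. -/
structure IsGeometricSuperalgebra (p : Param) : Prop where
  killing : ∀ X ∈ K0 p, IsKilling p X
  even_even : ∀ X ∈ K0 p, ∀ Y ∈ K0 p, lieBr X Y ∈ K0 p
  parallel : ∀ ξ ∈ K1 p, ∀ μ, D p μ ξ = 0
  even_odd : ∀ X ∈ K0 p, ∀ ξ ∈ K1 p, spinLie p X ξ ∈ K1 p
  odd_odd : ∀ ξ ∈ K1 p, ∀ η ∈ K1 p, oddBr p ξ η ∈ K0 p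
  odd_symm : ∀ ξ ∈ K1 p, ∀ η ∈ K1 p, oddBr p ξ η = oddBr p η ξ
  even_even_odd : ∀ X ∈ K0 p, ∀ Y ∈ K0 p, ∀ ξ ∈ K1 p,
    spinLie p (lieBr X Y) ξ = spinLie p X (spinLie p Y ξ) - spinLie p Y (spinLie p X ξ)
  even_odd_odd : ∀ X ∈ K0 p, ∀ ξ ∈ K1 p, ∀ η ∈ K1 p,
    lieBr X (oddBr p ξ η) = oddBr p (spinLie p X ξ) η + oddBr p ξ (spinLie p X η)

/-- Geometric supersymmetry: the geometric superalgebra is a Lie superalgebra. The graded Jacobi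
identity with one or two odd entries is part of the definition of a geometric superalgebra. -/
structure IsGeometricSupersymmetry (p : Param) : Prop extends IsGeometricSuperalgebra p where
  jacobi_even : ∀ X ∈ K0 p, ∀ Y ∈ K0 p, ∀ Z ∈ K0 p,
    lieBr X (lieBr Y Z) + lieBr Y (lieBr Z X) + lieBr Z (lieBr X Y) = 0
  jacobi_odd : ∀ ξ ∈ K1 p, ∀ η ∈ K1 p, ∀ ζ ∈ K1 p,
    spinLie p (oddBr p ξ η) ζ + spinLie p (oddBr p η ζ) ξ + spinLie p (oddBr p ζ ξ) η = 0

/-! ## Moduli spaces -/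

/-- The map `(α₋, α₊', α₊, α₋') ↦ (-α₋, α₊', α₊, α₋')`. -/
def flip (p : Param) : Param := !₂[-p 0, p 1, p 2, p 3]

/-- Two non-zero parameters are identified if they agree up to a positive scalar and the sign of
`α₋`. -/
def moduliSetoid : Setoid {p : Param // p ≠ 0} where
  r p q := ∃ c : ℝ, 0 < c ∧ ((q : Param) = c • (p : Param) ∨ (q : Param) = c • flip p)
  iseqv := by
    have hs : ∀ (c : ℝ) (p : Param), flip (c • p) = c • flip p := by
      intro c p; ext k; fin_cases k <;> simp [flip]
    have hf : ∀ p : Param, flip (flip p) = p := by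
      intro p; ext k; fin_cases k <;> simp [flip]
    refine ⟨fun p => ⟨1, one_pos, Or.inl (by simp)⟩, ?_, ?_⟩
    · rintro p q ⟨c, hc, h | h⟩
      · exact ⟨c⁻¹, inv_pos.2 hc, Or.inl (by rw [h, smul_smul, inv_mul_cancel₀ hc.ne', one_smul])⟩
      · exact ⟨c⁻¹, inv_pos.2 hc,
          Or.inr (by rw [h, hs, hf, smul_smul, inv_mul_cancel₀ hc.ne', one_smul])⟩
    · rintro p q r ⟨c, hc, h⟩ ⟨e, he, k⟩
      refine ⟨e * c, mul_pos he hc, ?_⟩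
      rcases h with h | h <;> rcases k with k | k
      · exact Or.inl (by rw [k, h, smul_smul])
      · exact Or.inr (by rw [k, h, hs, smul_smul])
      · exact Or.inr (by rw [k, h, smul_smul])
      · exact Or.inl (by rw [k, h, hs, hf, smul_smul])

/-- The space of all (indecomposable or decomposable) non-zero configurations up to positive
scalars and the sign of `α₋`, with the quotient topology. -/
abbrev Configurations := Quotient moduliSetoid

/-- The moduli space of geometric supersymmetries: the classes of the parameters for which `M_B` is
indecomposable and the geometric superalgebra is a geometric supersymmetry. -/
def susyModuli : Set Configurations :=
  {z | ∃ p : {p : Param // p ≠ 0}, ¬ Decomposable p.1 ∧ IsGeometricSupersymmetry p.1 ∧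
    z = Quotient.mk moduliSetoid p}

/-- The compactified moduli space of geometric supersymmetries. -/
def compactifiedSusyModuli : Set Configurations := closure susyModuli

end CahenWallach

end

open scoped Kronecker Topology
noncomputable section
namespace CahenWallach

/-! ## Configurations and the closed ball -/

/-! Topologically, the classes of non-zero parameters up to positive scalars form the sphere S³, and
identifying α₋ with -α₋ folds it onto a closed hemisphere. Dropping α₋ projects that hemisphere onto
the unit ball, and α₋ is recovered up to sign from |p| = 1. Everything else rests on one algebraic
equivalence, `not_decomposable_and_isGeometricSupersymmetry_iff`: M_B is indecomposable and p gives
a geometric supersymmetry exactly when all a_i are non-zero and α₊ = -3α₊'.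

Indecomposability is equivalent to all a_i ≠ 0 by linear algebra on W (`not_decomposable_iff`).
Under this condition the brackets become algebra on finite-dimensional data. An even field is
determined by its coefficients (`Even`, `mem_K0_iff`), an odd field by its value at the origin, and
the commutator, the spinorial Lie derivative and the odd bracket turn into `brk`, `act` and
`oddData` (`lieBr_field`, `spinLie_field`, `oddBr_eq`). The relation behind this is s(e_i) = a_i
γ₁₂₅ γ_i on the image of X⁺ (`s_mul_Xplus`): it makes the spinors parallel and the odd bracket
equivariant for every such p, so that only the Jacobi identity of three odd elements constrains p.

By polarisation that identity says that `act p (oddData p w w) w` vanishes for all w. A cubic Fierz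
identity shows that the second component is (α₊ + 3α₊') times a vector that is non-zero for a
suitable spinor (`right_jac`, `planes_psv_ne_zero`), so α₊ = -3α₊' is necessary. It is sufficient
because two further Fierz identities, quadratic in ξ₂⁰ and linear in an arbitrary ξ₁⁰, then make the
first component vanish (`left_jac_eq_zero`).

In the ball the conditions a_i ≠ 0 remove from the disc α₊ = -3α₊' the zero set of a non-zero
polynomial. Every point of the disc is a limit of remaining points along a segment, so the closure
is the whole disc. -/

/-- The representative `(α₊', α₊, α₋') / |p|` of a class of parameters in the closed unit ball. -/
def ballCoord (p : Param) : EuclideanSpace ℝ (Fin 3) := ‖p‖⁻¹ • !₂[p 1, p 2, p 3]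

theorem param_norm_sq (p : Param) : ‖p‖ ^ 2 = p 0 ^ 2 + p 1 ^ 2 + p 2 ^ 2 + p 3 ^ 2 := by
  rw [EuclideanSpace.real_norm_sq_eq, Fin.sum_univ_four]

theorem norm_sq_three (u : EuclideanSpace ℝ (Fin 3)) :
    ‖u‖ ^ 2 = u 0 ^ 2 + u 1 ^ 2 + u 2 ^ 2 := by
  rw [EuclideanSpace.real_norm_sq_eq, Fin.sum_univ_three]

/-- The coordinate α₋ that `ballCoord` drops survives as the defect of the norm from 1, and only its
sign is lost. This is what makes the map injective on classes. -/
theorem ballCoord_norm_sq {p : Param} (hp : p ≠ 0) :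
    ‖ballCoord p‖ ^ 2 = 1 - (p 0 / ‖p‖) ^ 2 := by
  have h : ‖p‖ ≠ 0 := norm_ne_zero_iff.2 hp
  have h2 := param_norm_sq p
  rw [norm_sq_three]
  simp only [ballCoord, PiLp.smul_apply, smul_eq_mul, Matrix.cons_val]
  field_simp
  linarith

theorem ballCoord_mem {p : Param} (hp : p ≠ 0) : ballCoord p ∈ Metric.closedBall 0 1 := by
  rw [mem_closedBall_zero_iff]
  have := ballCoord_norm_sq hp
  nlinarith [sq_nonneg (p 0 / ‖p‖), norm_nonneg (ballCoord p)]

theorem norm_flip (p : Param) : ‖flip p‖ = ‖p‖ := by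
  have h : ‖flip p‖ ^ 2 = ‖p‖ ^ 2 := by
    rw [param_norm_sq, param_norm_sq]; simp [flip]
  exact (pow_left_inj₀ (norm_nonneg _) (norm_nonneg _) two_ne_zero).1 h

theorem ballCoord_flip (p : Param) : ballCoord (flip p) = ballCoord p := by
  rw [ballCoord, ballCoord, norm_flip]; rfl

theorem ballCoord_smul {c : ℝ} (hc : 0 < c) (p : Param) : ballCoord (c • p) = ballCoord p := by
  ext k
  fin_cases k <;>
  · simp [ballCoord, norm_smul, abs_of_pos hc]
    field_simp

/-- A representative in the parameter space of a point of the closed ball. -/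
def ballLift (u : EuclideanSpace ℝ (Fin 3)) : Param := !₂[√(1 - ‖u‖ ^ 2), u 0, u 1, u 2]

theorem norm_ballLift {u : EuclideanSpace ℝ (Fin 3)} (hu : ‖u‖ ≤ 1) : ‖ballLift u‖ = 1 := by
  have h : ‖ballLift u‖ ^ 2 = 1 := by
    have h1 : 0 ≤ 1 - ‖u‖ ^ 2 := by nlinarith [norm_nonneg u]
    rw [param_norm_sq]
    simp only [ballLift, PiLp.toLp_apply, Matrix.cons_val, Real.sq_sqrt h1]
    rw [norm_sq_three]; ring
  exact (pow_eq_one_iff_of_nonneg (norm_nonneg _) two_ne_zero).1 h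

theorem ballLift_ne_zero {u : EuclideanSpace ℝ (Fin 3)} (hu : ‖u‖ ≤ 1) : ballLift u ≠ 0 := by
  rw [← norm_ne_zero_iff, norm_ballLift hu]; exact one_ne_zero

theorem ballCoord_ballLift {u : EuclideanSpace ℝ (Fin 3)} (hu : ‖u‖ ≤ 1) :
    ballCoord (ballLift u) = u := by
  rw [ballCoord, norm_ballLift hu]
  ext k
  fin_cases k <;> simp [ballLift]

/-- The lift always has α₋ ≥ 0, so the sign of `p 0` decides whether p or its flip lies on the ray
of the lift. -/
theorem smul_ballLift_ballCoord {p : Param} (hp : p ≠ 0) :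
    p = ‖p‖ • ballLift (ballCoord p) ∨ p = ‖p‖ • flip (ballLift (ballCoord p)) := by
  have h : ‖p‖ ≠ 0 := norm_ne_zero_iff.2 hp
  have h0 : √(1 - ‖ballCoord p‖ ^ 2) = |p 0| / ‖p‖ := by
    rw [ballCoord_norm_sq hp, sub_sub_cancel, Real.sqrt_sq_eq_abs, abs_div, abs_norm]
  rcases le_total 0 (p 0) with h1 | h1
  · left
    rw [abs_of_nonneg h1] at h0
    ext k
    rw [ballLift, h0]
    fin_cases k <;> simp [ballCoord] <;> field_simp
  · right
    rw [abs_of_nonpos h1] at h0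
    ext k
    rw [ballLift, h0]
    fin_cases k <;> simp [ballCoord, flip] <;> field_simp

/-- The configurations up to positive scalars and the sign of `α₋` form a closed ball. -/
def configurationsHomeo :
    Configurations ≃ₜ Metric.closedBall (0 : EuclideanSpace ℝ (Fin 3)) 1 where
  toFun := Quotient.lift (fun p => ⟨ballCoord p.1, ballCoord_mem p.2⟩) (by
    rintro p q ⟨c, hc, h | h⟩
    · exact Subtype.ext (by simp only [h, ballCoord_smul hc])
    · exact Subtype.ext (by simp only [h, ballCoord_smul hc, ballCoord_flip]))
  invFun u := Quotient.mk moduliSetoid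
    ⟨ballLift u.1, ballLift_ne_zero (mem_closedBall_zero_iff.1 u.2)⟩
  left_inv := by
    intro z
    induction z using Quotient.inductionOn with
    | h p =>
      exact Quotient.sound ⟨‖p.1‖, norm_pos_iff.2 p.2, smul_ballLift_ballCoord p.2⟩
  right_inv u := Subtype.ext (ballCoord_ballLift (mem_closedBall_zero_iff.1 u.2))
  continuous_toFun := by
    refine Continuous.quotient_lift ?_ _
    refine Continuous.subtype_mk ?_ _
    unfold ballCoord
    refine Continuous.smul (f := fun p : {p : Param // p ≠ 0} => ‖p.1‖⁻¹)
      (g := fun p : {p : Param // p ≠ 0} => !₂[p.1 1, p.1 2, p.1 3]) ?_ ?_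
    · exact (continuous_subtype_val.norm).inv₀ fun p => norm_ne_zero_iff.2 p.2
    · refine (PiLp.continuous_toLp 2 _).comp (continuous_pi fun k => ?_)
      fin_cases k <;> simp <;> fun_prop
  continuous_invFun := by
    refine continuous_quotient_mk'.comp (Continuous.subtype_mk ?_ _)
    unfold ballLift
    refine (PiLp.continuous_toLp 2 _).comp (continuous_pi fun k => ?_)
    fin_cases k <;> simp <;> fun_prop

theorem configurationsHomeo_mk (p : {p : Param // p ≠ 0}) :
    (configurationsHomeo (Quotient.mk moduliSetoid p) : EuclideanSpace ℝ (Fin 3)) =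
      ‖p.1‖⁻¹ • !₂[p.1 1, p.1 2, p.1 3] := rfl

/-- Closed embeddings commute with closures, so the closure defining the compactified moduli space
can be computed in ℝ³. -/
theorem isClosedEmbedding_configurationsHomeo :
    Topology.IsClosedEmbedding
      (fun z => (configurationsHomeo z : EuclideanSpace ℝ (Fin 3))) :=
  (Metric.isClosed_closedBall.isClosedEmbedding_subtypeVal).comp
    configurationsHomeo.isClosedEmbedding

/-! ### The moduli space and its closure inside the ball -/

theorem a_ne_zero_iff (p : Param) :
    (∀ i, a p i ≠ 0) ↔ p 0 ≠ p 1 ∧ p 0 ≠ -p 1 ∧ p 2 ≠ p 1 ∧ p 2 ≠ -p 1 := by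
  simp [Fin.forall_fin_succ, a, sub_eq_zero, add_eq_zero_iff_eq_neg]

/-- The hypothesis `key` is the algebraic equivalence proved at the end; assuming it here keeps the
topology separate. The conditions α₋ ≠ ±α₊' involve the dropped coordinate: normalised, they say 1 -
|u|² ≠ u₀², which is the last inequality of the set. -/
theorem image_susyModuli
    (key : ∀ p : Param, ¬ Decomposable p ∧ IsGeometricSupersymmetry p ↔
      (∀ i, a p i ≠ 0) ∧ p 2 = -3 * p 1) :
    (fun z => (configurationsHomeo z : EuclideanSpace ℝ (Fin 3))) '' susyModuli =
      {u | ‖u‖ ≤ 1 ∧ u 1 = -3 * u 0 ∧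
        u 1 ≠ u 0 ∧ u 1 ≠ -u 0 ∧ u 1 ^ 2 + 2 * u 0 ^ 2 + u 2 ^ 2 ≠ 1} := by
  ext u
  constructor
  · rintro ⟨_, ⟨p, h1, h2, rfl⟩, rfl⟩
    obtain ⟨h3, h4⟩ := (key p.1).1 ⟨h1, h2⟩
    obtain ⟨h5, h6, h7, h8⟩ := (a_ne_zero_iff p.1).1 h3
    obtain ⟨p, hp⟩ := p
    have hr : ‖p‖ ≠ 0 := norm_ne_zero_iff.2 hp
    have hn := ballCoord_norm_sq hp
    rw [norm_sq_three] at hn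
    change ballCoord p ∈ _
    have e0 : ballCoord p 0 = ‖p‖⁻¹ * p 1 := rfl
    have e1 : ballCoord p 1 = ‖p‖⁻¹ * p 2 := rfl
    refine ⟨mem_closedBall_zero_iff.1 (ballCoord_mem hp), ?_, ?_, ?_, ?_⟩
    · rw [e0, e1, h4]; ring
    · rw [e0, e1]; exact fun h => h7 (mul_left_cancel₀ (inv_ne_zero hr) h)
    · rw [e0, e1, ← mul_neg]; exact fun h => h8 (mul_left_cancel₀ (inv_ne_zero hr) h)
    · intro h
      have h9 : (p 0 / ‖p‖) ^ 2 = (p 1 / ‖p‖) ^ 2 := by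
        have : (p 1 / ‖p‖) ^ 2 = ballCoord p 0 ^ 2 := by rw [e0, div_eq_inv_mul]
        rw [this]; linarith
      rcases sq_eq_sq_iff_eq_or_eq_neg.1 h9 with h | h
      · exact h5 (by field_simp at h; exact h)
      · exact h6 (by field_simp at h; exact h)
  · rintro ⟨h0, h1, h2, h3, h4⟩
    have hl : 0 ≤ 1 - ‖u‖ ^ 2 := by nlinarith [norm_nonneg u]
    have hn := norm_sq_three u
    have hs : √(1 - ‖u‖ ^ 2) ^ 2 ≠ u 0 ^ 2 := by
      rw [Real.sq_sqrt hl]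
      intro h; apply h4; linarith
    refine ⟨Quotient.mk moduliSetoid ⟨ballLift u, ballLift_ne_zero h0⟩,
      ⟨_, ?_, ?_, rfl⟩, ballCoord_ballLift h0⟩
    all_goals
      have := (key (ballLift u)).2 ⟨(a_ne_zero_iff _).2 ⟨?_, ?_, h2, h3⟩, h1⟩
      · first | exact this.1 | exact this.2
      · exact fun h => hs (congrArg (· ^ 2) h)
      · exact fun h => hs ((congrArg (· ^ 2) h).trans (neg_sq _))

/-- On the plane u₁ = -3u₀ the removed points are the zeros of u₀(11u₀² + u₂² - 1). Restricted to a
segment that ends at a point outside this zero set, the polynomial is non-zero and has finitely many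
roots, so points near the other end can be chosen off the zero set. -/
theorem closure_punctured_disc :
    closure {u : EuclideanSpace ℝ (Fin 3) | ‖u‖ ≤ 1 ∧ u 1 = -3 * u 0 ∧
        u 1 ≠ u 0 ∧ u 1 ≠ -u 0 ∧ u 1 ^ 2 + 2 * u 0 ^ 2 + u 2 ^ 2 ≠ 1} =
      {u | ‖u‖ ≤ 1 ∧ u 1 = -3 * u 0} := by
  apply subset_antisymm
  · refine closure_minimal (fun u hu => ⟨hu.1, hu.2.1⟩) ?_
    have c1 : IsClosed {u : EuclideanSpace ℝ (Fin 3) | ‖u‖ ≤ 1} :=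
      isClosed_le continuous_norm continuous_const
    have c2 : IsClosed {u : EuclideanSpace ℝ (Fin 3) | u 1 = -3 * u 0} :=
      isClosed_eq (by fun_prop) (by fun_prop)
    exact c1.inter c2
  · rintro u ⟨h0, h1⟩
    -- A point of the disc at which the polynomial does not vanish: u₀ ≠ 0 and 11u₀² = 11/100 ≠ 1.
    let e : EuclideanSpace ℝ (Fin 3) := !₂[1 / 10, -3 / 10, 0]
    have he : ‖e‖ ≤ 1 := by
      have : ‖e‖ ^ 2 = 1 / 10 := by
        rw [norm_sq_three]; simp [e]; norm_num
      nlinarith [norm_nonneg e]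
    let w : ℝ → EuclideanSpace ℝ (Fin 3) := fun t => (1 - t) • u + t • e
    have hw : Continuous w := by fun_prop
    -- The defining polynomial along the segment `w`; the coefficient 11 is 9 + 2, from u₁² + 2u₀²
    -- with u₁ = -3u₀.
    let P : Polynomial ℝ := (Polynomial.C (u 0) + Polynomial.X * Polynomial.C (1 / 10 - u 0)) *
      (Polynomial.C 11 * (Polynomial.C (u 0) + Polynomial.X * Polynomial.C (1 / 10 - u 0)) ^ 2
        + ((1 - Polynomial.X) * Polynomial.C (u 2)) ^ 2 - 1)
    have hP : P ≠ 0 := by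
      intro h
      have := congrArg (Polynomial.eval 1) h
      simp [P] at this
      norm_num at this
    have hev : ∀ᶠ t in 𝓝[>] (0 : ℝ), w t ∈ {u : EuclideanSpace ℝ (Fin 3) | ‖u‖ ≤ 1 ∧
        u 1 = -3 * u 0 ∧ u 1 ≠ u 0 ∧ u 1 ≠ -u 0 ∧ u 1 ^ 2 + 2 * u 0 ^ 2 + u 2 ^ 2 ≠ 1} := by
      -- The root 0 is taken out of the finite set to be avoided, because `u` itself may be one of
      -- the removed points; right neighbourhoods do not contain it anyway.
      have hroot : ∀ᶠ t in 𝓝[>] (0 : ℝ), t ∉ {t | P.IsRoot t} \ {0} :=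
        nhdsWithin_le_nhds (((Polynomial.finite_setOfPred_isRoot hP).subset
          Set.sdiff_subset).isClosed.isOpen_compl.mem_nhds fun h => h.2 rfl)
      filter_upwards [hroot, Ioc_mem_nhdsGT one_pos] with t ht2 ht1
      have ht : ¬ P.IsRoot t := fun h => ht2 ⟨h, ht1.1.ne'⟩
      have w0 : w t 0 = u 0 + t * (1 / 10 - u 0) := by simp [w, e]; ring
      have w1 : w t 1 = -3 * w t 0 := by rw [w0]; simp [w, e, h1]; ring
      have w2 : w t 2 = (1 - t) * u 2 := by simp [w, e]
      have hne : w t 0 * (11 * w t 0 ^ 2 + w t 2 ^ 2 - 1) ≠ 0 := by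
        rw [w0, w2]
        simpa [P, Polynomial.IsRoot] using ht
      obtain ⟨n1, n2⟩ := mul_ne_zero_iff.1 hne
      refine ⟨?_, w1, ?_, ?_, ?_⟩
      · exact mem_closedBall_zero_iff.1 ((convex_closedBall (0 : EuclideanSpace ℝ (Fin 3)) 1)
          (mem_closedBall_zero_iff.2 h0) (mem_closedBall_zero_iff.2 he)
          (by linarith [ht1.2]) ht1.1.le (by ring))
      · rw [w1]; exact fun h => n1 (by linarith)
      · rw [w1]; exact fun h => n1 (by linarith)
      · rw [w1]; exact fun h => n2 (by linarith)
    refine mem_closure_of_tendsto (f := w) (b := 𝓝[>] (0 : ℝ)) ?_ hev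
    have : Filter.Tendsto w (𝓝 0) (𝓝 (w 0)) := hw.tendsto 0
    simpa [w] using this.mono_left nhdsWithin_le_nhds

/-- The intersection of the closed unit ball with the plane `α₊ = -3α₊'` is a closed disc. -/
def discHomeo : {u : EuclideanSpace ℝ (Fin 3) | ‖u‖ ≤ 1 ∧ u 1 = -3 * u 0} ≃ₜ
    Metric.closedBall (0 : EuclideanSpace ℝ (Fin 2)) 1 where
  -- The vector (1, -3) has length √10, so this is an isometric coordinate on the plane.
  toFun u := ⟨!₂[√10 * u.1 0, u.1 2], by
    obtain ⟨u, h0, h1⟩ := u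
    have h10 : √10 ^ 2 = 10 := Real.sq_sqrt (by norm_num)
    rw [mem_closedBall_zero_iff, ← sq_le_one_iff₀ (norm_nonneg _),
      EuclideanSpace.real_norm_sq_eq, Fin.sum_univ_two]
    rw [← sq_le_one_iff₀ (norm_nonneg _), norm_sq_three, h1] at h0
    simp [mul_pow, h10]
    linarith⟩
  invFun v := ⟨!₂[v.1 0 / √10, -3 * (v.1 0 / √10), v.1 1], by
    obtain ⟨v, hv⟩ := v
    have h10 : √10 ^ 2 = 10 := Real.sq_sqrt (by norm_num)
    rw [mem_closedBall_zero_iff, ← sq_le_one_iff₀ (norm_nonneg _),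
      EuclideanSpace.real_norm_sq_eq, Fin.sum_univ_two] at hv
    refine ⟨?_, rfl⟩
    rw [← sq_le_one_iff₀ (norm_nonneg _), norm_sq_three]
    simp [mul_pow, div_pow, h10]
    linarith⟩
  left_inv u := by
    obtain ⟨u, h0, h1⟩ := u
    ext k
    fin_cases k <;> simp [h1]
  right_inv v := by
    ext k
    fin_cases k <;> simp <;> field_simp
  continuous_toFun := by
    refine Continuous.subtype_mk ((PiLp.continuous_toLp 2 _).comp (continuous_pi fun k => ?_)) _
    fin_cases k <;> simp <;> fun_prop
  continuous_invFun := by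
    refine Continuous.subtype_mk ((PiLp.continuous_toLp 2 _).comp (continuous_pi fun k => ?_)) _
    fin_cases k <;> simp <;> fun_prop

theorem image_compactifiedSusyModuli
    (key : ∀ p : Param, ¬ Decomposable p ∧ IsGeometricSupersymmetry p ↔
      (∀ i, a p i ≠ 0) ∧ p 2 = -3 * p 1) :
    (fun z => (configurationsHomeo z : EuclideanSpace ℝ (Fin 3))) '' compactifiedSusyModuli =
      {u | ‖u‖ ≤ 1 ∧ u 1 = -3 * u 0} := by
  rw [compactifiedSusyModuli, ← isClosedEmbedding_configurationsHomeo.closure_image_eq,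
    image_susyModuli key, closure_punctured_disc]

theorem nonempty_homeo_disc
    (key : ∀ p : Param, ¬ Decomposable p ∧ IsGeometricSupersymmetry p ↔
      (∀ i, a p i ≠ 0) ∧ p 2 = -3 * p 1) :
    Nonempty (compactifiedSusyModuli ≃ₜ
      Metric.closedBall (0 : EuclideanSpace ℝ (Fin 2)) 1) :=
  ⟨((isClosedEmbedding_configurationsHomeo.isEmbedding.homeomorphImage _).trans
    (Homeomorph.setCongr (image_compactifiedSusyModuli key))).trans discHomeo⟩

/-! ## Decomposability -/

/-- If B kills e_i, the whole holonomy algebra does too, and the spacelike line of e_i is a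
non-degenerate invariant subspace. -/
theorem decomposable_of_a_eq_zero {p : Param} {i : Fin 9} (h : a p i = 0) : Decomposable p := by
  refine ⟨Submodule.span ℝ {Pi.single (Sum.inr i) 1}, ?_, ?_, ?_, ?_⟩
  · simp
  · intro ht
    have : (Pi.single ip 1 : Idx → ℝ) ∈ Submodule.span ℝ {(Pi.single (Sum.inr i) 1 : Idx → ℝ)} := by
      rw [ht]; trivial
    obtain ⟨c, hc⟩ := Submodule.mem_span_singleton.1 this
    simpa using congrFun hc ip
  · intro v u hu
    obtain ⟨c, rfl⟩ := Submodule.mem_span_singleton.1 hu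
    have : holonomy p v (c • Pi.single (Sum.inr i) 1) = 0 := by
      ext k
      rcases k with k | k
      · fin_cases k <;> simp [holonomy, Pi.single_apply, B, h]
      · simp [holonomy]
    rw [this]; exact Submodule.zero_mem _
  · intro u hu h'
    obtain ⟨c, rfl⟩ := Submodule.mem_span_singleton.1 hu
    have := h' _ (Submodule.mem_span_singleton_self _)
    simp [lorentz, Pi.single_apply] at this
    simp [this]

/-- Two cases, according to whether U meets the complement of {u₋ = 0}. If it does not, any vector
of U with a component along V produces e₊ ∈ U, which is orthogonal to U; so U lies on the null line
of e₊ and is zero by non-degeneracy. If it does, the holonomy generates e₊, then all e_i, then e₋,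
and U is everything. -/
theorem not_decomposable {p : Param} (h : ∀ i, a p i ≠ 0) : ¬ Decomposable p := by
  rintro ⟨U, hb, ht, hi, hn⟩
  have hB : ∀ i, B p i ≠ 0 := fun i => neg_ne_zero.2 (pow_ne_zero 2 (h i))
  have hz : ∀ u i, holonomy p (Pi.single i 1) u =
      -(B p i * u (Sum.inr i)) • Pi.single ip 1 + (u im * B p i) • Pi.single (Sum.inr i) 1 := by
    intro u i
    ext k
    rcases k with k | k
    · fin_cases k <;> simp [holonomy, Pi.single_apply]
    · by_cases hk : k = i <;> simp [holonomy, Pi.single_apply, hk]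
  by_cases h0 : ∀ u ∈ U, u im = 0
  · have h1 : ∀ u ∈ U, ∀ i, u (Sum.inr i) = 0 := by
      intro u hu i
      by_contra hne
      have h2 := hi (Pi.single i 1) u hu
      rw [hz, h0 u hu, zero_mul, zero_smul, add_zero,
        U.smul_mem_iff (neg_ne_zero.2 (mul_ne_zero (hB i) hne))] at h2
      have h3 := hn _ h2 fun u' hu' => by simp [lorentz, h0 u' hu']
      simpa using congrFun h3 ip
    refine hb ((Submodule.eq_bot_iff _).2 fun u hu => hn u hu fun u' hu' => ?_)
    simp [lorentz, h0 u hu, h0 u' hu', h1 u hu]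
  · push Not at h0
    obtain ⟨u, hu, hne⟩ := h0
    have hm : ∀ i, -(B p i * u (Sum.inr i)) • Pi.single ip 1
        + (u im * B p i) • Pi.single (Sum.inr i) 1 ∈ U := fun i => hz u i ▸ hi _ u hu
    -- A second application of the holonomy kills the e₊ term of `hm 0` and turns its e₀ term into a
    -- non-zero multiple of e₊.
    have hp : (Pi.single ip 1 : Idx → ℝ) ∈ U := by
      have h2 := hi (Pi.single 0 1) _ (hm 0)
      rw [hz] at h2
      simp at h2
      rwa [U.smul_mem_iff] at h2
      exact mul_ne_zero (hB 0) (mul_ne_zero hne (hB 0))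
    have hv : ∀ i, (Pi.single (Sum.inr i) 1 : Idx → ℝ) ∈ U := fun i => by
      have h2 := (U.add_mem_iff_right (U.smul_mem _ hp)).1 (hm i)
      rwa [U.smul_mem_iff (mul_ne_zero hne (hB i))] at h2
    have hmm : (Pi.single im 1 : Idx → ℝ) ∈ U := by
      have h2 : u = u ip • Pi.single ip 1 + u im • Pi.single im 1
          + ∑ i, u (Sum.inr i) • Pi.single (Sum.inr i) 1 := by
        ext k
        rcases k with k | k
        · fin_cases k <;> simp
        · simp [Pi.single_apply]
      rw [h2, U.add_mem_iff_left (U.sum_mem fun i _ => U.smul_mem _ (hv i)),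
        U.add_mem_iff_right (U.smul_mem _ hp), U.smul_mem_iff hne] at hu
      exact hu
    refine ht (top_le_iff.1 ?_)
    rw [← (Pi.basisFun ℝ Idx).span_eq, Submodule.span_le]
    rintro _ ⟨k, rfl⟩
    rw [Pi.basisFun_apply]
    rcases k with k | k
    · fin_cases k
      · exact hp
      · exact hmm
    · exact hv k

theorem not_decomposable_iff (p : Param) : ¬ Decomposable p ↔ ∀ i, a p i ≠ 0 :=
  ⟨fun h _ hi => h (decomposable_of_a_eq_zero hi), not_decomposable⟩

/-! ## The even part in coordinates -/

/-- The solution `cosh(a_i t) u_i - a_i sinh(a_i t) v_i` of `f'' = a_i² f`. -/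
def prof (p : Param) (u v : Fin 9 → ℂ) (i : Fin 9) (t : ℝ) : ℂ :=
  ((Real.cosh (a p i * t) : ℝ) : ℂ) * u i - (a p i : ℂ) * ((Real.sinh (a p i * t) : ℝ) : ℂ) * v i

/-- The function `i ↦ -a_i² v_i`. -/
def negSq (p : Param) (v : Fin 9 → ℂ) : Fin 9 → ℂ := fun i => -(a p i : ℂ) ^ 2 * v i

/-- Differentiation sends the data (u, v) to (-a²v, -u), so derivatives of profiles are again
profiles. Throughout, `prof p (negSq p v) (-u)` stands for the time derivative of `prof p u v`. -/
theorem hasDerivAt_prof (p : Param) (u v : Fin 9 → ℂ) (i : Fin 9) (t : ℝ) :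
    HasDerivAt (prof p u v i) (prof p (negSq p v) (-u) i t) t := by
  have h0 : HasDerivAt (fun t => a p i * t) (a p i) t := by
    simpa using (hasDerivAt_id t).const_mul (a p i)
  have h1 := (h0.cosh.ofReal_comp.mul_const (u i)).sub
    ((h0.sinh.ofReal_comp.const_mul (a p i : ℂ)).mul_const (v i))
  refine h1.congr_deriv ?_
  simp only [prof, negSq, Pi.neg_apply]
  push_cast
  ring

theorem prof_negSq_neg (p : Param) (u v : Fin 9 → ℂ) (i : Fin 9) (t : ℝ) :
    prof p (negSq p (-u)) (-negSq p v) i t = (a p i : ℂ) ^ 2 * prof p u v i t := by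
  simp only [prof, negSq, Pi.neg_apply]
  ring

/-- Coordinates of the even part: the coefficients of `∂₊`, `∂₋`, `K_(i)`, `K_(i*)`, and the skew
matrix of a linear vector field. -/
@[ext] structure Even where
  cp : ℂ
  cm : ℂ
  u : Fin 9 → ℂ
  v : Fin 9 → ℂ
  m : Matrix (Fin 9) (Fin 9) ℂ

/-- The linear part is skew and preserves the blocks. -/
structure Even.Valid (A : Even) : Prop where
  skew : ∀ i j, A.m j i = -A.m i j
  off : ∀ i j, block i ≠ block j → A.m i j = 0

theorem a_eq_of_block (p : Param) {i j : Fin 9} (h : block i = block j) : a p i = a p j := by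
  fin_cases i <;> fin_cases j <;> first | rfl | exact absurd h (by decide)

/-- The numbers a_i are constant on blocks, so a block-preserving matrix commutes with diag(a). The
entrywise form serves as a coefficient relation for `linear_combination`. -/
theorem Even.Valid.mul_a {A : Even} (hA : A.Valid) (p : Param) (i j : Fin 9) :
    A.m i j * (a p j : ℂ) = A.m i j * (a p i : ℂ) := by
  by_cases h : block i = block j
  · rw [a_eq_of_block p h]
  · rw [hA.off i j h, zero_mul, zero_mul]

theorem Even.Valid.mul_prof {A : Even} (hA : A.Valid) (p : Param) (u v : Fin 9 → ℂ)
    (i j : Fin 9) (t : ℝ) :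
    A.m i j * prof p u v j t =
      A.m i j * (((Real.cosh (a p i * t) : ℝ) : ℂ) * u j
        - (a p i : ℂ) * ((Real.sinh (a p i * t) : ℝ) : ℂ) * v j) := by
  by_cases h : block i = block j
  · rw [prof, a_eq_of_block p h]
  · rw [hA.off i j h, zero_mul, zero_mul]

theorem Even.Valid.sum_mul_prof {A : Even} (hA : A.Valid) (p : Param) (u v : Fin 9 → ℂ)
    (i : Fin 9) (t : ℝ) :
    ∑ j, A.m i j * prof p u v j t = prof p (A.m.mulVec u) (A.m.mulVec v) i t := by
  rw [Finset.sum_congr rfl fun j _ => hA.mul_prof p u v i j t]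
  simp only [prof, Matrix.mulVec, dotProduct, Finset.mul_sum, ← Finset.sum_sub_distrib]
  exact Finset.sum_congr rfl fun j _ => by ring

theorem Even.Valid.negSq_mulVec {A : Even} (hA : A.Valid) (p : Param) (v : Fin 9 → ℂ) :
    negSq p (A.m.mulVec v) = A.m.mulVec (negSq p v) := by
  ext i
  simp only [negSq, Matrix.mulVec, dotProduct, Finset.mul_sum]
  refine Finset.sum_congr rfl fun j _ => ?_
  have := hA.mul_a p i j
  linear_combination (v j * (a p j + a p i)) * this

/-- Since m commutes with diag(a²) and is skew, diag(a²)m is skew as well. This is the invariance of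
B under rotations within the blocks; it cancels the terms quadratic in x in Killing's equation and
in the covariant derivative. -/
theorem Even.Valid.quadratic_eq_zero {A : Even} (hA : A.Valid) (p : Param) (x : Fin 9 → ℂ) :
    ∑ i, ∑ j, (a p i : ℂ) ^ 2 * A.m i j * x i * x j = 0 := by
  have h : ∑ i, ∑ j, (a p i : ℂ) ^ 2 * A.m i j * x i * x j
      = -∑ i, ∑ j, (a p i : ℂ) ^ 2 * A.m i j * x i * x j := by
    conv_lhs => rw [Finset.sum_comm]
    simp only [← Finset.sum_neg_distrib]
    refine Finset.sum_congr rfl fun i _ => Finset.sum_congr rfl fun j _ => ?_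
    have := hA.mul_a p i j
    rw [hA.skew i j]
    linear_combination (-x i * x j * (a p j + a p i)) * this
  linear_combination (1 / 2 : ℂ) * h

/-- The vector field with given coordinates. -/
def field (p : Param) (A : Even) : VF := fun x =>
  Sum.elim ![A.cp - ∑ i, (x (Sum.inr i) : ℂ) * prof p (negSq p A.v) (-A.u) i (x im), A.cm]
    (fun i => prof p A.u A.v i (x im) + ∑ j, A.m i j * (x (Sum.inr j) : ℂ))

/-- The partial derivatives of the components of `field p A`. -/
def dfield (p : Param) (A : Even) (x : Pt) : Idx → Idx → ℂ :=
  Sum.elim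
    ![0, Sum.elim ![-∑ i, (x (Sum.inr i) : ℂ) * ((a p i : ℂ) ^ 2 * prof p A.u A.v i (x im)), 0]
      (fun i => prof p (negSq p A.v) (-A.u) i (x im))]
    (fun j => Sum.elim ![-prof p (negSq p A.v) (-A.u) j (x im), 0] (fun i => A.m i j))

theorem pd_eq_of_hasDerivAt {E : Type*} [NormedAddCommGroup E] [NormedSpace ℝ E] {μ : Idx}
    {f : Pt → E} {x : Pt} {f' : E}
    (h : HasDerivAt (fun t : ℝ => f (Function.update x μ t)) f' (x μ)) : pd μ f x = f' :=
  h.deriv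

theorem hasDerivAt_coord (x : Pt) (i j : Fin 9) :
    HasDerivAt (fun t : ℝ => ((Function.update x (Sum.inr j) t (Sum.inr i) : ℝ) : ℂ))
      (if i = j then 1 else 0) (x (Sum.inr j)) := by
  by_cases h : i = j
  · subst h
    simpa using (hasDerivAt_id (x (Sum.inr i))).ofReal_comp
  · have : (Sum.inr i : Idx) ≠ Sum.inr j := fun h' => h (Sum.inr_injective h')
    simpa [h, this] using hasDerivAt_const (x (Sum.inr j)) ((x (Sum.inr i) : ℝ) : ℂ)

theorem hasDerivAt_sum_coord (x : Pt) (c : Fin 9 → ℂ) (j : Fin 9) :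
    HasDerivAt (fun t : ℝ => ∑ i, ((Function.update x (Sum.inr j) t (Sum.inr i) : ℝ) : ℂ) * c i)
      (c j) (x (Sum.inr j)) := by
  have := HasDerivAt.fun_sum (u := Finset.univ)
    fun i _ => (hasDerivAt_coord x i j).mul_const (c i)
  simpa using this

theorem pd_field (p : Param) (A : Even) (x : Pt) (μ ν : Idx) :
    pd μ (fun y => field p A y ν) x = dfield p A x μ ν := by
  apply pd_eq_of_hasDerivAt
  rcases μ with μ | j
  · fin_cases μ
    · change HasDerivAt (fun t => field p A (Function.update x ip t) ν) 0 (x ip)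
      have h : (fun t => field p A (Function.update x ip t) ν) = fun _ => field p A x ν := by
        funext t; rcases ν with ν | i
        · fin_cases ν <;> simp [field]
        · simp [field]
      rw [h]
      exact hasDerivAt_const _ _
    · rcases ν with ν | i
      · fin_cases ν
        · have := (HasDerivAt.fun_sum (u := Finset.univ) fun i _ =>
            (hasDerivAt_prof p (negSq p A.v) (-A.u) i (x im)).const_mul
              (x (Sum.inr i) : ℂ)).const_sub A.cp
          simp only [prof_negSq_neg] at this
          simpa [field, dfield] using this
        · simpa [field, dfield] using hasDerivAt_const (x im) A.cm
      · simpa [field, dfield] using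
          (hasDerivAt_prof p A.u A.v i (x im)).add_const (∑ j, A.m i j * (x (Sum.inr j) : ℂ))
  · rcases ν with ν | i
    · fin_cases ν
      · simpa [field, dfield] using (hasDerivAt_sum_coord x
          (fun i => prof p (negSq p A.v) (-A.u) i (x im)) j).const_sub A.cp
      · simpa [field, dfield] using hasDerivAt_const (x (Sum.inr j)) A.cm
    · simpa [field, dfield, mul_comm] using
        (hasDerivAt_sum_coord x (A.m i) j).const_add (prof p A.u A.v i (x im))

theorem sum_idx {M : Type*} [AddCommMonoid M] (f : Idx → M) :
    ∑ μ, f μ = f ip + f im + ∑ i, f (Sum.inr i) := by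
  rw [Fintype.sum_sum_type, Fin.sum_univ_two]

/-- The Lie bracket of the even part in coordinates. -/
def brk (p : Param) (A A' : Even) : Even where
  cp := ∑ i, (a p i : ℂ) ^ 2 * (A.u i * A'.v i - A.v i * A'.u i)
  cm := 0
  u := A.cm • negSq p A'.v - A'.cm • negSq p A.v + A'.m.mulVec A.u - A.m.mulVec A'.u
  v := -(A.cm • A'.u) + A'.cm • A.u + A'.m.mulVec A.v - A.m.mulVec A'.v
  m := A'.m * A.m - A.m * A'.m

theorem brk_valid {p : Param} {A A' : Even} (hA : A.Valid) (hA' : A'.Valid) :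
    (brk p A A').Valid where
  skew i j := by
    simp only [brk, Matrix.sub_apply, Matrix.mul_apply, ← Finset.sum_sub_distrib,
      ← Finset.sum_neg_distrib]
    refine Finset.sum_congr rfl fun k _ => ?_
    rw [hA.skew k i, hA.skew j k, hA'.skew k i, hA'.skew j k]; ring
  off i j h := by
    simp only [brk, Matrix.sub_apply, Matrix.mul_apply]
    rw [Finset.sum_eq_zero, Finset.sum_eq_zero, sub_zero] <;>
    · intro k _
      by_cases h1 : block i = block k
      · rw [mul_comm, Even.Valid.off ‹_› k j (h1 ▸ h), zero_mul]
      · rw [Even.Valid.off ‹_› i k h1, zero_mul]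

/-- The Wronskian of two solutions of f'' = a²f is constant. This is why the bracket of the fields
K_(i), K_(i*) is a constant multiple of ∂₊. -/
theorem prof_wronskian (p : Param) (u v u' v' : Fin 9 → ℂ) (i : Fin 9) (t : ℝ) :
    prof p u' v' i t * prof p (negSq p v) (-u) i t - prof p u v i t * prof p (negSq p v') (-u') i t
      = (a p i : ℂ) ^ 2 * (u i * v' i - v i * u' i) := by
  have h : ((Real.cosh (a p i * t) : ℝ) : ℂ) ^ 2 - ((Real.sinh (a p i * t) : ℝ) : ℂ) ^ 2 = 1 := by
    exact_mod_cast Real.cosh_sq_sub_sinh_sq (a p i * t)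
  simp only [prof, negSq, Pi.neg_apply]
  linear_combination ((a p i : ℂ) ^ 2 * (u i * v' i - v i * u' i)) * h

theorem prof_add (p : Param) (u v u' v' : Fin 9 → ℂ) (i : Fin 9) (t : ℝ) :
    prof p (u + u') (v + v') i t = prof p u v i t + prof p u' v' i t := by
  simp only [prof, Pi.add_apply]; ring

theorem prof_smul (p : Param) (c : ℂ) (u v : Fin 9 → ℂ) (i : Fin 9) (t : ℝ) :
    prof p (c • u) (c • v) i t = c * prof p u v i t := by
  simp only [prof, Pi.smul_apply, smul_eq_mul]; ring

theorem prof_sub (p : Param) (u v u' v' : Fin 9 → ℂ) (i : Fin 9) (t : ℝ) :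
    prof p (u - u') (v - v') i t = prof p u v i t - prof p u' v' i t := by
  simp only [prof, Pi.sub_apply]; ring

theorem negSq_add (p : Param) (v w : Fin 9 → ℂ) : negSq p (v + w) = negSq p v + negSq p w := by
  ext i; simp only [negSq, Pi.add_apply]; ring

theorem negSq_sub (p : Param) (v w : Fin 9 → ℂ) : negSq p (v - w) = negSq p v - negSq p w := by
  ext i; simp only [negSq, Pi.sub_apply]; ring

theorem negSq_smul (p : Param) (c : ℂ) (v : Fin 9 → ℂ) : negSq p (c • v) = c • negSq p v := by
  ext i; simp only [negSq, Pi.smul_apply, smul_eq_mul]; ring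

theorem negSq_neg (p : Param) (v : Fin 9 → ℂ) : negSq p (-v) = -negSq p v := by
  ext i; simp only [negSq, Pi.neg_apply]; ring

/-- The V-component of a commutator has three sources: ∂₋ differentiates profiles, and each linear
part acts on the other profile by its matrix. All results are profiles, so they can be read off from
the data of `brk`. -/
theorem prof_brk (p : Param) {A A' : Even} (hA : A.Valid) (hA' : A'.Valid) (i : Fin 9) (t : ℝ) :
    prof p (brk p A A').u (brk p A A').v i t =
      A.cm * prof p (negSq p A'.v) (-A'.u) i t - A'.cm * prof p (negSq p A.v) (-A.u) i t
        + ∑ j, A'.m i j * prof p A.u A.v j t - ∑ j, A.m i j * prof p A'.u A'.v j t := by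
  have h : (brk p A A').v = A.cm • (-A'.u) - A'.cm • (-A.u) + A'.m.mulVec A.v
      - A.m.mulVec A'.v := by
    simp only [brk]; module
  rw [hA.sum_mul_prof, hA'.sum_mul_prof, h, ← prof_smul, ← prof_smul, ← prof_sub, ← prof_add,
    ← prof_sub]
  rfl

/-- The time derivative of `prof_brk`, obtained on the level of data; it needs that the matrices
commute with diag(a²). -/
theorem prof_brk_deriv (p : Param) {A A' : Even} (hA : A.Valid) (hA' : A'.Valid) (i : Fin 9)
    (t : ℝ) :
    prof p (negSq p (brk p A A').v) (-(brk p A A').u) i t =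
      A.cm * ((a p i : ℂ) ^ 2 * prof p A'.u A'.v i t)
        - A'.cm * ((a p i : ℂ) ^ 2 * prof p A.u A.v i t)
        + ∑ j, A'.m i j * prof p (negSq p A.v) (-A.u) j t
        - ∑ j, A.m i j * prof p (negSq p A'.v) (-A'.u) j t := by
  rw [hA.sum_mul_prof, hA'.sum_mul_prof, ← prof_negSq_neg, ← prof_negSq_neg, ← prof_smul,
    ← prof_smul, ← prof_sub, ← prof_add, ← prof_sub]
  congr 1
  · simp only [brk, negSq_sub, negSq_add, negSq_smul, negSq_neg, hA.negSq_mulVec,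
      hA'.negSq_mulVec]
    module
  · simp only [brk, Matrix.mulVec_neg]
    module

theorem sum_mul_sum_skew {A : Even} (hA : A.Valid) (x h : Fin 9 → ℂ) :
    ∑ j, (∑ k, A.m j k * x k) * h j = -∑ k, x k * ∑ j, A.m k j * h j := by
  simp only [Finset.sum_mul, Finset.mul_sum]
  rw [Finset.sum_comm, ← Finset.sum_neg_distrib]
  refine Finset.sum_congr rfl fun k _ => ?_
  rw [← Finset.sum_neg_distrib]
  exact Finset.sum_congr rfl fun j _ => by rw [hA.skew k j]; ring

theorem sum_sum_mul_eq (M N : Matrix (Fin 9) (Fin 9) ℂ) (y : Fin 9 → ℂ) (i : Fin 9) :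
    ∑ j, (∑ k, M j k * y k) * N i j = ∑ k, (N * M) i k * y k := by
  simp only [Matrix.mul_apply, Finset.sum_mul]
  rw [Finset.sum_comm]
  exact Finset.sum_congr rfl fun k _ => Finset.sum_congr rfl fun j _ => by ring

/-- In the ∂₊-component the terms free of the factors xⁱ form a Wronskian, and those linear in x are
the derivative of the bracket's profile. The linear parts contribute there through skewness, and to
the V-component by the matrix commutator in reversed order. -/
theorem lieBr_field (p : Param) {A A' : Even} (hA : A.Valid) (hA' : A'.Valid) :
    lieBr (field p A) (field p A') = field p (brk p A A') := by
  funext x ν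
  simp only [lieBr, pd_field]
  rw [sum_idx]
  rcases ν with ν | i
  · fin_cases ν
    · simp only [field, dfield, Sum.elim_inl, Sum.elim_inr, Matrix.cons_val, Fin.zero_eta,
        prof_brk_deriv p hA hA', Pi.zero_apply]
      have h1 := sum_mul_sum_skew hA (fun k => (x (Sum.inr k) : ℂ))
        (fun j => prof p (negSq p A'.v) (-A'.u) j (x im))
      have h2 := sum_mul_sum_skew hA' (fun k => (x (Sum.inr k) : ℂ))
        (fun j => prof p (negSq p A.v) (-A.u) j (x im))
      have h3 : (brk p A A').cp = ∑ i, (prof p A'.u A'.v i (x im) *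
          prof p (negSq p A.v) (-A.u) i (x im) - prof p A.u A.v i (x im) *
          prof p (negSq p A'.v) (-A'.u) i (x im)) :=
        by simp only [brk, prof_wronskian]
      rw [h3]
      simp only [mul_sub, mul_add, add_mul, mul_neg, Finset.sum_sub_distrib,
        Finset.sum_add_distrib, Finset.sum_neg_distrib, sub_neg_eq_add] at h1 h2 ⊢
      rw [h1, h2]
      simp only [Finset.mul_sum, mul_left_comm]
      ring
    · simp [field, dfield, brk]
  · simp only [field, dfield, Sum.elim_inl, Sum.elim_inr, Matrix.cons_val, Pi.zero_apply,
      prof_brk p hA hA']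
    simp only [brk, Matrix.sub_apply, sub_mul, add_mul, Finset.sum_sub_distrib,
      Finset.sum_add_distrib, sum_sum_mul_eq]
    simp only [mul_comm (A.m i _), mul_comm (A'.m i _)]
    ring

/-! ### The Killing equation -/

/-- The partial derivatives `∂_σ g_{μν}` of the metric. -/
def dmetric (p : Param) (x : Pt) (σ μ ν : Idx) : ℝ :=
  Sum.elim (fun _ => 0) (fun j => if μ = im ∧ ν = im then -2 * B p j * x (Sum.inr j) else 0) σ

theorem hasDerivAt_metric (p : Param) (x : Pt) (σ μ ν : Idx) :
    HasDerivAt (fun t => metric p (Function.update x σ t) μ ν) (dmetric p x σ μ ν) (x σ) := by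
  have hc : (fun t => metric p (Function.update x σ t) μ ν) = (fun _ => metric p x μ ν) →
      HasDerivAt (fun t => metric p (Function.update x σ t) μ ν) 0 (x σ) := fun h => by
    rw [h]; exact hasDerivAt_const _ _
  rcases σ with k | j
  · exact hc (by funext t; simp [metric])
  simp only [dmetric, Sum.elim_inr]
  by_cases h : μ = im ∧ ν = im
  · obtain ⟨rfl, rfl⟩ := h
    have h1 : ∀ i, HasDerivAt (fun t : ℝ => Function.update x (Sum.inr j) t (Sum.inr i))
        (if i = j then 1 else 0) (x (Sum.inr j)) := by
      intro i
      by_cases h : i = j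
      · subst h
        simpa using hasDerivAt_id' (x (Sum.inr i))
      · have : (Sum.inr i : Idx) ≠ Sum.inr j := fun h' => h (Sum.inr_injective h')
        simpa [h, this] using hasDerivAt_const (x (Sum.inr j)) (x (Sum.inr i))
    have h2 := (HasDerivAt.fun_sum (u := Finset.univ)
      fun i _ => ((h1 i).fun_pow 2).const_mul (B p i)).fun_neg
    simp only [metric, Matrix.fromBlocks_apply₁₁, and_self, if_true]
    refine h2.congr_deriv ?_
    simp
    ring
  · rw [if_neg h]
    refine hc (funext fun t => ?_)
    rcases μ with μ | i <;> rcases ν with ν | k <;> simp only [metric, Matrix.fromBlocks_apply₁₁,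
      Matrix.fromBlocks_apply₁₂, Matrix.fromBlocks_apply₂₁, Matrix.fromBlocks_apply₂₂]
    fin_cases μ <;> fin_cases ν <;> first | rfl | exact absurd ⟨rfl, rfl⟩ h

theorem pd_metric (p : Param) (x : Pt) (σ μ ν : Idx) :
    pd σ (fun y => metric p y μ ν) x = dmetric p x σ μ ν :=
  pd_eq_of_hasDerivAt (hasDerivAt_metric p x σ μ ν)

theorem pd_metric_complex (p : Param) (x : Pt) (σ μ ν : Idx) :
    pd σ (fun y => (metric p y μ ν : ℂ)) x = dmetric p x σ μ ν :=
  pd_eq_of_hasDerivAt (hasDerivAt_metric p x σ μ ν).ofReal_comp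

/-- The (-,i) components cancel because the ∂₊-coefficient carries minus the derivative of the
profile, and the (i,j) components are the skewness of m. In the (-,-) component the linear terms
cancel by f'' = a²f and the quadratic ones by `quadratic_eq_zero`. -/
theorem isKilling_field (p : Param) {A : Even} (hA : A.Valid) : IsKilling p (field p A) := by
  intro x μ ν
  have h := fun σ => congrArg₂ (· + ·) (congrArg₂ (· + ·)
    (congrArg (field p A x σ * ·) (pd_metric_complex p x σ μ ν))
    (congrArg ((metric p x σ ν : ℂ) * ·) (pd_field p A x μ σ)))
    (congrArg ((metric p x μ σ : ℂ) * ·) (pd_field p A x ν σ))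
  refine (Finset.sum_congr rfl fun σ _ => h σ).trans ?_
  clear h
  rw [sum_idx]
  rcases μ with μ | i <;> rcases ν with ν | k
  · fin_cases μ <;> fin_cases ν
    · simp [dmetric, metric, dfield]
    · simp [dmetric, metric, dfield]
    · simp [dmetric, metric, dfield]
    · have h := hA.quadratic_eq_zero p (fun i => (x (Sum.inr i) : ℂ))
      simp [dmetric, metric, dfield, field, B]
      simp only [add_mul, Finset.sum_add_distrib, Finset.sum_mul]
      have h1 : ∀ i, ∑ j, A.m i j * (x (Sum.inr j) : ℂ) * (2 * (a p i : ℂ) ^ 2 * x (Sum.inr i)) =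
          2 * ∑ j, (a p i : ℂ) ^ 2 * A.m i j * x (Sum.inr i) * x (Sum.inr j) := by
        intro i
        rw [Finset.mul_sum]
        exact Finset.sum_congr rfl fun j _ => by ring
      simp only [h1, ← Finset.mul_sum, h, mul_zero, add_zero]
      rw [← Finset.sum_neg_distrib, ← Finset.sum_add_distrib, ← Finset.sum_add_distrib]
      exact Finset.sum_eq_zero fun i _ => by ring
  · fin_cases μ <;> simp [dmetric, metric, dfield, Matrix.one_apply, apply_ite Complex.ofReal]
  · fin_cases ν <;> simp [dmetric, metric, dfield, Matrix.one_apply, apply_ite Complex.ofReal]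
  · simp [dmetric, metric, dfield, Matrix.one_apply, apply_ite Complex.ofReal,
      Finset.sum_add_distrib, hA.skew i k]

/-! ### Membership in `𝒦₀` -/

theorem coordField_ip_eq (p : Param) : coordField ip = field p ⟨1, 0, 0, 0, 0⟩ := by
  funext x ν
  rcases ν with ν | i
  · fin_cases ν <;> simp [coordField, field, prof, negSq]
  · simp [coordField, field, prof]

theorem coordField_im_eq (p : Param) : coordField im = field p ⟨0, 1, 0, 0, 0⟩ := by
  funext x ν
  rcases ν with ν | i
  · fin_cases ν <;> simp [coordField, field, prof, negSq]
  · simp [coordField, field, prof]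

theorem killV_eq (p : Param) (i : Fin 9) :
    killV p i = field p ⟨0, 0, Pi.single i 1, 0, 0⟩ := by
  funext x ν
  rcases ν with ν | k
  · fin_cases ν <;> simp [killV, field, prof, negSq, Pi.single_apply]
    ring
  · by_cases h : k = i <;> simp [killV, field, prof, Pi.single_apply, h]

theorem killVstar_eq (p : Param) (i : Fin 9) :
    killVstar p i = field p ⟨0, 0, 0, Pi.single i 1, 0⟩ := by
  funext x ν
  rcases ν with ν | k
  · fin_cases ν <;> simp [killVstar, field, prof, negSq, Pi.single_apply]
    ring
  · by_cases h : k = i <;> simp [killVstar, field, prof, Pi.single_apply, h]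

theorem killSO_eq (p : Param) (i j : Fin 9) :
    killSO i j = field p ⟨0, 0, 0, 0, Matrix.single i j 1 - Matrix.single j i 1⟩ := by
  funext x ν
  rcases ν with ν | k
  · fin_cases ν <;> simp [killSO, field, prof, negSq]
  · simp [killSO, field, prof, Pi.single_apply, Matrix.single_apply, sub_mul, ite_and, eq_comm]

theorem field_add (p : Param) (A A' : Even) : field p A + field p A' =
    field p ⟨A.cp + A'.cp, A.cm + A'.cm, A.u + A'.u, A.v + A'.v, A.m + A'.m⟩ := by
  funext x ν
  rcases ν with ν | k
  · fin_cases ν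
    · simp [field, negSq_add, neg_add, -neg_add_rev, prof_add, mul_add, Finset.sum_add_distrib]
      ring
    · simp [field]
  · simp [field, prof_add, add_mul, Finset.sum_add_distrib]
    ring

theorem field_smul (p : Param) (c : ℂ) (A : Even) : c • field p A =
    field p ⟨c * A.cp, c * A.cm, c • A.u, c • A.v, c • A.m⟩ := by
  funext x ν
  rcases ν with ν | k
  · fin_cases ν
    · simp [field, negSq_smul, ← smul_neg, prof_smul, mul_sub, Finset.mul_sum, mul_left_comm]
    · simp [field]
  · simp [field, prof_smul, mul_add, Finset.mul_sum, mul_assoc]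

theorem field_sum_uv (p : Param) (u v : Fin 9 → ℂ) :
    ∑ i, u i • killV p i + ∑ i, v i • killVstar p i = field p ⟨0, 0, u, v, 0⟩ := by
  funext x ν
  rcases ν with ν | k
  · fin_cases ν
    · simp [Finset.sum_apply, killV, killVstar, field, prof, negSq]
      rw [← Finset.sum_neg_distrib, ← Finset.sum_add_distrib, ← Finset.sum_neg_distrib]
      exact Finset.sum_congr rfl fun i _ => by ring
    · simp [Finset.sum_apply, killV, killVstar, field]
  · simp [Finset.sum_apply, killV, killVstar, field, prof, Pi.single_apply]
    ring

theorem field_sum_so (p : Param) (m : Matrix (Fin 9) (Fin 9) ℂ) :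
    ∑ i, ∑ j, m i j • killSO i j = field p ⟨0, 0, 0, 0, m - m.transpose⟩ := by
  funext x ν
  rcases ν with ν | k
  · fin_cases ν <;> simp [Finset.sum_apply, killSO, field, prof, negSq]
  · simp [Finset.sum_apply, killSO, field, prof, Pi.single_apply, mul_sub, sub_mul,
      Finset.sum_sub_distrib]

/-- The factor ½ accounts for each pair of indices occurring twice: summing m_ij K_(ij) gives the
matrix m - mᵗ = 2m. -/
theorem field_eq_sum (p : Param) {A : Even} (hA : A.Valid) :
    field p A = A.cp • coordField ip + A.cm • coordField im
      + ∑ i, A.u i • killV p i + ∑ i, A.v i • killVstar p i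
      + (1 / 2 : ℂ) • ∑ i, ∑ j, A.m i j • killSO i j := by
  rw [add_assoc (_ + _) _ (∑ i, A.v i • killVstar p i), field_sum_uv, field_sum_so p,
    coordField_ip_eq p, coordField_im_eq p]
  simp only [field_smul, field_add]
  refine congrArg (field p) (Even.ext ?_ ?_ ?_ ?_ ?_)
  · simp
  · simp
  · simp
  · simp
  · ext i j
    simp [hA.skew i j]
    ring

/-- The generators are fields with valid data, and valid data are closed under linear combinations;
the converse is the expansion `field_eq_sum`. All statements about 𝒦₀ are reduced to data in this
way. -/
theorem mem_K0_iff (p : Param) (X : VF) : X ∈ K0 p ↔ ∃ A : Even, A.Valid ∧ X = field p A := by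
  constructor
  · intro h
    induction h using Submodule.span_induction with
    | mem X h =>
      rcases h with ((h | ⟨i, rfl⟩) | ⟨i, rfl⟩) | ⟨i, j, hij, rfl⟩
      · rcases h with rfl | rfl
        · exact ⟨_, ⟨by simp, by simp⟩, coordField_ip_eq p⟩
        · exact ⟨_, ⟨by simp, by simp⟩, coordField_im_eq p⟩
      · exact ⟨_, ⟨by simp, by simp⟩, killV_eq p i⟩
      · exact ⟨_, ⟨by simp, by simp⟩, killVstar_eq p i⟩
      · refine ⟨_, ⟨fun k l => ?_, fun k l hkl => ?_⟩, killSO_eq p i j⟩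
        · simp [Matrix.single_apply, and_comm]
        · have h1 : ¬(i = k ∧ j = l) := by rintro ⟨rfl, rfl⟩; exact hkl hij
          have h2 : ¬(j = k ∧ i = l) := by rintro ⟨rfl, rfl⟩; exact hkl hij.symm
          simp [h1, h2]
    | zero => exact ⟨⟨0, 0, 0, 0, 0⟩, ⟨by simp, by simp⟩, by
        have := field_smul p 0 ⟨0, 0, 0, 0, 0⟩; simpa using this⟩
    | add X Y _ _ hX hY =>
      obtain ⟨A, hA, rfl⟩ := hX
      obtain ⟨A', hA', rfl⟩ := hY
      refine ⟨_, ⟨fun i j => ?_, fun i j h => ?_⟩, field_add p A A'⟩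
      · simp [hA.skew i j, hA'.skew i j, add_comm]
      · simp [hA.off i j h, hA'.off i j h]
    | smul c X _ hX =>
      obtain ⟨A, hA, rfl⟩ := hX
      refine ⟨_, ⟨fun i j => ?_, fun i j h => ?_⟩, field_smul p c A⟩
      · simp [hA.skew i j]
      · simp [hA.off i j h]
  · rintro ⟨A, hA, rfl⟩
    rw [field_eq_sum p hA]
    have hs : ∀ X ∈ _, X ∈ K0 p := fun X hX => Submodule.subset_span hX
    refine add_mem (add_mem (add_mem (add_mem ?_ ?_) ?_) ?_) ?_
    · exact Submodule.smul_mem _ _ (hs _ (by simp))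
    · exact Submodule.smul_mem _ _ (hs _ (by simp))
    · exact sum_mem fun i _ => Submodule.smul_mem _ _ (hs _ (by simp))
    · exact sum_mem fun i _ => Submodule.smul_mem _ _ (hs _ (by simp))
    · refine Submodule.smul_mem _ _ (sum_mem fun i _ => sum_mem fun j _ => ?_)
      by_cases h : block i = block j
      · exact Submodule.smul_mem _ _ (hs _ (Or.inr ⟨i, j, h, rfl⟩))
      · rw [hA.off i j h, zero_smul]; exact zero_mem _

/-! ### The Jacobi identity of the even part -/

/-- The bilinear form with matrix `diag(a_i²)`. -/
def sqForm (p : Param) (u w : Fin 9 → ℂ) : ℂ := ∑ i, (a p i : ℂ) ^ 2 * (u i * w i)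

theorem sqForm_comm (p : Param) (u w : Fin 9 → ℂ) : sqForm p u w = sqForm p w u :=
  Finset.sum_congr rfl fun i _ => by ring

theorem sqForm_add_right (p : Param) (u w w' : Fin 9 → ℂ) :
    sqForm p u (w + w') = sqForm p u w + sqForm p u w' := by
  simp only [sqForm, ← Finset.sum_add_distrib, Pi.add_apply]
  exact Finset.sum_congr rfl fun i _ => by ring

theorem sqForm_smul_right (p : Param) (c : ℂ) (u w : Fin 9 → ℂ) :
    sqForm p u (c • w) = c * sqForm p u w := by
  simp only [sqForm, Finset.mul_sum, Pi.smul_apply, smul_eq_mul]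
  exact Finset.sum_congr rfl fun i _ => by ring

theorem sqForm_neg_right (p : Param) (u w : Fin 9 → ℂ) :
    sqForm p u (-w) = -sqForm p u w := by
  simpa using sqForm_smul_right p (-1) u w

theorem sqForm_sub_right (p : Param) (u w w' : Fin 9 → ℂ) :
    sqForm p u (w - w') = sqForm p u w - sqForm p u w' := by
  rw [sub_eq_add_neg, sqForm_add_right, sqForm_neg_right, ← sub_eq_add_neg]

theorem sqForm_negSq (p : Param) (u w : Fin 9 → ℂ) :
    sqForm p u (negSq p w) = sqForm p w (negSq p u) :=
  Finset.sum_congr rfl fun i _ => by simp only [negSq]; ring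

/-- Valid matrices are infinitesimal isometries of `sqForm`, again because they are skew and commute
with diag(a²). -/
theorem Even.Valid.sqForm_mulVec {A : Even} (hA : A.Valid) (p : Param) (u w : Fin 9 → ℂ) :
    sqForm p u (A.m.mulVec w) = -sqForm p w (A.m.mulVec u) := by
  simp only [sqForm, Matrix.mulVec, dotProduct, Finset.mul_sum, ← Finset.sum_neg_distrib]
  rw [Finset.sum_comm]
  refine Finset.sum_congr rfl fun i _ => Finset.sum_congr rfl fun j _ => ?_
  have := hA.mul_a p i j
  rw [hA.skew i j]
  linear_combination (-u j * w i * (a p j + a p i)) * this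

theorem brk_cp (p : Param) (A A' : Even) :
    (brk p A A').cp = sqForm p A.u A'.v - sqForm p A.v A'.u := by
  simp only [brk, sqForm, ← Finset.sum_sub_distrib]
  exact Finset.sum_congr rfl fun i _ => by ring

/-- Checked on data. The ∂₊-component is the cocycle condition for the Heisenberg extension:
rotations preserve `sqForm`, `negSq` is symmetric for it, and so is the form itself. The matrix
component is the Jacobi identity for matrices. -/
theorem lieBr_jacobi (p : Param) {X Y Z : VF} (hX : X ∈ K0 p) (hY : Y ∈ K0 p) (hZ : Z ∈ K0 p) :
    lieBr X (lieBr Y Z) + lieBr Y (lieBr Z X) + lieBr Z (lieBr X Y) = 0 := by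
  obtain ⟨A, hA, rfl⟩ := (mem_K0_iff p X).1 hX
  obtain ⟨A', hA', rfl⟩ := (mem_K0_iff p Y).1 hY
  obtain ⟨A'', hA'', rfl⟩ := (mem_K0_iff p Z).1 hZ
  have hz : (0 : VF) = field p ⟨0, 0, 0, 0, 0⟩ := by
    have := field_smul p 0 ⟨0, 0, 0, 0, 0⟩; simpa using this
  rw [lieBr_field p hA' hA'', lieBr_field p hA'' hA, lieBr_field p hA hA',
    lieBr_field p hA (brk_valid hA' hA''), lieBr_field p hA' (brk_valid hA'' hA),
    lieBr_field p hA'' (brk_valid hA hA'), field_add, field_add, hz]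
  refine congrArg (field p) (Even.ext ?_ ?_ ?_ ?_ ?_)
  · simp only [brk_cp p A, brk_cp p A', brk_cp p A'']
    simp only [brk, sqForm_add_right, sqForm_sub_right, sqForm_smul_right, sqForm_neg_right]
    linear_combination hA.sqForm_mulVec p A'.u A''.v - hA.sqForm_mulVec p A''.u A'.v
      + hA'.sqForm_mulVec p A''.u A.v - hA'.sqForm_mulVec p A.u A''.v
      + hA''.sqForm_mulVec p A.u A'.v - hA''.sqForm_mulVec p A'.u A.v
      - A'.cm * sqForm_comm p A.u A''.u - A'.cm * sqForm_negSq p A.v A''.v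
      + A''.cm * sqForm_comm p A.u A'.u + A''.cm * sqForm_negSq p A.v A'.v
      + A.cm * sqForm_comm p A'.u A''.u + A.cm * sqForm_negSq p A'.v A''.v
  · simp [brk]
  · simp only [brk, negSq_sub, negSq_add, negSq_smul, negSq_neg, hA.negSq_mulVec,
      hA'.negSq_mulVec, hA''.negSq_mulVec, Matrix.mulVec_sub, Matrix.mulVec_add,
      Matrix.mulVec_smul, Matrix.sub_mulVec, ← Matrix.mulVec_mulVec]
    module
  · simp only [brk, negSq_sub, negSq_add, negSq_smul, negSq_neg, hA.negSq_mulVec,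
      hA'.negSq_mulVec, hA''.negSq_mulVec, Matrix.mulVec_sub, Matrix.mulVec_add,
      Matrix.mulVec_smul, Matrix.sub_mulVec, ← Matrix.mulVec_mulVec, Matrix.mulVec_neg]
    module
  · simp only [brk]
    noncomm_ring

/-! ## Clifford algebra -/

/-- The matrices have integer entries, which makes the Clifford relations decidable; the complex
relations follow by applying the ring map ℤ → ℂ. -/
theorem octL_anticomm : ∀ a b : Fin 7,
    octL a * octL b + octL b * octL a = if a = b then (-2 : ℤ) • 1 else 0 := by
  decide +kernel

theorem octL_transpose : ∀ a : Fin 7, (octL a).transpose = -octL a := by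
  decide +kernel

/-- Complex left multiplications by the imaginary octonion units. -/
def octC (a : Fin 7) : Matrix (Fin 8) (Fin 8) ℂ := (octL a).map (fun n : ℤ => (n : ℂ))

theorem octC_anticomm (a b : Fin 7) :
    octC a * octC b + octC b * octC a = if a = b then (-2 : ℂ) • 1 else 0 := by
  have h := congrArg (fun M : Matrix (Fin 8) (Fin 8) ℤ => M.map (Int.castRingHom ℂ))
    (octL_anticomm a b)
  have e : ∀ a, octC a = (octL a).map (Int.castRingHom ℂ) := fun _ => rfl
  rw [e, e, ← Matrix.map_mul, ← Matrix.map_mul, ← Matrix.map_add _ (map_add _), h]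
  split_ifs
  · ext i j
    by_cases hij : i = j
    · subst hij
      simp only [Matrix.map_apply, Matrix.smul_apply, Matrix.one_apply_eq]
      simp
    · simp only [Matrix.map_apply, Matrix.smul_apply, Matrix.one_apply_ne hij]
      simp
  · ext i j; simp

theorem octC_transpose (a : Fin 7) : (octC a).transpose = -octC a := by
  have h := octL_transpose a
  ext i j
  have h1 := congrFun (congrFun h i) j
  simp only [Matrix.transpose_apply, Matrix.neg_apply] at h1 ⊢
  simp only [octC, Matrix.map_apply, h1]
  push_cast; rfl

theorem γ_castAdd (a : Fin 7) : γ (Fin.castAdd 2 a) =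
    (!![0, 1; 1, 0] : Matrix (Fin 2) (Fin 2) ℂ) ⊗ₖ octC a := by
  have : ((Fin.castAdd 2 a : Fin 9) : ℕ) < 7 := a.2
  simp only [γ, this, dif_pos]
  rfl

theorem γ_seven : γ (Fin.natAdd 7 (0 : Fin 2)) =
    (!![0, -1; 1, 0] : Matrix (Fin 2) (Fin 2) ℂ) ⊗ₖ (1 : Matrix (Fin 8) (Fin 8) ℂ) := by
  simp [γ]

theorem γ_eight : γ (Fin.natAdd 7 (1 : Fin 2)) =
    (!![-Complex.I, 0; 0, Complex.I] : Matrix (Fin 2) (Fin 2) ℂ) ⊗ₖ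
      (1 : Matrix (Fin 8) (Fin 8) ℂ) := by
  simp [γ]

theorem kron_eq_smul_one (c : ℂ) :
    (c • (1 : Matrix SV SV ℂ)) = !![c, 0; 0, c] ⊗ₖ (1 : Matrix (Fin 8) (Fin 8) ℂ) := by
  have : (!![c, 0; 0, c] : Matrix (Fin 2) (Fin 2) ℂ) = c • 1 := by
    ext i j; fin_cases i <;> fin_cases j <;> simp
  rw [this, Matrix.smul_kronecker, Matrix.one_kronecker_one]

/-- The three 2 × 2 factors anticommute. The first squares to 1 and is paired with the L_a, whose
relations it inherits; the other two square to -1 and are paired with the identity. -/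
theorem γ_anticomm (i j : Fin 9) :
    γ i * γ j + γ j * γ i = (if i = j then (-2 : ℂ) else 0) • (1 : Matrix SV SV ℂ) := by
  induction i using Fin.addCases (m := 7) (n := 2) with
  | left a =>
    induction j using Fin.addCases (m := 7) (n := 2) with
    | left b =>
      have h1 : (Fin.castAdd 2 a = Fin.castAdd 2 b) ↔ a = b := by simp [Fin.ext_iff]
      rw [γ_castAdd, γ_castAdd, ← Matrix.mul_kronecker_mul, ← Matrix.mul_kronecker_mul,
        ← Matrix.kronecker_add, octC_anticomm]
      simp only [h1]
      split_ifs
      · rw [Matrix.kronecker_smul, kron_eq_smul_one, ← Matrix.smul_kronecker]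
        congr 1
        ext i j; fin_cases i <;> fin_cases j <;> simp
      · simp
    | right b =>
      have h1 : Fin.castAdd 2 a ≠ Fin.natAdd 7 b := by
        intro h; have := congrArg Fin.val h; simp at this; omega
      rw [if_neg h1, zero_smul]
      fin_cases b
      · rw [γ_castAdd, Fin.zero_eta, γ_seven, ← Matrix.mul_kronecker_mul,
          ← Matrix.mul_kronecker_mul, mul_one, one_mul, ← Matrix.add_kronecker]
        refine (congrArg (· ⊗ₖ octC a) (?_ : _ = (0 : Matrix (Fin 2) (Fin 2) ℂ))).trans
          (Matrix.zero_kronecker _)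
        ext i j; fin_cases i <;> fin_cases j <;> simp
      · rw [γ_castAdd, Fin.mk_one, γ_eight, ← Matrix.mul_kronecker_mul,
          ← Matrix.mul_kronecker_mul, mul_one, one_mul, ← Matrix.add_kronecker]
        refine (congrArg (· ⊗ₖ octC a) (?_ : _ = (0 : Matrix (Fin 2) (Fin 2) ℂ))).trans
          (Matrix.zero_kronecker _)
        ext i j; fin_cases i <;> fin_cases j <;> simp
  | right a =>
    induction j using Fin.addCases (m := 7) (n := 2) with
    | left b =>
      have h1 : Fin.natAdd 7 a ≠ Fin.castAdd 2 b := by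
        intro h; have := congrArg Fin.val h; simp at this; omega
      rw [if_neg h1, zero_smul]
      fin_cases a
      · rw [γ_castAdd, Fin.zero_eta, γ_seven, ← Matrix.mul_kronecker_mul,
          ← Matrix.mul_kronecker_mul, mul_one, one_mul, ← Matrix.add_kronecker]
        refine (congrArg (· ⊗ₖ octC b) (?_ : _ = (0 : Matrix (Fin 2) (Fin 2) ℂ))).trans
          (Matrix.zero_kronecker _)
        ext i j; fin_cases i <;> fin_cases j <;> simp
      · rw [γ_castAdd, Fin.mk_one, γ_eight, ← Matrix.mul_kronecker_mul,
          ← Matrix.mul_kronecker_mul, mul_one, one_mul, ← Matrix.add_kronecker]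
        refine (congrArg (· ⊗ₖ octC b) (?_ : _ = (0 : Matrix (Fin 2) (Fin 2) ℂ))).trans
          (Matrix.zero_kronecker _)
        ext i j; fin_cases i <;> fin_cases j <;> simp
    | right b =>
      fin_cases a <;> fin_cases b <;>
      · simp only [Fin.zero_eta, Fin.mk_one, γ_seven, γ_eight, ← Matrix.mul_kronecker_mul,
          mul_one, ← Matrix.add_kronecker, kron_eq_smul_one]
        congr 1
        ext i j; fin_cases i <;> fin_cases j <;> simp <;> norm_num

theorem γ_sq (i : Fin 9) : γ i * γ i = -1 := by
  have h := γ_anticomm i i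
  rw [if_pos rfl, ← two_smul ℂ] at h
  have h2 := congrArg ((1 / 2 : ℂ) • ·) h
  simpa [smul_smul] using h2

/-- The sign in `γ_j γ_i = sgn γ_i γ_j`. -/
def swapSign (j i : Fin 9) : ℂ := if i = j then 1 else -1

theorem γ_swap (j i : Fin 9) : γ j * γ i = swapSign j i • (γ i * γ j) := by
  by_cases h : i = j
  · subst h; simp [swapSign]
  · have := γ_anticomm i j
    rw [if_neg h, zero_smul] at this
    rw [swapSign, if_neg h, neg_one_smul]
    exact eq_neg_of_add_eq_zero_right this

/-- For the first seven indices, the sign from L_aᵗ = -L_a cancels the sign from commuting σ₁ past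
σ₃. The last two cases concern only 2 × 2 matrices. -/
theorem transpose_γ_mul_CV (i : Fin 9) : (γ i).transpose * CV = CV * γ i := by
  induction i using Fin.addCases (m := 7) (n := 2) with
  | left a =>
    rw [γ_castAdd, CV, ← Matrix.kroneckerMap_transpose, ← Matrix.mul_kronecker_mul,
      ← Matrix.mul_kronecker_mul, octC_transpose, mul_one, one_mul,
      ← neg_one_smul ℂ (octC a), Matrix.kronecker_smul, ← Matrix.smul_kronecker]
    congr 1
    ext i j; fin_cases i <;> fin_cases j <;> simp [Matrix.mul_apply, Fin.sum_univ_two]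
  | right a =>
    fin_cases a <;>
    · simp only [Fin.zero_eta, Fin.mk_one, γ_seven, γ_eight, CV, ← Matrix.kroneckerMap_transpose,
        ← Matrix.mul_kronecker_mul, Matrix.transpose_one, mul_one]
      congr 1
      ext i j; fin_cases i <;> fin_cases j <;> simp [Matrix.mul_apply, Fin.sum_univ_two]

theorem transpose_CV : CV.transpose = CV := by
  rw [CV, ← Matrix.kroneckerMap_transpose, Matrix.transpose_one]
  congr 1
  ext i j; fin_cases i <;> fin_cases j <;> simp

/-- `γ₁₂₃₄`. -/
def γ1234 : Matrix SV SV ℂ := γ 0 * γ 1 * γ 2 * γ 3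

/-- The sign in `γ₁₂₅ γ_i = ε_i γ_i γ₁₂₅`. -/
def ε : Fin 9 → ℂ := ![1, 1, -1, -1, 1, -1, -1, -1, -1]

/-- The sign in `γ₁₂₃₄ γ_i = χ_i γ_i γ₁₂₃₄`. -/
def χ : Fin 9 → ℂ := ![-1, -1, -1, -1, 1, 1, 1, 1, 1]

theorem γ125_mul_γ (i : Fin 9) : γ125 * γ i = ε i • (γ i * γ125) := by
  have h : γ125 * γ i = (swapSign 0 i * (swapSign 1 i * swapSign 4 i)) • (γ i * γ125) := by
    simp only [γ125]
    rw [mul_assoc, γ_swap 4 i, mul_smul_comm, ← mul_assoc, mul_assoc (γ 0), γ_swap 1 i]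
    simp only [mul_smul_comm, smul_mul_assoc]
    rw [← mul_assoc (γ 0), γ_swap 0 i]
    simp only [smul_mul_assoc, smul_smul, mul_assoc]
    congr 1; ring
  rw [h]
  congr 1
  fin_cases i <;> simp [swapSign, ε]

theorem γ1234_mul_γ (i : Fin 9) : γ1234 * γ i = χ i • (γ i * γ1234) := by
  have h : γ1234 * γ i = (swapSign 0 i * (swapSign 1 i * (swapSign 2 i * swapSign 3 i))) •
      (γ i * γ1234) := by
    simp only [γ1234]
    rw [mul_assoc, γ_swap 3 i, mul_smul_comm, ← mul_assoc, mul_assoc (γ 0 * γ 1), γ_swap 2 i]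
    simp only [mul_smul_comm, smul_mul_assoc]
    rw [← mul_assoc (γ 0 * γ 1), mul_assoc (γ 0) (γ 1) (γ i), γ_swap 1 i]
    simp only [mul_smul_comm, smul_mul_assoc]
    rw [← mul_assoc (γ 0), γ_swap 0 i]
    simp only [smul_mul_assoc, smul_smul, mul_assoc]
    congr 1; ring
  rw [h]
  congr 1
  fin_cases i <;> simp [swapSign, χ]

theorem γ_swap_assoc {i j : Fin 9} (h : i ≠ j) (X : Matrix SV SV ℂ) :
    γ j * (γ i * X) = -(γ i * (γ j * X)) := by
  rw [← mul_assoc, γ_swap, swapSign, if_neg h, neg_one_smul, neg_mul, mul_assoc]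

theorem γ125_sq : γ125 * γ125 = 1 := by
  simp only [γ125, mul_assoc, γ_swap_assoc (i := 0) (j := 4) (by decide),
    γ_swap_assoc (i := 0) (j := 1) (by decide), γ_swap_assoc (i := 1) (j := 4) (by decide),
    γ_sq, mul_neg, neg_neg, mul_one]

theorem γ1234_sq : γ1234 * γ1234 = 1 := by
  simp only [γ1234, mul_assoc, γ_swap_assoc (i := 0) (j := 1) (by decide),
    γ_swap_assoc (i := 0) (j := 2) (by decide), γ_swap_assoc (i := 0) (j := 3) (by decide),
    γ_swap_assoc (i := 1) (j := 2) (by decide), γ_swap_assoc (i := 1) (j := 3) (by decide),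
    γ_swap_assoc (i := 2) (j := 3) (by decide), γ_sq, mul_neg, neg_neg, mul_one]

theorem commute_γ1234_γ125 : γ1234 * γ125 = γ125 * γ1234 := by
  rw [γ125, ← mul_assoc, ← mul_assoc, γ1234_mul_γ, smul_mul_assoc, smul_mul_assoc, mul_assoc (γ 0),
    γ1234_mul_γ, mul_smul_comm, smul_mul_assoc, mul_assoc (γ 0), mul_assoc (γ 1), γ1234_mul_γ]
  simp [χ, mul_assoc]

/-! ### The projections X^± and the maps c̄, d, s on the image of X⁺ -/

theorem Xplus_eq : Xplus = (1 / 2 : ℂ) • (1 + γ1234) := rfl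

theorem Xminus_eq : Xminus = (1 / 2 : ℂ) • (1 - γ1234) := rfl

theorem γ1234_mul_Xplus : γ1234 * Xplus = Xplus := by
  rw [Xplus_eq, mul_smul_comm, mul_add, mul_one, γ1234_sq, add_comm]

theorem Xplus_sq : Xplus * Xplus = Xplus := by
  conv_lhs => arg 1; rw [Xplus_eq]
  rw [smul_mul_assoc, add_mul, one_mul, γ1234_mul_Xplus]
  module

theorem Xminus_mul_Xplus : Xminus * Xplus = 0 := by
  rw [Xminus_eq, smul_mul_assoc, sub_mul, one_mul, γ1234_mul_Xplus, sub_self, smul_zero]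

theorem Xplus_add_Xminus : Xplus + Xminus = 1 := by
  rw [Xplus_eq, Xminus_eq]; module

theorem Xplus_mul_γ125 : Xplus * γ125 = γ125 * Xplus := by
  rw [Xplus_eq, smul_mul_assoc, mul_smul_comm, add_mul, mul_add, commute_γ1234_γ125, one_mul,
    mul_one]

theorem Xminus_mul_γ125 : Xminus * γ125 = γ125 * Xminus := by
  rw [Xminus_eq, smul_mul_assoc, mul_smul_comm, sub_mul, mul_sub, commute_γ1234_γ125, one_mul,
    mul_one]

/-- The vectors `e_i` of the first two blocks exchange the images of `X⁺` and `X⁻`, the other ones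
preserve them. -/
theorem γ_mul_Xplus (i : Fin 9) :
    γ i * Xplus = (if i.1 < 4 then Xminus else Xplus) * γ i := by
  split_ifs with h
  · have h1 : χ i = -1 := by
      fin_cases i <;> simp [χ] at h ⊢
    rw [Xplus_eq, Xminus_eq, mul_smul_comm, smul_mul_assoc, sub_mul, mul_add, γ1234_mul_γ, h1]
    simp
  · have h1 : χ i = 1 := by
      fin_cases i <;> simp [χ] at h ⊢
    rw [Xplus_eq, mul_smul_comm, smul_mul_assoc, add_mul, mul_add, γ1234_mul_γ, h1]
    simp

theorem dd_mul_Xplus (p : Param) : dd p * Xplus = (p 1 : ℂ) • (γ125 * Xplus) := by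
  rw [dd, mul_assoc, ← Xplus_mul_γ125, ← mul_assoc, add_mul, smul_mul_assoc, smul_mul_assoc,
    Xplus_sq, Xminus_mul_Xplus, smul_zero, add_zero, smul_mul_assoc]

theorem Xplus_mul_Xminus : Xplus * Xminus = 0 := by
  have h := congrArg (Xplus * ·) Xplus_add_Xminus
  simp only [mul_add, Xplus_sq, mul_one] at h
  simpa using h

theorem Xminus_sq : Xminus * Xminus = Xminus := by
  have h := congrArg (· * Xminus) Xplus_add_Xminus
  simp only [add_mul, Xplus_mul_Xminus, one_mul] at h
  simpa using h

theorem cbar_mul_Xplus (p : Param) : cbar p * Xplus = (p 2 : ℂ) • (γ125 * Xplus) := by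
  rw [cbar, mul_assoc, ← Xplus_mul_γ125, ← mul_assoc, add_mul, smul_mul_assoc, smul_mul_assoc,
    Xplus_sq, Xminus_mul_Xplus, smul_zero, add_zero, smul_mul_assoc]

theorem cbar_mul_Xminus (p : Param) : cbar p * Xminus = (p 0 : ℂ) • (γ125 * Xminus) := by
  rw [cbar, mul_assoc, ← Xminus_mul_γ125, ← mul_assoc, add_mul, smul_mul_assoc, smul_mul_assoc,
    Xminus_sq, Xplus_mul_Xminus, smul_zero, zero_add, smul_mul_assoc]

/-- Here the numbers a_i enter. For the first four indices γ_i leads into the image of X⁻, where c̄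
is α₋γ₁₂₅; for the others it stays in that of X⁺, where c̄ is α₊γ₁₂₅. In both cases the coefficient
equals a_i + ε_iα₊' by the definition of a_i. -/
theorem cbar_mul_γ_mul_Xplus (p : Param) (i : Fin 9) :
    cbar p * γ i * Xplus = (a p i + ε i * p 1 : ℂ) • (γ125 * γ i * Xplus) := by
  rw [mul_assoc, mul_assoc, γ_mul_Xplus]
  by_cases h : i.1 < 4
  · rw [if_pos h, ← mul_assoc, cbar_mul_Xminus, smul_mul_assoc, mul_assoc]
    congr 1
    fin_cases i <;> simp [a, ε] at h ⊢
  · rw [if_neg h, ← mul_assoc, cbar_mul_Xplus, smul_mul_assoc, mul_assoc]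
    congr 1
    fin_cases i <;> simp [a, ε] at h ⊢

theorem ε_mul_self (i : Fin 9) : ε i * ε i = 1 := by
  fin_cases i <;> simp [ε]

/-- On the image of `X⁺` the map `s_{c̄,d}(e_i)` is `a_i γ₁₂₅ γ_i`. -/
theorem s_mul_Xplus (p : Param) (i : Fin 9) :
    s p i * Xplus = (a p i : ℂ) • (γ125 * γ i * Xplus) := by
  rw [s, sub_mul, cbar_mul_γ_mul_Xplus, mul_assoc (γ i), dd_mul_Xplus, mul_smul_comm,
    γ125_mul_γ, ← mul_assoc (γ i), smul_mul_assoc, smul_smul, smul_smul, ← sub_smul]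
  congr 1
  linear_combination (p 1 : ℂ) * ε_mul_self i

theorem cbar_comm_γ125 (p : Param) : cbar p * γ125 = γ125 * cbar p := by
  simp only [cbar, add_mul, mul_add, smul_mul_assoc, mul_smul_comm, ← mul_assoc, ← Xplus_mul_γ125,
    ← Xminus_mul_γ125]

theorem dd_comm_Xplus (p : Param) : dd p * Xplus = Xplus * dd p := by
  simp only [dd, add_mul, mul_add, smul_mul_assoc, mul_smul_comm, ← mul_assoc, Xplus_sq,
    Xplus_mul_Xminus]
  simp only [mul_assoc, ← Xplus_mul_γ125]
  simp only [← mul_assoc, Xplus_sq, Xminus_mul_Xplus]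

/-- The relation `c̄² v - 2 c̄ v d + v d² = a_i² v` on the image of `X⁺`. -/
theorem cbar_mul_s_sub (p : Param) (i : Fin 9) :
    cbar p * s p i * Xplus - s p i * dd p * Xplus = ((a p i : ℂ) ^ 2) • (γ i * Xplus) := by
  rw [mul_assoc, s_mul_Xplus, mul_assoc (s p i), dd_comm_Xplus, ← mul_assoc (s p i), s_mul_Xplus,
    mul_smul_comm, smul_mul_assoc, mul_assoc _ Xplus, ← dd_comm_Xplus, ← smul_sub]
  -- The map x ↦ c̄x - xd commutes with left multiplication by γ₁₂₅, so applying it twice multiplies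
  -- by (a_iγ₁₂₅)² = a_i².
  have h : cbar p * (γ125 * γ i * Xplus) - γ125 * γ i * (dd p * Xplus) =
      γ125 * (s p i * Xplus) := by
    rw [s, sub_mul, mul_sub]
    congr 1
    · simp only [← mul_assoc, cbar_comm_γ125]
    · simp only [mul_assoc]
  rw [h, s_mul_Xplus, mul_smul_comm, smul_smul, ← mul_assoc, ← mul_assoc, γ125_sq, one_mul, sq]

/-! ### The invariant form -/

/-- `M'` is the adjoint of `M` with respect to the charge conjugation. -/
def IsAdj (M M' : Matrix SV SV ℂ) : Prop := M.transpose * CV = CV * M'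

theorem isAdj_γ (i : Fin 9) : IsAdj (γ i) (γ i) := transpose_γ_mul_CV i

theorem IsAdj.congr {M M' L' : Matrix SV SV ℂ} (h : IsAdj M M') (e : M' = L') : IsAdj M L' :=
  e ▸ h

theorem IsAdj.mul {M M' L L' : Matrix SV SV ℂ} (h : IsAdj M M') (h' : IsAdj L L') :
    IsAdj (M * L) (L' * M') := by
  rw [IsAdj, Matrix.transpose_mul, mul_assoc, h, ← mul_assoc, h', mul_assoc]

theorem IsAdj.add {M M' L L' : Matrix SV SV ℂ} (h : IsAdj M M') (h' : IsAdj L L') :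
    IsAdj (M + L) (M' + L') := by
  rw [IsAdj, Matrix.transpose_add, add_mul, h, h', mul_add]

theorem IsAdj.smul {M M' : Matrix SV SV ℂ} (h : IsAdj M M') (c : ℂ) : IsAdj (c • M) (c • M') := by
  rw [IsAdj, Matrix.transpose_smul, smul_mul_assoc, h, mul_smul_comm]

theorem IsAdj.sum {ι : Type*} {s : Finset ι} {M M' : ι → Matrix SV SV ℂ}
    (h : ∀ i, IsAdj (M i) (M' i)) : IsAdj (∑ i ∈ s, M i) (∑ i ∈ s, M' i) := by
  rw [IsAdj, Matrix.transpose_sum, Finset.sum_mul, Finset.mul_sum]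
  exact Finset.sum_congr rfl fun i _ => h i

theorem isAdj_one : IsAdj 1 1 := by rw [IsAdj, Matrix.transpose_one, one_mul, mul_one]

/-- Each γ_i is self-adjoint, so taking adjoints reverses products. Reversing three distinct factors
takes three transpositions, hence the sign; for four factors it takes six, and `γ1234` is
self-adjoint. -/
theorem isAdj_γ125 : IsAdj γ125 (-γ125) := by
  refine (((isAdj_γ 0).mul (isAdj_γ 1)).mul (isAdj_γ 4)).congr ?_
  have e : ∀ {i j : Fin 9}, i ≠ j → γ j * γ i = -(γ i * γ j) := fun {i j} h => by
    rw [γ_swap, swapSign, if_neg h, neg_one_smul]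
  rw [γ125, e (i := 0) (j := 1) (by decide), mul_neg,
    γ_swap_assoc (i := 0) (j := 4) (by decide), e (i := 1) (j := 4) (by decide), mul_neg, mul_assoc]
  simp

theorem isAdj_γ1234 : IsAdj γ1234 γ1234 := by
  refine ((((isAdj_γ 0).mul (isAdj_γ 1)).mul (isAdj_γ 2)).mul (isAdj_γ 3)).congr ?_
  have e : ∀ {i j : Fin 9}, i ≠ j → γ j * γ i = -(γ i * γ j) := fun {i j} h => by
    rw [γ_swap, swapSign, if_neg h, neg_one_smul]
  simp only [γ1234, mul_assoc, γ_swap_assoc (i := 0) (j := 2) (by decide),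
    γ_swap_assoc (i := 0) (j := 3) (by decide), e (i := 0) (j := 1) (by decide),
    e (i := 1) (j := 2) (by decide), γ_swap_assoc (i := 1) (j := 3) (by decide),
    e (i := 2) (j := 3) (by decide), mul_neg, neg_neg]

theorem isAdj_Xplus : IsAdj Xplus Xplus := (isAdj_one.add isAdj_γ1234).smul _

theorem isAdj_Xminus : IsAdj Xminus Xminus := by
  have := (isAdj_one.add (isAdj_γ1234.smul (-1))).smul (1 / 2)
  rwa [neg_one_smul, ← sub_eq_add_neg] at this

theorem isAdj_cbar (p : Param) : IsAdj (cbar p) (-cbar p) := by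
  refine (((isAdj_Xplus.smul (p 2)).add (isAdj_Xminus.smul (p 0))).mul isAdj_γ125).congr ?_
  rw [cbar, neg_mul, mul_add, add_mul, mul_smul_comm, mul_smul_comm, ← Xplus_mul_γ125,
    ← Xminus_mul_γ125, smul_mul_assoc, smul_mul_assoc]

theorem isAdj_dd (p : Param) : IsAdj (dd p) (-dd p) := by
  refine (((isAdj_Xplus.smul (p 1)).add (isAdj_Xminus.smul (p 3))).mul isAdj_γ125).congr ?_
  rw [dd, neg_mul, mul_add, add_mul, mul_smul_comm, mul_smul_comm, ← Xplus_mul_γ125,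
    ← Xminus_mul_γ125, smul_mul_assoc, smul_mul_assoc]

/-- The invariant symmetric form on `S(V)`. -/
def form (x y : SV → ℂ) : ℂ := x ⬝ᵥ CV.mulVec y

theorem form_comm (x y : SV → ℂ) : form x y = form y x := by
  rw [form, form, Matrix.dotProduct_mulVec, ← Matrix.mulVec_transpose, transpose_CV,
    dotProduct_comm]

theorem IsAdj.form_left {M M' : Matrix SV SV ℂ} (h : IsAdj M M') (x y : SV → ℂ) :
    form (M.mulVec x) y = form x (M'.mulVec y) := by
  rw [form, form, Matrix.mulVec_mulVec, ← h, ← Matrix.mulVec_mulVec,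
    Matrix.dotProduct_mulVec x, ← Matrix.mulVec_transpose, Matrix.transpose_transpose]

/-! ### Infinitesimal rotations -/

/-- The spin representation `¼ ∑ m_{ij} γ_i γ_j` of a skew matrix. -/
def rot (m : Matrix (Fin 9) (Fin 9) ℂ) : Matrix SV SV ℂ :=
  (1 / 4 : ℂ) • ∑ i, ∑ j, m i j • (γ i * γ j)

theorem γ_mul_γ_mul_γ (i j k : Fin 9) : γ i * γ j * γ k - γ k * (γ i * γ j) =
    (if j = k then (-2 : ℂ) else 0) • γ i + (if i = k then (2 : ℂ) else 0) • γ j := by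
  have h1 := congrArg (γ i * ·) (γ_anticomm j k)
  have h2 := congrArg (· * γ j) (γ_anticomm i k)
  simp only [mul_add, add_mul, mul_smul_comm, smul_mul_assoc, mul_one, one_mul] at h1 h2
  have h3 : (if i = k then (2 : ℂ) else 0) = -(if i = k then (-2 : ℂ) else 0) := by
    split_ifs <;> simp
  rw [h3, neg_smul, ← h1, ← h2]
  noncomm_ring

/-- On vectors, `rot m` acts as -m. The sign matches the vector fields: commuting the linear field
of m with a constant field on V also produces -m. -/
theorem rot_comm_γ {A : Even} (hA : A.Valid) (k : Fin 9) :
    rot A.m * γ k - γ k * rot A.m = -∑ i, A.m i k • γ i := by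
  simp only [rot, smul_mul_assoc, mul_smul_comm, Finset.sum_mul, Finset.mul_sum, ← smul_sub,
    ← Finset.sum_sub_distrib, γ_mul_γ_mul_γ]
  simp only [smul_add, Finset.sum_add_distrib, ite_smul, zero_smul, smul_ite, smul_zero,
    Finset.sum_ite_eq', Finset.mem_univ, if_true]
  rw [Finset.sum_comm (f := fun i j => if i = k then A.m i j • (2 : ℂ) • γ j else 0)]
  simp only [Finset.sum_ite_eq', Finset.mem_univ, if_true]
  rw [← smul_add, ← Finset.sum_add_distrib, Finset.smul_sum, ← Finset.sum_neg_distrib]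
  refine Finset.sum_congr rfl fun i _ => ?_
  rw [hA.skew i k]
  module

theorem ε_eq_of_block {i j : Fin 9} (h : block i = block j) : ε i = ε j := by
  fin_cases i <;> fin_cases j <;> first | rfl | exact absurd h (by decide)

theorem χ_eq_of_block {i j : Fin 9} (h : block i = block j) : χ i = χ j := by
  fin_cases i <;> fin_cases j <;> first | rfl | exact absurd h (by decide)

theorem χ_mul_self (i : Fin 9) : χ i * χ i = 1 := by
  fin_cases i <;> simp [χ]

/-- An element that passes each γ_i at the cost of a sign depending only on the block of i commutes
with γ_iγ_j inside a block. Both γ₁₂₅ and γ₁₂₃₄ are of this kind, which is why the rotations within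
blocks commute with c̄ and d. -/
theorem rot_comm_of_mul_γ {A : Even} (hA : A.Valid) {N : Matrix SV SV ℂ} {e : Fin 9 → ℂ}
    (hN : ∀ i, N * γ i = e i • (γ i * N)) (he : ∀ i j, block i = block j → e i * e j = 1) :
    rot A.m * N = N * rot A.m := by
  have h : ∀ i j, A.m i j • (γ i * γ j * N) = A.m i j • (N * (γ i * γ j)) := by
    intro i j
    by_cases h : block i = block j
    · rw [← mul_assoc N, hN, smul_mul_assoc, mul_assoc (γ i) N, hN, mul_smul_comm, smul_smul (e i),
        he i j h, one_smul, mul_assoc]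
    · rw [hA.off i j h, zero_smul, zero_smul]
  simp only [rot, smul_mul_assoc, mul_smul_comm, Finset.sum_mul, Finset.mul_sum, h]

theorem rot_comm_γ125 {A : Even} (hA : A.Valid) : rot A.m * γ125 = γ125 * rot A.m :=
  rot_comm_of_mul_γ hA γ125_mul_γ fun i j h => by rw [ε_eq_of_block h, ε_mul_self]

theorem rot_comm_γ1234 {A : Even} (hA : A.Valid) : rot A.m * γ1234 = γ1234 * rot A.m :=
  rot_comm_of_mul_γ hA γ1234_mul_γ fun i j h => by rw [χ_eq_of_block h, χ_mul_self]

theorem rot_comm_Xplus {A : Even} (hA : A.Valid) : rot A.m * Xplus = Xplus * rot A.m := by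
  rw [Xplus_eq, mul_smul_comm, smul_mul_assoc, mul_add, add_mul, rot_comm_γ1234 hA, mul_one,
    one_mul]

theorem rot_comm_Xminus {A : Even} (hA : A.Valid) : rot A.m * Xminus = Xminus * rot A.m := by
  rw [Xminus_eq, mul_smul_comm, smul_mul_assoc, mul_sub, sub_mul, rot_comm_γ1234 hA, mul_one,
    one_mul]

theorem rot_comm_cbar {A : Even} (hA : A.Valid) (p : Param) :
    rot A.m * cbar p = cbar p * rot A.m := by
  rw [cbar, mul_assoc, ← rot_comm_γ125 hA, ← mul_assoc, ← mul_assoc, mul_add, add_mul,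
    mul_smul_comm, mul_smul_comm, smul_mul_assoc, smul_mul_assoc, rot_comm_Xplus hA,
    rot_comm_Xminus hA]
  simp only [add_mul, smul_mul_assoc]

theorem rot_comm_dd {A : Even} (hA : A.Valid) (p : Param) :
    rot A.m * dd p = dd p * rot A.m := by
  rw [dd, mul_assoc, ← rot_comm_γ125 hA, ← mul_assoc, ← mul_assoc, mul_add, add_mul,
    mul_smul_comm, mul_smul_comm, smul_mul_assoc, smul_mul_assoc, rot_comm_Xplus hA,
    rot_comm_Xminus hA]
  simp only [add_mul, smul_mul_assoc]

theorem rot_comm_s {A : Even} (hA : A.Valid) (p : Param) (k : Fin 9) :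
    rot A.m * s p k - s p k * rot A.m = -∑ i, A.m i k • s p i := by
  have h : rot A.m * s p k - s p k * rot A.m = cbar p * (rot A.m * γ k - γ k * rot A.m)
      - (rot A.m * γ k - γ k * rot A.m) * dd p := by
    rw [s, mul_sub, sub_mul, mul_sub, sub_mul, ← mul_assoc (cbar p), ← rot_comm_cbar hA,
      mul_assoc (γ k) (rot A.m), rot_comm_dd hA, ← mul_assoc]
    noncomm_ring
  rw [h, rot_comm_γ hA, mul_neg, neg_mul, Finset.mul_sum, Finset.sum_mul, sub_neg_eq_add,
    neg_add_eq_sub, ← Finset.sum_sub_distrib, ← Finset.sum_neg_distrib]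
  exact Finset.sum_congr rfl fun i _ => by rw [s, mul_smul_comm, smul_mul_assoc]; module

theorem isAdj_rot {A : Even} (hA : A.Valid) : IsAdj (rot A.m) (-rot A.m) := by
  refine ((IsAdj.sum (s := Finset.univ) fun i => IsAdj.sum (s := Finset.univ) fun j =>
    ((isAdj_γ i).mul (isAdj_γ j)).smul (A.m i j)).smul (1 / 4)).congr ?_
  rw [rot, ← smul_neg, Finset.sum_comm, ← Finset.sum_neg_distrib]
  refine congrArg _ (Finset.sum_congr rfl fun i _ => ?_)
  rw [← Finset.sum_neg_distrib]
  exact Finset.sum_congr rfl fun j _ => by rw [hA.skew i j, neg_smul]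

/-- Two reversals compensate: linear fields bracket with the opposite sign of their matrices, and
`rot` acts on vectors by -m. -/
theorem rot_brk {A A' : Even} (hA : A.Valid) (p : Param) :
    rot (brk p A A').m = rot A.m * rot A'.m - rot A'.m * rot A.m := by
  have h : ∀ j k, rot A.m * (γ j * γ k) - γ j * γ k * rot A.m =
      ∑ i, (-(A.m i j) • (γ i * γ k) + A.m k i • (γ j * γ i)) := by
    intro j k
    have e : rot A.m * (γ j * γ k) - γ j * γ k * rot A.m =
        (rot A.m * γ j - γ j * rot A.m) * γ k + γ j * (rot A.m * γ k - γ k * rot A.m) := by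
      noncomm_ring
    rw [e, rot_comm_γ hA, rot_comm_γ hA, neg_mul, mul_neg, Finset.sum_mul, Finset.mul_sum,
      ← neg_add, ← Finset.sum_add_distrib, ← Finset.sum_neg_distrib]
    refine Finset.sum_congr rfl fun i _ => ?_
    rw [hA.skew i k, smul_mul_assoc, mul_smul_comm]
    module
  have h2 : rot A.m * rot A'.m - rot A'.m * rot A.m = (1 / 4 : ℂ) • ∑ j, ∑ k, A'.m j k •
      (rot A.m * (γ j * γ k) - γ j * γ k * rot A.m) := by
    conv_lhs => rw [rot.eq_def A'.m]
    simp only [smul_mul_assoc, mul_smul_comm, Finset.mul_sum, Finset.sum_mul, ← smul_sub,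
      ← Finset.sum_sub_distrib]
  have h3 : ∑ j, ∑ k, A'.m j k • ∑ i, -(A.m i j) • (γ i * γ k) =
      -∑ i, ∑ k, (A.m * A'.m) i k • (γ i * γ k) := by
    simp only [Matrix.mul_apply, Finset.sum_smul, Finset.smul_sum, smul_smul,
      ← Finset.sum_neg_distrib]
    calc _ = ∑ j, ∑ i, ∑ k, (A'.m j k * -A.m i j) • (γ i * γ k) :=
          Finset.sum_congr rfl fun j _ => Finset.sum_comm
      _ = ∑ i, ∑ j, ∑ k, (A'.m j k * -A.m i j) • (γ i * γ k) := Finset.sum_comm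
      _ = ∑ i, ∑ k, ∑ j, (A'.m j k * -A.m i j) • (γ i * γ k) :=
          Finset.sum_congr rfl fun j _ => Finset.sum_comm
      _ = _ := Finset.sum_congr rfl fun i _ => Finset.sum_congr rfl fun k _ =>
          Finset.sum_congr rfl fun j _ => by rw [← neg_smul]; congr 1; ring
  have h4 : ∑ j, ∑ k, A'.m j k • ∑ i, A.m k i • (γ j * γ i) =
      ∑ i, ∑ k, (A'.m * A.m) i k • (γ i * γ k) := by
    simp only [Matrix.mul_apply, Finset.sum_smul, Finset.smul_sum, smul_smul]
    exact Finset.sum_congr rfl fun j _ => Finset.sum_comm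
  rw [h2, rot]
  refine congrArg _ ?_
  simp only [h, Finset.sum_add_distrib, smul_add]
  rw [h3, h4]
  simp only [brk, Matrix.sub_apply, sub_smul, Finset.sum_sub_distrib]
  abel

/-! ## Parallel spinors -/

theorem hasDerivAt_exp_mulVec (A : Matrix SV SV ℂ) (v : SV → ℂ) (t : ℝ) :
    HasDerivAt (fun t : ℝ => (NormedSpace.exp (-(t : ℂ) • A)).mulVec v)
      (-(A.mulVec ((NormedSpace.exp (-(t : ℂ) • A)).mulVec v))) t := by
  -- The norm is an auxiliary local choice that makes the exponential series differentiable; the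
  -- statement does not depend on it.
  let _ : NormedRing (Matrix SV SV ℂ) := Matrix.linftyOpNormedRing
  let _ : NormedAlgebra ℂ (Matrix SV SV ℂ) := Matrix.linftyOpNormedAlgebra
  let _ : NormedAlgebra ℝ (Matrix SV SV ℂ) := NormedAlgebra.restrictScalars ℝ ℂ _
  have h := hasDerivAt_exp_smul_const' (𝕂 := ℝ) (-A) t
  let L : Matrix SV SV ℂ →ₗ[ℝ] (SV → ℂ) :=
    { toFun := fun M => M.mulVec v
      map_add' := fun M N => Matrix.add_mulVec M N v
      map_smul' := fun c M => Matrix.smul_mulVec c M v }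
  have h2 := L.toContinuousLinearMap.hasFDerivAt.comp_hasDerivAt t h
  have e : ∀ t : ℝ, -(t : ℂ) • A = t • (-A) := fun t => by
    ext i j; simp
  simp only [e]
  refine h2.congr_deriv ?_
  change (-A * NormedSpace.exp (t • -A)).mulVec v = _
  rw [← Matrix.mulVec_mulVec, Matrix.neg_mulVec]

theorem exp_mulVec_comm {A M : Matrix SV SV ℂ} (h : M * A = A * M) (t : ℝ) (v : SV → ℂ) :
    M.mulVec ((NormedSpace.exp (-(t : ℂ) • A)).mulVec v) =
      (NormedSpace.exp (-(t : ℂ) • A)).mulVec (M.mulVec v) := by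
  have h1 : Commute M (-(t : ℂ) • A) := (show Commute M A from h).smul_right _
  let _ : NormedRing (Matrix SV SV ℂ) := Matrix.linftyOpNormedRing
  let _ : NormedAlgebra ℂ (Matrix SV SV ℂ) := Matrix.linftyOpNormedAlgebra
  have h2 : Commute M (NormedSpace.exp (-(t : ℂ) • A)) := h1.exp_right
  rw [Matrix.mulVec_mulVec, Matrix.mulVec_mulVec, h2.eq]

/-- Uniqueness for linear differential equations. It identifies a curve with a flow of c̄ without
commuting exponentials past γ_i or s(e_i). -/
theorem eq_exp_mulVec {A : Matrix SV SV ℂ} {y : ℝ → SV → ℂ}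
    (h : ∀ t, HasDerivAt y (-(A.mulVec (y t))) t) (t : ℝ) :
    y t = (NormedSpace.exp (-(t : ℂ) • A)).mulVec (y 0) := by
  let L : (SV → ℂ) →L[ℝ] (SV → ℂ) :=
    LinearMap.toContinuousLinearMap ((-(Matrix.mulVecLin A)).restrictScalars ℝ)
  have hL : ∀ v, L v = -(A.mulVec v) := fun v => rfl
  have := ODE_solution_unique_univ (v := fun _ => L) (s := fun _ => Set.univ) (K := ‖L‖₊) (t₀ := 0)
    (f := y) (g := fun t => (NormedSpace.exp (-(t : ℂ) • A)).mulVec (y 0))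
    (fun _ => L.lipschitz.lipschitzOnWith) (fun t => ⟨h t, trivial⟩)
    (fun t => ⟨hasDerivAt_exp_mulVec A (y 0) t, trivial⟩) (by simp)
  exact congrFun this t

/-- The flow `exp(-tc̄)` on the first summand of the spinor space. -/
def flow₁ (p : Param) (t : ℝ) : Matrix SV SV ℂ := NormedSpace.exp (-(t : ℂ) • cbar p)

/-- The flow `exp(-td)` on the second summand of the spinor space. -/
def flow₂ (p : Param) (t : ℝ) : Matrix SV SV ℂ := NormedSpace.exp (-(t : ℂ) • dd p)

/-- The components of a spinor. -/
def left (w : Spinor) : SV → ℂ := fun k => w (Sum.inl k)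

/-- The components of a spinor. -/
def right (w : Spinor) : SV → ℂ := fun k => w (Sum.inr k)

theorem elim_left_right (w : Spinor) : Sum.elim (left w) (right w) = w := by
  ext k; rcases k with k | k <;> rfl

theorem mulVec_sum_smul (M : Fin 9 → Matrix SV SV ℂ) (c : Fin 9 → ℂ) (v : SV → ℂ) :
    (∑ i, c i • M i).mulVec v = ∑ i, c i • (M i).mulVec v := by
  rw [Matrix.sum_mulVec]
  exact Finset.sum_congr rfl fun i _ => Matrix.smul_mulVec _ _ _

theorem parallelSpinor_apply (p : Param) (w : Spinor) (x : Pt) :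
    parallelSpinor p w x = Sum.elim
      ((flow₁ p (x im)).mulVec (left w) + ((Real.sqrt 2 : ℝ) : ℂ)⁻¹ •
        ∑ i, (x (Sum.inr i) : ℂ) • (s p i).mulVec ((flow₂ p (x im)).mulVec (right w)))
      ((flow₂ p (x im)).mulVec (right w)) := by
  change (transport p x).mulVec w = _
  rw [transport, Matrix.fromBlocks_mulVec]
  congr 1
  · rw [← Matrix.mulVec_mulVec, Matrix.smul_mulVec, mulVec_sum_smul]
    rfl
  · rw [Matrix.zero_mulVec, zero_add]
    rfl

theorem hasDerivAt_sumElim {f g : ℝ → SV → ℂ} {f' g' : SV → ℂ} {t : ℝ}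
    (hf : HasDerivAt f f' t) (hg : HasDerivAt g g' t) :
    HasDerivAt (fun t => (Sum.elim (f t) (g t) : Spinor)) (Sum.elim f' g') t := by
  rw [hasDerivAt_pi] at hf hg ⊢
  rintro (k | k)
  · exact hf k
  · exact hg k

theorem pd_ip_parallelSpinor (p : Param) (w : Spinor) (x : Pt) :
    pd ip (parallelSpinor p w) x = 0 := by
  apply pd_eq_of_hasDerivAt
  have h : (fun t => parallelSpinor p w (Function.update x ip t)) =
      fun _ => parallelSpinor p w x := by
    funext t
    simp [parallelSpinor_apply]
  rw [h]
  exact hasDerivAt_const _ _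

theorem pd_im_parallelSpinor (p : Param) (w : Spinor) (x : Pt) :
    pd im (parallelSpinor p w) x = Sum.elim
      (-(cbar p).mulVec ((flow₁ p (x im)).mulVec (left w)) - ((Real.sqrt 2 : ℝ) : ℂ)⁻¹ •
        ∑ i, (x (Sum.inr i) : ℂ) •
          (s p i).mulVec ((dd p).mulVec ((flow₂ p (x im)).mulVec (right w))))
      (-(dd p).mulVec ((flow₂ p (x im)).mulVec (right w))) := by
  apply pd_eq_of_hasDerivAt
  have h1 := hasDerivAt_exp_mulVec (cbar p) (left w) (x im)
  have h2 := hasDerivAt_exp_mulVec (dd p) (right w) (x im)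
  have h3 : ∀ i, HasDerivAt (fun t : ℝ => (s p i).mulVec ((flow₂ p t).mulVec (right w)))
      (-(s p i).mulVec ((dd p).mulVec ((flow₂ p (x im)).mulVec (right w)))) (x im) := by
    intro i
    have := (LinearMap.toContinuousLinearMap ((Matrix.mulVecLin (s p i)).restrictScalars ℝ)
      ).hasFDerivAt.comp_hasDerivAt (x im) h2
    refine this.congr_deriv ?_
    change (s p i).mulVec (-_) = _
    rw [Matrix.mulVec_neg]; rfl
  have h4 := hasDerivAt_sumElim (h1.add ((HasDerivAt.fun_sum (u := Finset.univ) fun i _ =>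
    (h3 i).const_smul (x (Sum.inr i) : ℂ)).const_smul (((Real.sqrt 2 : ℝ) : ℂ)⁻¹))) h2
  have e : (fun t => parallelSpinor p w (Function.update x im t)) = fun t => Sum.elim
      ((flow₁ p t).mulVec (left w) + ((Real.sqrt 2 : ℝ) : ℂ)⁻¹ •
        ∑ i, (x (Sum.inr i) : ℂ) • (s p i).mulVec ((flow₂ p t).mulVec (right w)))
      ((flow₂ p t).mulVec (right w)) := by
    funext t
    simp [parallelSpinor_apply]
  rw [e]
  refine h4.congr_deriv ?_
  simp only [smul_neg, Finset.sum_neg_distrib, ← sub_eq_add_neg]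
  rfl

theorem pd_inr_parallelSpinor (p : Param) (w : Spinor) (x : Pt) (j : Fin 9) :
    pd (Sum.inr j) (parallelSpinor p w) x = Sum.elim
      (((Real.sqrt 2 : ℝ) : ℂ)⁻¹ • (s p j).mulVec ((flow₂ p (x im)).mulVec (right w))) 0 := by
  apply pd_eq_of_hasDerivAt
  set v := fun i => (s p i).mulVec ((flow₂ p (x im)).mulVec (right w)) with hv
  have h1 : HasDerivAt (fun t : ℝ => ∑ i, ((Function.update x (Sum.inr j) t (Sum.inr i) : ℝ) : ℂ)
      • v i) (v j) (x (Sum.inr j)) := by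
    rw [hasDerivAt_pi]
    intro k
    simpa using hasDerivAt_sum_coord x (fun i => v i k) j
  have h2 := hasDerivAt_sumElim ((h1.const_smul (((Real.sqrt 2 : ℝ) : ℂ)⁻¹)).const_add
    ((flow₁ p (x im)).mulVec (left w))) (hasDerivAt_const _ ((flow₂ p (x im)).mulVec (right w)))
  refine h2.congr_of_eventuallyEq (Filter.Eventually.of_forall fun t => ?_)
  dsimp only
  rw [parallelSpinor_apply]
  simp [hv]

/-- The constants of the parallel spinors satisfy `X⁻ ξ₂⁰ = 0`. -/
theorem mem_ker_iff (w : Spinor) :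
    w ∈ LinearMap.ker (Matrix.mulVecLin (onPlus Xminus)) ↔ Xplus.mulVec (right w) = right w := by
  have e : (onPlus Xminus).mulVec w = Sum.elim (0 : SV → ℂ) (Xminus.mulVec (right w)) := by
    rw [onPlus, Matrix.fromBlocks_mulVec]
    congr 1
    · simp
    · rw [Matrix.zero_mulVec, zero_add]; rfl
  have h2 : Xplus.mulVec (right w) + Xminus.mulVec (right w) = right w := by
    rw [← Matrix.add_mulVec, Xplus_add_Xminus, Matrix.one_mulVec]
  rw [LinearMap.mem_ker, Matrix.mulVecLin_apply, e]
  constructor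
  · intro h
    have : Xminus.mulVec (right w) = 0 := by
      ext k; exact congrFun h (Sum.inr k)
    rwa [this, add_zero] at h2
  · intro h
    have : Xminus.mulVec (right w) = 0 := by
      rw [h] at h2; simpa using h2
    rw [this]
    ext k; rcases k with k | k <;> rfl

/-- As d commutes with X⁺, the condition on ξ₂⁰ persists along the flow, so the relations valid on
the image of X⁺ apply at every x⁻. -/
theorem Xplus_flow₂ (p : Param) (t : ℝ) {v : SV → ℂ} (h : Xplus.mulVec v = v) :
    Xplus.mulVec ((flow₂ p t).mulVec v) = (flow₂ p t).mulVec v := by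
  rw [flow₂, exp_mulVec_comm (dd_comm_Xplus p).symm, h]

theorem cbar_s_mulVec (p : Param) (i : Fin 9) {v : SV → ℂ} (h : Xplus.mulVec v = v) :
    (cbar p).mulVec ((s p i).mulVec v) =
      (s p i).mulVec ((dd p).mulVec v) + (a p i : ℂ) ^ 2 • (γ i).mulVec v := by
  have h1 := congrArg (fun M => M.mulVec v) (cbar_mul_s_sub p i)
  simp only [Matrix.sub_mulVec, ← Matrix.mulVec_mulVec, h, Matrix.smul_mulVec] at h1
  rw [← h1]; abel

theorem ofReal_sqrt_two_sq : ((Real.sqrt 2 : ℝ) : ℂ) * ((Real.sqrt 2 : ℝ) : ℂ) = 2 := by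
  rw [← Complex.ofReal_mul, Real.mul_self_sqrt zero_le_two]; norm_num

theorem ofReal_sqrt_two_ne_zero : ((Real.sqrt 2 : ℝ) : ℂ) ≠ 0 := fun h => by
  have := ofReal_sqrt_two_sq
  rw [h] at this; norm_num at this

theorem Γ_ip_mul_Γ_inr (j : Fin 9) : Γ ip * Γ (Sum.inr j) =
    Matrix.fromBlocks 0 (((Real.sqrt 2 : ℝ) : ℂ) • γ j) 0 0 := by
  simp [Γ, Matrix.fromBlocks_multiply]

theorem fromBlocks_mulVec_elim (A B' C' D' : Matrix SV SV ℂ) (v w : SV → ℂ) :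
    (Matrix.fromBlocks A B' C' D').mulVec (Sum.elim v w) =
      Sum.elim (A.mulVec v + B'.mulVec w) (C'.mulVec v + D'.mulVec w) := by
  rw [Matrix.fromBlocks_mulVec]; rfl

theorem sum_fromBlocks (c : Fin 9 → ℂ) (M : Fin 9 → Matrix SV SV ℂ) :
    ∑ i, c i • Matrix.fromBlocks 0 (M i) 0 0 =
      (Matrix.fromBlocks 0 (∑ i, c i • M i) 0 0 : Matrix (SV ⊕ SV) (SV ⊕ SV) ℂ) := by
  ext i j
  rcases i with i | i <;> rcases j with j | j <;> simp [Matrix.sum_apply]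

theorem elim_add_elim (v w v' w' : SV → ℂ) :
    (Sum.elim v w + Sum.elim v' w' : Spinor) = Sum.elim (v + v') (w + w') := by
  ext k; rcases k with k | k <;> rfl

theorem smul_elim (c : ℂ) (v w : SV → ℂ) :
    c • (Sum.elim v w : Spinor) = Sum.elim (c • v) (c • w) := by
  ext k; rcases k with k | k <;> rfl

theorem elim_zero_zero : (Sum.elim (0 : SV → ℂ) (0 : SV → ℂ) : Spinor) = 0 := by
  ext k; rcases k with k | k <;> rfl

/-- In the directions e_i, ρ cancels the derivative of the term linear in x. In the direction ∂₋ the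
linear term leaves c̄s - sd, which is a_i²γ_i on the image of X⁺, and the spin connection supplies
the same with opposite sign through B = -diag(a²). -/
theorem parallel (p : Param) {w : Spinor}
    (hw : w ∈ LinearMap.ker (Matrix.mulVecLin (onPlus Xminus))) (μ : Idx) :
    D p μ (parallelSpinor p w) = 0 := by
  rw [mem_ker_iff] at hw
  funext x
  have hη := Xplus_flow₂ p (x im) hw
  rcases μ with μ | j
  · fin_cases μ
    · change D p ip _ _ = _
      simp [D, nabla, pd_ip_parallelSpinor, ρ]
    · change D p im _ _ = _
      simp only [D, nabla, pd_im_parallelSpinor, if_true, ρ, Sum.elim_inl, Matrix.cons_val_one,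
        Γ_ip_mul_Γ_inr, sum_fromBlocks, parallelSpinor_apply, fromBlocks_mulVec_elim,
        Matrix.zero_mulVec, Matrix.cons_val_fin_one]
      set η := (flow₂ p (x im)).mulVec (right w)
      rw [smul_elim, elim_add_elim, elim_add_elim, Pi.zero_apply, ← elim_zero_zero]
      congr 1
      · simp only [mulVec_sum_smul, Matrix.mulVec_add, Matrix.mulVec_smul, Matrix.mulVec_sum,
          cbar_s_mulVec p _ hη, zero_add]
        have h2 := ofReal_sqrt_two_sq
        have h3 := ofReal_sqrt_two_ne_zero
        simp only [Matrix.smul_mulVec, smul_add, Finset.sum_add_distrib, B]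
        -- The spin connection term rewritten with √2/2 = 1/√2 so as to match the factor in front of
        -- s.
        have e : (1 / 2 : ℂ) • ∑ i, ((x (Sum.inr i) * -a p i ^ 2 : ℝ) : ℂ) •
            ((Real.sqrt 2 : ℝ) : ℂ) • (γ i).mulVec η = -(((Real.sqrt 2 : ℝ) : ℂ)⁻¹ • ∑ i,
              (x (Sum.inr i) : ℂ) • (a p i : ℂ) ^ 2 • (γ i).mulVec η) := by
          rw [Finset.smul_sum, Finset.smul_sum, ← Finset.sum_neg_distrib]
          refine Finset.sum_congr rfl fun i _ => ?_
          rw [smul_smul, smul_smul, smul_smul, smul_smul, ← neg_smul]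
          congr 1
          push_cast
          field_simp
          linear_combination (-(x (Sum.inr i) : ℂ) * (a p i : ℂ) ^ 2) * h2
        rw [e]
        module
      · simp
  · simp only [D, nabla, pd_inr_parallelSpinor, ρ, Sum.elim_inr, parallelSpinor_apply,
      fromBlocks_mulVec_elim, reduceCtorEq, if_false, Matrix.zero_mulVec, Matrix.neg_mulVec,
      Matrix.smul_mulVec]
    ext k
    rcases k with k | k <;> simp

/-! ## The spinorial Lie derivative -/

/-- The inverse of the metric. -/
def invMetric (p : Param) (x : Pt) : Matrix Idx Idx ℝ :=
  Matrix.fromBlocks !![∑ i, B p i * (x (Sum.inr i)) ^ 2, 1; 1, 0] 0 0 1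

theorem inv_metric (p : Param) (x : Pt) : (metric p x)⁻¹ = invMetric p x := by
  apply Matrix.inv_eq_right_inv
  rw [metric, invMetric, Matrix.fromBlocks_multiply]
  rw [← Matrix.fromBlocks_one]
  congr 1
  · ext i j; fin_cases i <;> fin_cases j <;> simp
  · simp
  · simp
  · simp

/-- The Christoffel symbols of a Cahen-Wallach space. -/
def chr (p : Param) (x : Pt) (κ μ ν : Idx) : ℝ :=
  Sum.elim
    ![Sum.elim (fun k => Sum.elim (fun _ => 0)
        (fun j => if k = 1 then -B p j * x (Sum.inr j) else 0) ν)
      (fun i => if ν = im then -B p i * x (Sum.inr i) else 0) μ, 0]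
    (fun i => if μ = im ∧ ν = im then B p i * x (Sum.inr i) else 0) κ

theorem christoffel_eq (p : Param) (x : Pt) (κ μ ν : Idx) :
    christoffel p x κ μ ν = chr p x κ μ ν := by
  have h : christoffel p x κ μ ν = (1 / 2) * ∑ σ, invMetric p x κ σ *
      (dmetric p x μ σ ν + dmetric p x ν σ μ - dmetric p x σ μ ν) := by
    rw [christoffel, inv_metric]
    refine congrArg _ (Finset.sum_congr rfl fun σ _ => ?_)
    exact congrArg _ (congrArg₂ (· - ·) (congrArg₂ (· + ·) (pd_metric p x μ σ ν)
      (pd_metric p x ν σ μ)) (pd_metric p x σ μ ν))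
  rw [h, sum_idx]
  rcases κ with κ | i
  · fin_cases κ
    · rcases μ with μ | k <;> rcases ν with ν | l
      · fin_cases μ <;> fin_cases ν <;> simp [dmetric, invMetric, chr]
      · fin_cases μ <;> simp [dmetric, invMetric, chr]
        ring
      · fin_cases ν <;> simp [dmetric, invMetric, chr]
        ring
      · simp [dmetric, invMetric, chr]
    · rcases μ with μ | k <;> rcases ν with ν | l
      · fin_cases μ <;> fin_cases ν <;> simp [dmetric, invMetric, chr]
      · fin_cases μ <;> simp [dmetric, invMetric, chr]
      · fin_cases ν <;> simp [dmetric, invMetric, chr]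
      · simp [dmetric, invMetric, chr]
  · rcases μ with μ | k <;> rcases ν with ν | l
    · fin_cases μ <;> fin_cases ν <;> simp [dmetric, invMetric, chr, Matrix.one_apply]
      ring
    · fin_cases μ <;> simp [dmetric, invMetric, chr, Matrix.one_apply]
    · fin_cases ν <;> simp [dmetric, invMetric, chr, Matrix.one_apply]
    · simp [dmetric, invMetric, chr, Matrix.one_apply]

/-! ### The covariant derivative of an even field and its spin action -/

/-- The components `∇_- X^i = -∇_i X^+` of the covariant derivative of an even vector field. -/
def boost (p : Param) (A : Even) (x : Pt) (i : Fin 9) : ℂ :=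
  prof p (negSq p A.v) (-A.u) i (x im) - (a p i : ℂ) ^ 2 * x (Sum.inr i) * A.cm

/-- The covariant derivative of an even vector field. -/
def dcov (p : Param) (A : Even) (x : Pt) : Idx → Idx → ℂ :=
  Sum.elim ![0, Sum.elim ![0, 0] (boost p A x)]
    (fun j => Sum.elim ![-boost p A x j, 0] (fun i => A.m i j))

/-- For a Killing field ∇X is skew; what is left here is a null rotation with coefficients `boost`
and the rotation m. The component ∇₋X⁺ vanishes by `quadratic_eq_zero` once the terms linear in x
cancel. -/
theorem covD_field (p : Param) {A : Even} (hA : A.Valid) (x : Pt) (μ ν : Idx) :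
    covD p (field p A) x μ ν = dcov p A x μ ν := by
  rw [covD, pd_field]
  simp only [christoffel_eq]
  rw [sum_idx]
  rcases ν with ν | i
  · fin_cases ν
    · rcases μ with μ | j
      · fin_cases μ
        · simp [chr, dfield, dcov]
        · have h := hA.quadratic_eq_zero p (fun i => (x (Sum.inr i) : ℂ))
          simp [chr, dfield, dcov, field, B]
          rw [← Finset.sum_neg_distrib, ← Finset.sum_add_distrib, ← h]
          refine Finset.sum_congr rfl fun i _ => ?_
          rw [mul_add, Finset.mul_sum]
          have : ∑ j, (a p i : ℂ) ^ 2 * (x (Sum.inr i) : ℂ) * (A.m i j * (x (Sum.inr j) : ℂ)) =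
              ∑ j, (a p i : ℂ) ^ 2 * A.m i j * (x (Sum.inr i) : ℂ) * (x (Sum.inr j) : ℂ) :=
            Finset.sum_congr rfl fun j _ => by ring
          rw [this]
          ring
      · simp [chr, dfield, dcov, field, B, boost]
        ring
    · rcases μ with μ | j
      · fin_cases μ <;> simp [chr, dfield, dcov]
      · simp [chr, dfield, dcov]
  · rcases μ with μ | j
    · fin_cases μ <;> simp [chr, dfield, dcov, field, B, boost]
      ring
    · simp [chr, dfield, dcov]

/-- The Clifford matrix of `dx^μ`. -/
def Γup (p : Param) (x : Pt) : Idx → Matrix (SV ⊕ SV) (SV ⊕ SV) ℂ :=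
  Sum.elim
    ![Γ im + ((1 / 2 * ∑ i, B p i * (x (Sum.inr i)) ^ 2 : ℝ) : ℂ) • Γ ip, Γ ip]
    (fun i => Γ (Sum.inr i))

theorem sum_invMetric_Γcoord (p : Param) (x : Pt) (μ : Idx) :
    ∑ κ, (((metric p x)⁻¹ μ κ : ℝ) : ℂ) • Γcoord p x κ = Γup p x μ := by
  rw [inv_metric, sum_idx]
  rcases μ with μ | i
  · fin_cases μ
    · simp [invMetric, Γcoord, Γup]
      module
    · simp [invMetric, Γcoord, Γup]
  · simp [invMetric, Γcoord, Γup, Matrix.one_apply, apply_ite Complex.ofReal]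

theorem Γ_inr_mul_Γ_ip (j : Fin 9) : Γ (Sum.inr j) * Γ ip =
    Matrix.fromBlocks 0 (-((Real.sqrt 2 : ℝ) : ℂ) • γ j) 0 0 := by
  simp [Γ, Matrix.fromBlocks_multiply]

theorem Γ_inr_mul_Γ_inr (i j : Fin 9) : Γ (Sum.inr i) * Γ (Sum.inr j) =
    Matrix.fromBlocks (γ i * γ j) 0 0 (γ i * γ j) := by
  simp [Γ, Matrix.fromBlocks_multiply]

theorem sum_fromBlocks_diag (m : Matrix (Fin 9) (Fin 9) ℂ) :
    ∑ i, ∑ j, m i j • Matrix.fromBlocks (γ i * γ j) 0 0 (γ i * γ j) =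
      (Matrix.fromBlocks (∑ i, ∑ j, m i j • (γ i * γ j)) 0 0 (∑ i, ∑ j, m i j • (γ i * γ j)) :
        Matrix (SV ⊕ SV) (SV ⊕ SV) ℂ) := by
  ext i j
  rcases i with i | i <;> rcases j with j | j <;> simp [Matrix.sum_apply]

theorem sum_dcov_smul {M : Type*} [AddCommGroup M] [Module ℂ M] (p : Param) (A : Even) (x : Pt)
    (T : Idx → Idx → M) :
    ∑ μ, ∑ ν, (dcov p A x μ ν * (1 / 2)) • T μ ν =
      ∑ i, (boost p A x i * (1 / 2)) • (T im (Sum.inr i) - T (Sum.inr i) ip)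
        + ∑ i, ∑ j, (A.m i j * (1 / 2)) • T (Sum.inr j) (Sum.inr i) := by
  rw [sum_idx, sum_idx, sum_idx]
  simp only [sum_idx (M := M)]
  simp [dcov, Finset.sum_add_distrib, smul_sub]
  rw [Finset.sum_comm]
  abel

theorem spin_term (p : Param) {A : Even} (hA : A.Valid) (x : Pt) :
    (1 / 4 : ℂ) • (∑ μ, ∑ ν, (covD p (field p A) x μ ν * (1 / 2)) •
        ((∑ κ, ((metric p x)⁻¹ μ κ : ℂ) • Γcoord p x κ) * Γcoord p x ν
          - Γcoord p x ν * (∑ κ, ((metric p x)⁻¹ μ κ : ℂ) • Γcoord p x κ))) =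
      Matrix.fromBlocks (-rot A.m)
        (((Real.sqrt 2 : ℝ) : ℂ)⁻¹ • ∑ i, boost p A x i • γ i) 0 (-rot A.m) := by
  have h0 := fun μ => sum_invMetric_Γcoord p x μ
  have h2 := ofReal_sqrt_two_sq
  have h3 := ofReal_sqrt_two_ne_zero
  simp only [covD_field p hA, h0]
  rw [sum_dcov_smul p A x (fun μ ν => Γup p x μ * Γcoord p x ν - Γcoord p x ν * Γup p x μ)]
  have e1 : ∀ i, (boost p A x i * (1 / 2)) • (Γup p x im * Γcoord p x (Sum.inr i)
      - Γcoord p x (Sum.inr i) * Γup p x im - (Γup p x (Sum.inr i) * Γcoord p x ip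
      - Γcoord p x ip * Γup p x (Sum.inr i))) = boost p A x i •
        Matrix.fromBlocks 0 ((2 * ((Real.sqrt 2 : ℝ) : ℂ)) • γ i) 0 0 := by
    intro i
    -- Raising the index - gives Γ₊, so the x-dependent corrections in `Γcoord` and `Γup` play no
    -- role.
    change (boost p A x i * (1 / 2)) • (Γ ip * Γ (Sum.inr i) - Γ (Sum.inr i) * Γ ip
      - (Γ (Sum.inr i) * Γ ip - Γ ip * Γ (Sum.inr i))) = _
    have h : (Matrix.fromBlocks 0 (-((Real.sqrt 2 : ℝ) : ℂ) • γ i) 0 0 :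
        Matrix (SV ⊕ SV) (SV ⊕ SV) ℂ) =
        -Matrix.fromBlocks 0 (((Real.sqrt 2 : ℝ) : ℂ) • γ i) 0 0 := by
      rw [Matrix.fromBlocks_neg]; simp
    have h' : (Matrix.fromBlocks 0 ((2 * ((Real.sqrt 2 : ℝ) : ℂ)) • γ i) 0 0 :
        Matrix (SV ⊕ SV) (SV ⊕ SV) ℂ) =
          (2 : ℂ) • Matrix.fromBlocks 0 (((Real.sqrt 2 : ℝ) : ℂ) • γ i) 0 0 := by
      rw [Matrix.fromBlocks_smul, smul_smul]; simp only [smul_zero]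
    rw [Γ_ip_mul_Γ_inr, Γ_inr_mul_Γ_ip, h, h']
    module
  have e2 : ∑ i, ∑ j, (A.m i j * (1 / 2)) • (Γup p x (Sum.inr j) * Γcoord p x (Sum.inr i)
      - Γcoord p x (Sum.inr i) * Γup p x (Sum.inr j)) =
        -∑ i, ∑ j, A.m i j • Matrix.fromBlocks (γ i * γ j) 0 0 (γ i * γ j) := by
    have h4 : ∑ i, ∑ j, A.m i j • (Γ (Sum.inr j) * Γ (Sum.inr i)) =
        -∑ i, ∑ j, A.m i j • (Γ (Sum.inr i) * Γ (Sum.inr j)) := by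
      rw [Finset.sum_comm, ← Finset.sum_neg_distrib]
      refine Finset.sum_congr rfl fun i _ => ?_
      rw [← Finset.sum_neg_distrib]
      exact Finset.sum_congr rfl fun j _ => by rw [hA.skew i j, neg_smul]
    have h5 : ∀ i j, (A.m i j * (1 / 2)) • (Γup p x (Sum.inr j) * Γcoord p x (Sum.inr i)
      - Γcoord p x (Sum.inr i) * Γup p x (Sum.inr j)) =
        (1 / 2 : ℂ) • (A.m i j • (Γ (Sum.inr j) * Γ (Sum.inr i)))
          - (1 / 2 : ℂ) • (A.m i j • (Γ (Sum.inr i) * Γ (Sum.inr j))) := by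
      intro i j
      change (A.m i j * (1 / 2)) • (Γ (Sum.inr j) * Γ (Sum.inr i)
        - Γ (Sum.inr i) * Γ (Sum.inr j)) = _
      module
    simp only [h5, Finset.sum_sub_distrib, ← Finset.smul_sum, h4]
    simp only [Γ_inr_mul_Γ_inr]
    module
  simp only [e1]
  rw [e2, sum_fromBlocks, sum_fromBlocks_diag, Matrix.fromBlocks_neg, Matrix.fromBlocks_add,
    Matrix.fromBlocks_smul, rot]
  congr 1
  · rw [zero_add, smul_neg]
  · rw [neg_zero, add_zero, Finset.smul_sum, Finset.smul_sum]
    refine Finset.sum_congr rfl fun i _ => ?_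
    rw [smul_smul, smul_smul, smul_smul]
    congr 1
    field_simp
    linear_combination (boost p A x i) * 2 * h2
  · simp
  · rw [zero_add, smul_neg]

/-- The action of the even part on the constants of the parallel spinors. -/
def act (p : Param) (A : Even) (w : Spinor) : Spinor :=
  Sum.elim
    (-(A.cm • (cbar p).mulVec (left w)) + (rot A.m).mulVec (left w) + ((Real.sqrt 2 : ℝ) : ℂ)⁻¹ •
      ∑ i, (A.u i • (s p i).mulVec (right w)
        + ((a p i : ℂ) ^ 2 * A.v i) • (γ i).mulVec (right w)))
    (-(A.cm • (dd p).mulVec (right w)) + (rot A.m).mulVec (right w))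

theorem act_mem {p : Param} {A : Even} (hA : A.Valid) {w : Spinor}
    (hw : w ∈ LinearMap.ker (Matrix.mulVecLin (onPlus Xminus))) :
    act p A w ∈ LinearMap.ker (Matrix.mulVecLin (onPlus Xminus)) := by
  rw [mem_ker_iff] at hw ⊢
  have h : right (act p A w) = -(A.cm • (dd p).mulVec (right w)) + (rot A.m).mulVec (right w) := rfl
  rw [h, Matrix.mulVec_add, Matrix.mulVec_neg, Matrix.mulVec_smul, Matrix.mulVec_mulVec,
    Matrix.mulVec_mulVec, ← dd_comm_Xplus, ← rot_comm_Xplus hA, ← Matrix.mulVec_mulVec,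
    ← Matrix.mulVec_mulVec, hw]

/-- Both sides solve y' = -c̄y with the same initial value: the relations c̄s = sd + a²γ and c̄γ =
γd + s make the left side a solution. Thus the effect of K_(i) and K_(i*) at x⁻ is transported from
constants at the origin. -/
theorem prof_s_sub_γ (p : Param) (u v : Fin 9 → ℂ) {w : SV → ℂ} (hw : Xplus.mulVec w = w) (t : ℝ) :
    ∑ i, (prof p u v i t • (s p i).mulVec ((flow₂ p t).mulVec w)
        - prof p (negSq p v) (-u) i t • (γ i).mulVec ((flow₂ p t).mulVec w)) =
      (flow₁ p t).mulVec
        (∑ i, (u i • (s p i).mulVec w + ((a p i : ℂ) ^ 2 * v i) • (γ i).mulVec w)) := by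
  let y : ℝ → SV → ℂ := fun t =>
    ∑ i, (prof p u v i t • (s p i).mulVec ((flow₂ p t).mulVec w)
        - prof p (negSq p v) (-u) i t • (γ i).mulVec ((flow₂ p t).mulVec w))
  have hd : ∀ (M : Matrix SV SV ℂ) (t : ℝ),
      HasDerivAt (fun t : ℝ => M.mulVec ((flow₂ p t).mulVec w))
        (-M.mulVec ((dd p).mulVec ((flow₂ p t).mulVec w))) t := by
    intro M t
    have := (LinearMap.toContinuousLinearMap ((Matrix.mulVecLin M).restrictScalars ℝ)
      ).hasFDerivAt.comp_hasDerivAt t (hasDerivAt_exp_mulVec (dd p) w t)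
    refine this.congr_deriv ?_
    change M.mulVec (-_) = _
    rw [Matrix.mulVec_neg]; rfl
  have hy : ∀ t, HasDerivAt y (-(cbar p).mulVec (y t)) t := by
    intro t
    have h := HasDerivAt.fun_sum (u := Finset.univ) fun i _ =>
      ((hasDerivAt_prof p u v i t).smul (hd (s p i) t)).sub
        ((hasDerivAt_prof p (negSq p v) (-u) i t).smul (hd (γ i) t))
    refine h.congr_deriv ?_
    have hη := Xplus_flow₂ p t hw
    simp only [y, Matrix.mulVec_sum, Matrix.mulVec_sub, Matrix.mulVec_smul,
      cbar_s_mulVec p _ hη, prof_negSq_neg]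
    rw [← Finset.sum_neg_distrib]
    refine Finset.sum_congr rfl fun i _ => ?_
    have hs : ∀ v, (s p i).mulVec v = (cbar p).mulVec ((γ i).mulVec v)
        - (γ i).mulVec ((dd p).mulVec v) := fun v => by
      rw [s, Matrix.sub_mulVec, Matrix.mulVec_mulVec, Matrix.mulVec_mulVec]
    have e : (cbar p).mulVec ((γ i).mulVec ((flow₂ p t).mulVec w)) =
        (s p i).mulVec ((flow₂ p t).mulVec w)
          + (γ i).mulVec ((dd p).mulVec ((flow₂ p t).mulVec w)) := by
      rw [hs]; abel
    rw [e]
    module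
  have h := eq_exp_mulVec hy t
  change y t = _
  rw [h]
  change (flow₁ p t).mulVec (y 0) = _
  congr 1
  refine Finset.sum_congr rfl fun i _ => ?_
  have h0 : flow₂ p 0 = 1 := by simp [flow₂]
  rw [h0, Matrix.one_mulVec]
  simp [prof, negSq]

theorem elim_neg (v w : SV → ℂ) : -(Sum.elim v w : Spinor) = Sum.elim (-v) (-w) := by
  ext k; rcases k with k | k <;> rfl

theorem sum_elim (v w : Fin 9 → SV → ℂ) :
    ∑ i, (Sum.elim (v i) (w i) : Spinor) = Sum.elim (∑ i, v i) (∑ i, w i) := by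
  ext k; rcases k with k | k <;> simp

theorem spinLie_field (p : Param) {A : Even} (hA : A.Valid) {w : Spinor}
    (hw : w ∈ LinearMap.ker (Matrix.mulVecLin (onPlus Xminus))) :
    spinLie p (field p A) (parallelSpinor p w) = parallelSpinor p (act p A w) := by
  funext x
  -- The spinor is D-parallel, so ∇ may be replaced by -ρ and no further differentiation is needed.
  have hn : ∀ μ, nabla p μ (parallelSpinor p w) x = -(ρ p μ).mulVec (parallelSpinor p w x) := by
    intro μ
    exact eq_neg_of_add_eq_zero_left (congrFun (parallel p hw μ) x)
  rw [spinLie, ← Matrix.smul_mulVec, spin_term p hA]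
  rw [mem_ker_iff] at hw
  simp only [hn]
  rw [sum_idx]
  simp only [ρ, field, Sum.elim_inl, Sum.elim_inr, Matrix.cons_val_zero, Matrix.cons_val_one,
    Matrix.zero_mulVec, neg_zero, smul_zero, zero_add, parallelSpinor_apply,
    fromBlocks_mulVec_elim, add_zero, Matrix.cons_val_fin_one, Matrix.neg_mulVec]
  have e1 : left (act p A w) = -(A.cm • (cbar p).mulVec (left w)) + (rot A.m).mulVec (left w)
      + ((Real.sqrt 2 : ℝ) : ℂ)⁻¹ • ∑ i, (A.u i • (s p i).mulVec (right w)
        + ((a p i : ℂ) ^ 2 * A.v i) • (γ i).mulVec (right w)) := rfl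
  have e2 : right (act p A w) = -(A.cm • (dd p).mulVec (right w)) + (rot A.m).mulVec (right w) :=
    rfl
  have hη := Xplus_flow₂ p (x im) hw
  have c1 := exp_mulVec_comm (rfl : cbar p * cbar p = _) (x im) (left w)
  have c2 := exp_mulVec_comm (rot_comm_cbar hA p) (x im) (left w)
  have c3 := exp_mulVec_comm (rfl : dd p * dd p = _) (x im) (right w)
  have c4 := exp_mulVec_comm (rot_comm_dd hA p) (x im) (right w)
  rw [← flow₁] at c1 c2
  rw [← flow₂] at c3 c4
  have e3 : (flow₂ p (x im)).mulVec (right (act p A w)) =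
      -(A.cm • (dd p).mulVec ((flow₂ p (x im)).mulVec (right w)))
        + (rot A.m).mulVec ((flow₂ p (x im)).mulVec (right w)) := by
    rw [e2, Matrix.mulVec_add, Matrix.mulVec_neg, Matrix.mulVec_smul, c3, c4]
  have e4 : (flow₁ p (x im)).mulVec (left (act p A w)) =
      -(A.cm • (cbar p).mulVec ((flow₁ p (x im)).mulVec (left w)))
        + (rot A.m).mulVec ((flow₁ p (x im)).mulVec (left w)) + ((Real.sqrt 2 : ℝ) : ℂ)⁻¹ •
        ∑ i, (prof p A.u A.v i (x im) • (s p i).mulVec ((flow₂ p (x im)).mulVec (right w))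
        - prof p (negSq p A.v) (-A.u) i (x im) •
          (γ i).mulVec ((flow₂ p (x im)).mulVec (right w))) := by
    rw [e1, Matrix.mulVec_add, Matrix.mulVec_add, Matrix.mulVec_neg, Matrix.mulVec_smul, c1, c2,
      prof_s_sub_γ p _ _ hw, Matrix.mulVec_smul]
  rw [e4, e3]
  set η := (flow₂ p (x im)).mulVec (right w)
  set ζ := (flow₁ p (x im)).mulVec (left w)
  have e5 : ∀ i, (rot A.m).mulVec ((s p i).mulVec η) =
      (s p i).mulVec ((rot A.m).mulVec η) - ∑ k, A.m k i • (s p k).mulVec η := by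
    intro i
    have := congrArg (fun M => M.mulVec η) (rot_comm_s hA p i)
    simp only [Matrix.sub_mulVec, ← Matrix.mulVec_mulVec, Matrix.neg_mulVec, mulVec_sum_smul]
      at this
    rw [sub_eq_iff_eq_add] at this
    rw [this]; abel
  have hm : ∑ i, (∑ j, A.m i j * (x (Sum.inr j) : ℂ)) • (s p i).mulVec η =
      ∑ i, (x (Sum.inr i) : ℂ) • ∑ k, A.m k i • (s p k).mulVec η := by
    simp only [Finset.sum_smul, Finset.smul_sum, smul_smul]
    rw [Finset.sum_comm]
    exact Finset.sum_congr rfl fun i _ => Finset.sum_congr rfl fun j _ => by rw [mul_comm]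
  have hb : ∑ i, boost p A x i • (γ i).mulVec η =
      ∑ i, prof p (negSq p A.v) (-A.u) i (x im) • (γ i).mulVec η
        - A.cm • ∑ i, (x (Sum.inr i) : ℂ) • (a p i : ℂ) ^ 2 • (γ i).mulVec η := by
    rw [Finset.smul_sum, ← Finset.sum_sub_distrib]
    exact Finset.sum_congr rfl fun i _ => by rw [boost]; module
  simp only [elim_neg, smul_elim, elim_add_elim, sum_elim, sub_eq_add_neg (G := Spinor)]
  congr 1
  · simp only [Matrix.mulVec_add, Matrix.mulVec_smul, Matrix.mulVec_neg, Matrix.mulVec_sum, e5,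
      cbar_s_mulVec p _ hη, Matrix.smul_mulVec, mulVec_sum_smul, hb, neg_neg]
    have hX : ∑ i, (prof p A.u A.v i (x im) + ∑ j, A.m i j * (x (Sum.inr j) : ℂ)) •
        ((Real.sqrt 2 : ℝ) : ℂ)⁻¹ • (s p i).mulVec η = ((Real.sqrt 2 : ℝ) : ℂ)⁻¹ •
        (∑ i, prof p A.u A.v i (x im) • (s p i).mulVec η
          + ∑ i, (x (Sum.inr i) : ℂ) • ∑ k, A.m k i • (s p k).mulVec η) := by
      rw [← hm, ← Finset.sum_add_distrib, Finset.smul_sum]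
      exact Finset.sum_congr rfl fun i _ => by module
    have hd : ∑ i, (x (Sum.inr i) : ℂ) • (-(A.cm • (s p i).mulVec ((dd p).mulVec η))
        + (s p i).mulVec ((rot A.m).mulVec η)) =
        -(A.cm • ∑ i, (x (Sum.inr i) : ℂ) • (s p i).mulVec ((dd p).mulVec η))
        + ∑ i, (x (Sum.inr i) : ℂ) • (s p i).mulVec ((rot A.m).mulVec η) := by
      rw [Finset.smul_sum, ← Finset.sum_neg_distrib, ← Finset.sum_add_distrib]
      exact Finset.sum_congr rfl fun i _ => by module
    rw [hX, hd]
    simp only [smul_sub, smul_add, Finset.sum_add_distrib, Finset.sum_sub_distrib]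
    module
  · simp

/-! ## The representation of the even part -/

/-- The map `S⁺ → S⁻` of the element `∑ u_i K_(i) + ∑ v_i K_(i*)`. -/
def oddMap (p : Param) (u v : Fin 9 → ℂ) (w : SV → ℂ) : SV → ℂ :=
  ∑ i, (u i • (s p i).mulVec w + ((a p i : ℂ) ^ 2 * v i) • (γ i).mulVec w)

theorem left_act (p : Param) (A : Even) (w : Spinor) : left (act p A w) =
    -(A.cm • (cbar p).mulVec (left w)) + (rot A.m).mulVec (left w)
      + ((Real.sqrt 2 : ℝ) : ℂ)⁻¹ • oddMap p A.u A.v (right w) := rfl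

theorem right_act (p : Param) (A : Even) (w : Spinor) : right (act p A w) =
    -(A.cm • (dd p).mulVec (right w)) + (rot A.m).mulVec (right w) := rfl

theorem oddMap_add_right (p : Param) (u v : Fin 9 → ℂ) (w w' : SV → ℂ) :
    oddMap p u v (w + w') = oddMap p u v w + oddMap p u v w' := by
  simp only [oddMap, Matrix.mulVec_add, ← Finset.sum_add_distrib]
  exact Finset.sum_congr rfl fun i _ => by module

theorem oddMap_smul_right (p : Param) (u v : Fin 9 → ℂ) (c : ℂ) (w : SV → ℂ) :
    oddMap p u v (c • w) = c • oddMap p u v w := by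
  simp only [oddMap, Matrix.mulVec_smul, Finset.smul_sum]
  exact Finset.sum_congr rfl fun i _ => by module

theorem oddMap_add_left (p : Param) (u v u' v' : Fin 9 → ℂ) (w : SV → ℂ) :
    oddMap p (u + u') (v + v') w = oddMap p u v w + oddMap p u' v' w := by
  simp only [oddMap, Pi.add_apply, ← Finset.sum_add_distrib]
  exact Finset.sum_congr rfl fun i _ => by module

theorem oddMap_smul_left (p : Param) (u v : Fin 9 → ℂ) (c : ℂ) (w : SV → ℂ) :
    oddMap p (c • u) (c • v) w = c • oddMap p u v w := by
  simp only [oddMap, Pi.smul_apply, smul_eq_mul, Finset.smul_sum]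
  exact Finset.sum_congr rfl fun i _ => by module

theorem cbar_γ_mulVec (p : Param) (i : Fin 9) (v : SV → ℂ) :
    (cbar p).mulVec ((γ i).mulVec v) = (γ i).mulVec ((dd p).mulVec v) + (s p i).mulVec v := by
  rw [s, Matrix.sub_mulVec, ← Matrix.mulVec_mulVec, ← Matrix.mulVec_mulVec]; abel

/-- Moving c̄ past an odd map changes (u, v) into (a²v, u), which up to sign is the bracket with ∂₋.
-/
theorem cbar_oddMap (p : Param) (u v : Fin 9 → ℂ) {w : SV → ℂ} (hw : Xplus.mulVec w = w) :
    (cbar p).mulVec (oddMap p u v w) =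
      oddMap p u v ((dd p).mulVec w) + oddMap p (-negSq p v) u w := by
  simp only [oddMap, Matrix.mulVec_sum, Matrix.mulVec_add, Matrix.mulVec_smul,
    cbar_s_mulVec p _ hw, cbar_γ_mulVec, ← Finset.sum_add_distrib]
  refine Finset.sum_congr rfl fun i _ => ?_
  simp only [negSq, Pi.neg_apply]
  module

theorem rot_γ_mulVec {A : Even} (hA : A.Valid) (i : Fin 9) (w : SV → ℂ) :
    (rot A.m).mulVec ((γ i).mulVec w) =
      (γ i).mulVec ((rot A.m).mulVec w) - ∑ k, A.m k i • (γ k).mulVec w := by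
  have := congrArg (fun M => M.mulVec w) (rot_comm_γ hA i)
  simp only [Matrix.sub_mulVec, ← Matrix.mulVec_mulVec, Matrix.neg_mulVec, mulVec_sum_smul] at this
  rw [sub_eq_iff_eq_add] at this
  rw [this]; abel

theorem rot_s_mulVec {A : Even} (hA : A.Valid) (p : Param) (i : Fin 9) (w : SV → ℂ) :
    (rot A.m).mulVec ((s p i).mulVec w) =
      (s p i).mulVec ((rot A.m).mulVec w) - ∑ k, A.m k i • (s p k).mulVec w := by
  have := congrArg (fun M => M.mulVec w) (rot_comm_s hA p i)
  simp only [Matrix.sub_mulVec, ← Matrix.mulVec_mulVec, Matrix.neg_mulVec, mulVec_sum_smul] at this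
  rw [sub_eq_iff_eq_add] at this
  rw [this]; abel

theorem rot_oddMap {A : Even} (hA : A.Valid) (p : Param) (u v : Fin 9 → ℂ) (w : SV → ℂ) :
    (rot A.m).mulVec (oddMap p u v w) =
      oddMap p u v ((rot A.m).mulVec w) - oddMap p (A.m.mulVec u) (A.m.mulVec v) w := by
  have h1 : ∑ i, u i • ∑ k, A.m k i • (s p k).mulVec w =
      ∑ i, A.m.mulVec u i • (s p i).mulVec w := by
    simp only [Matrix.mulVec, dotProduct, Finset.sum_smul, Finset.smul_sum, smul_smul]
    rw [Finset.sum_comm]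
    exact Finset.sum_congr rfl fun i _ => Finset.sum_congr rfl fun j _ => by rw [mul_comm]
  have h2 : ∑ i, ((a p i : ℂ) ^ 2 * v i) • ∑ k, A.m k i • (γ k).mulVec w =
      ∑ i, ((a p i : ℂ) ^ 2 * A.m.mulVec v i) • (γ i).mulVec w := by
    simp only [Matrix.mulVec, dotProduct, Finset.sum_smul, Finset.smul_sum, smul_smul,
      Finset.mul_sum]
    rw [Finset.sum_comm]
    refine Finset.sum_congr rfl fun i _ => Finset.sum_congr rfl fun j _ => ?_
    congr 1
    have := hA.mul_a p i j
    linear_combination (v j * (a p j + a p i)) * this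
  simp only [oddMap, Matrix.mulVec_sum, Matrix.mulVec_add, Matrix.mulVec_smul, rot_s_mulVec hA,
    rot_γ_mulVec hA, smul_sub, Finset.sum_add_distrib, Finset.sum_sub_distrib, h1, h2]
  abel

/-- On the second component only d and the rotations act. The fields K_(i), K_(i*) lead from the
second component to the first, so products of two such maps vanish, in agreement with ∂₊ acting by
zero. The mixed terms are `cbar_oddMap` and `rot_oddMap`. -/
theorem act_brk {p : Param} {A A' : Even} (hA : A.Valid) (hA' : A'.Valid) {w : Spinor}
    (hw : Xplus.mulVec (right w) = right w) :
    act p (brk p A A') w = act p A (act p A' w) - act p A' (act p A w) := by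
  have hd : ∀ {A : Even}, A.Valid → ∀ v : SV → ℂ, (rot A.m).mulVec ((dd p).mulVec v) =
      (dd p).mulVec ((rot A.m).mulVec v) := fun hA v => by
    rw [Matrix.mulVec_mulVec, Matrix.mulVec_mulVec, rot_comm_dd hA]
  have hc : ∀ {A : Even}, A.Valid → ∀ v : SV → ℂ, (rot A.m).mulVec ((cbar p).mulVec v) =
      (cbar p).mulVec ((rot A.m).mulVec v) := fun hA v => by
    rw [Matrix.mulVec_mulVec, Matrix.mulVec_mulVec, rot_comm_cbar hA]
  have e1 : right (act p (brk p A A') w) =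
      right (act p A (act p A' w)) - right (act p A' (act p A w)) := by
    simp only [right_act, rot_brk hA, Matrix.mulVec_add, Matrix.mulVec_neg, Matrix.mulVec_smul,
      hd hA, hd hA', Matrix.sub_mulVec, ← Matrix.mulVec_mulVec]
    simp only [brk]
    module
  have e2 : left (act p (brk p A A') w) =
      left (act p A (act p A' w)) - left (act p A' (act p A w)) := by
    have hu : oddMap p (brk p A A').u (brk p A A').v (right w) =
        -(A.cm • oddMap p (-negSq p A'.v) A'.u (right w))
        + A'.cm • oddMap p (-negSq p A.v) A.u (right w)
        + oddMap p (A'.m.mulVec A.u) (A'.m.mulVec A.v) (right w)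
        - oddMap p (A.m.mulVec A'.u) (A.m.mulVec A'.v) (right w) := by
      rw [← neg_smul, ← oddMap_smul_left, ← oddMap_smul_left, ← oddMap_add_left, ← oddMap_add_left,
        sub_eq_add_neg, ← neg_one_smul ℂ (oddMap _ _ _ _), ← oddMap_smul_left, ← oddMap_add_left]
      congr 1
      · simp only [brk]; module
      · simp only [brk]; module
    rw [left_act, hu]
    simp only [left_act, right_act, rot_brk hA, Matrix.mulVec_add,
      Matrix.mulVec_smul, hc hA, hc hA', Matrix.sub_mulVec, ← Matrix.mulVec_mulVec,
      cbar_oddMap p _ _ hw, rot_oddMap hA, rot_oddMap hA', oddMap_add_right, oddMap_smul_right,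
      ← neg_smul]
    simp only [brk]
    module
  rw [← elim_left_right (act p (brk p A A') w), e1, e2]
  ext k; rcases k with k | k <;> rfl

/-! ## The bracket of two parallel spinors -/

theorem form_add_right (x y z : SV → ℂ) : form x (y + z) = form x y + form x z := by
  simp only [form, Matrix.mulVec_add, dotProduct_add]

theorem form_smul_right (c : ℂ) (x y : SV → ℂ) : form x (c • y) = c * form x y := by
  simp only [form, Matrix.mulVec_smul, dotProduct_smul, smul_eq_mul]

theorem form_neg_right (x y : SV → ℂ) : form x (-y) = -form x y := by
  simp only [form, Matrix.mulVec_neg, dotProduct_neg]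

theorem form_sub_right (x y z : SV → ℂ) : form x (y - z) = form x y - form x z := by
  simp only [form, Matrix.mulVec_sub, dotProduct_sub]

theorem form_sum_right (x : SV → ℂ) (y : Fin 9 → SV → ℂ) :
    form x (∑ i, y i) = ∑ i, form x (y i) := by
  simp only [form, Matrix.mulVec_sum, dotProduct_sum]

theorem form_zero_right (x : SV → ℂ) : form x 0 = 0 := by
  simp [form]

theorem form_add_left (x y z : SV → ℂ) : form (x + y) z = form x z + form y z := by
  simp only [form, add_dotProduct]

theorem form_smul_left (c : ℂ) (x y : SV → ℂ) : form (c • x) y = c * form x y := by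
  simp only [form, smul_dotProduct, smul_eq_mul]

theorem form_neg_left (x y : SV → ℂ) : form (-x) y = -form x y := by
  simp only [form, neg_dotProduct]

theorem form_zero_left (x : SV → ℂ) : form 0 x = 0 := by
  simp [form]

theorem form_sum_left (y : Fin 9 → SV → ℂ) (x : SV → ℂ) :
    form (∑ i, y i) x = ∑ i, form (y i) x := by
  simp only [form, sum_dotProduct]

theorem C_elim (v w v' w' : SV → ℂ) : C (Sum.elim v w) (Sum.elim v' w') =
    -Complex.I * form v w' + Complex.I * form w v' := by
  rw [C, fromBlocks_mulVec_elim, sumElim_dotProduct_sumElim, Matrix.zero_mulVec,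
    Matrix.zero_mulVec, zero_add, add_zero, Matrix.smul_mulVec, Matrix.smul_mulVec,
    dotProduct_smul, dotProduct_smul, form, form, smul_eq_mul, smul_eq_mul]

theorem fst_eq (w : Spinor) : fst w = Sum.elim (left w) (0 : SV → ℂ) := rfl

theorem snd_eq (w : Spinor) : snd w = Sum.elim (0 : SV → ℂ) (right w) := rfl

/-- The Clifford elements `γ_i γ₁₂₅ γ_j - γ_j γ₁₂₅ γ_i`. -/
def wedge (i j : Fin 9) : Matrix SV SV ℂ := γ i * γ125 * γ j - γ j * γ125 * γ i

theorem wedge_swap (i j : Fin 9) : wedge j i = -wedge i j := by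
  rw [wedge, wedge, neg_sub]

theorem IsAdj.sub {M M' L L' : Matrix SV SV ℂ} (h : IsAdj M M') (h' : IsAdj L L') :
    IsAdj (M - L) (M' - L') := by
  rw [IsAdj, Matrix.transpose_sub, sub_mul, h, h', mul_sub]

theorem isAdj_wedge (i j : Fin 9) : IsAdj (wedge i j) (wedge i j) := by
  refine ((((isAdj_γ i).mul isAdj_γ125).mul (isAdj_γ j)).sub
    (((isAdj_γ j).mul isAdj_γ125).mul (isAdj_γ i))).congr ?_
  rw [wedge]
  noncomm_ring

theorem γ1234_mulVec {w : SV → ℂ} (hw : Xplus.mulVec w = w) : γ1234.mulVec w = w := by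
  conv_lhs => rw [← hw]
  rw [Matrix.mulVec_mulVec, γ1234_mul_Xplus, hw]

theorem γ125_mul_wedge (i j : Fin 9) : γ125 * wedge i j = (ε i * ε j) • (wedge i j * γ125) := by
  have h : ∀ i j, γ125 * (γ i * γ125 * γ j) = (ε i * ε j) • (γ i * γ125 * γ j * γ125) := by
    intro i j
    rw [← mul_assoc, ← mul_assoc, γ125_mul_γ, smul_mul_assoc, smul_mul_assoc,
      mul_assoc (γ i * γ125), γ125_mul_γ, mul_smul_comm, smul_smul, ← mul_assoc]
  rw [wedge, mul_sub, h, h, sub_mul, smul_sub, mul_comm (ε j)]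

theorem γ1234_mul_wedge (i j : Fin 9) : γ1234 * wedge i j = (χ i * χ j) • (wedge i j * γ1234) := by
  have h : ∀ i j, γ1234 * (γ i * γ125 * γ j) = (χ i * χ j) • (γ i * γ125 * γ j * γ1234) := by
    intro i j
    rw [← mul_assoc, ← mul_assoc, γ1234_mul_γ, smul_mul_assoc, smul_mul_assoc, mul_assoc (γ i),
      commute_γ1234_γ125, ← mul_assoc, mul_assoc (γ i * γ125), γ1234_mul_γ, mul_smul_comm,
      smul_smul, ← mul_assoc]
  rw [wedge, mul_sub, h, h, sub_mul, smul_sub, mul_comm (χ j)]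

theorem wedge_eq {i j : Fin 9} (h : i ≠ j) : wedge i j = (ε i + ε j) • (γ i * γ j * γ125) := by
  rw [wedge, mul_assoc, γ125_mul_γ, mul_smul_comm, mul_assoc (γ j), γ125_mul_γ, mul_smul_comm,
    ← mul_assoc, ← mul_assoc, γ_swap j i, swapSign, if_neg h, neg_one_smul, neg_mul]
  module

/-- For different blocks there are two mechanisms. Either ε_i = -ε_j and `wedge i j` itself is zero,
or χ_iχ_j = -1 and it maps the image of X⁺ to that of X⁻, which is orthogonal because γ₁₂₃₄ is
self-adjoint. Hence the rotations in the odd bracket stay within the blocks. -/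
theorem form_wedge_eq_zero {i j : Fin 9} (h : block i ≠ block j) {v w : SV → ℂ}
    (hv : Xplus.mulVec v = v) (hw : Xplus.mulVec w = w) : form v ((wedge i j).mulVec w) = 0 := by
  have hij : i ≠ j := fun e => h (congrArg block e)
  have h1 : (ε i + ε j = 0) ∨ (χ i * χ j = -1) := by
    clear hij
    fin_cases i <;> fin_cases j <;> first | exact absurd rfl h | simp [ε, χ]
  rcases h1 with h1 | h1
  · rw [wedge_eq hij, h1, zero_smul, Matrix.zero_mulVec, form_zero_right]
  · have h2 := isAdj_γ1234.form_left v ((wedge i j).mulVec w)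
    rw [γ1234_mulVec hv, Matrix.mulVec_mulVec, γ1234_mul_wedge, h1, Matrix.smul_mulVec,
      ← Matrix.mulVec_mulVec, γ1234_mulVec hw, form_smul_right] at h2
    linear_combination (1 / 2 : ℂ) * h2

theorem s_mulVec (p : Param) (i : Fin 9) {w : SV → ℂ} (hw : Xplus.mulVec w = w) :
    (s p i).mulVec w = (a p i : ℂ) • (γ125 * γ i).mulVec w := by
  have := congrArg (fun M => M.mulVec w) (s_mul_Xplus p i)
  simpa only [← Matrix.mulVec_mulVec, Matrix.smul_mulVec, hw] using this

theorem isAdj_sdc (p : Param) (i : Fin 9) : IsAdj (sdc p i) (s p i) := by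
  refine (((isAdj_dd p).mul (isAdj_γ i)).sub ((isAdj_γ i).mul (isAdj_cbar p))).congr ?_
  rw [s]
  noncomm_ring

/-- The coordinates of the bracket of two parallel spinors. -/
def oddData (p : Param) (v w : Spinor) : Even where
  cp := Complex.I * (Real.sqrt 2 : ℝ) * form (left v) (left w)
  cm := Complex.I * (Real.sqrt 2 : ℝ) * form (right v) (right w)
  u i := -Complex.I * (form (left v) ((γ i).mulVec (right w))
    + form (left w) ((γ i).mulVec (right v)))
  v i := Complex.I * (a p i : ℂ)⁻¹ * (form (left v) ((γ125 * γ i).mulVec (right w))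
    + form (left w) ((γ125 * γ i).mulVec (right v)))
  m := Matrix.of fun i j => -(Complex.I * (Real.sqrt 2 : ℝ) / 2) * a p j *
    form (right v) ((wedge i j).mulVec (right w))

theorem oddData_valid (p : Param) {v w : Spinor} (hv : Xplus.mulVec (right v) = right v)
    (hw : Xplus.mulVec (right w) = right w) : (oddData p v w).Valid where
  skew i j := by
    simp only [oddData, Matrix.of_apply]
    by_cases h : block i = block j
    · rw [wedge_swap, Matrix.neg_mulVec, form_neg_right, a_eq_of_block p h]; ring
    · rw [form_wedge_eq_zero h hv hw, form_wedge_eq_zero (Ne.symm h) hv hw]; ring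
  off i j h := by
    simp only [oddData, Matrix.of_apply]
    rw [form_wedge_eq_zero h hv hw, mul_zero]

/-- The form is symmetric and `wedge i j` is self-adjoint; the remaining two components are
symmetrised by definition. -/
theorem oddData_symm (p : Param) (v w : Spinor) : oddData p v w = oddData p w v := by
  ext
  · simp only [oddData, form_comm (left v)]
  · simp only [oddData, form_comm (right v)]
  · simp only [oddData, add_comm]
  · simp only [oddData, add_comm]
  · simp only [oddData, Matrix.of_apply]
    rw [← (isAdj_wedge _ _).form_left, form_comm]

theorem parallelSpinor_zero (p : Param) (w : Spinor) : parallelSpinor p w 0 = w := by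
  rw [parallelSpinor_apply]
  have h1 : flow₁ p ((0 : Pt) im) = 1 := by simp [flow₁]
  have h2 : flow₂ p ((0 : Pt) im) = 1 := by simp [flow₂]
  rw [h1, h2, Matrix.one_mulVec, Matrix.one_mulVec]
  simp [elim_left_right]

/-- The adjoint of s_{d,c̄}(e_j) is s_{c̄,d}(e_j), so both terms evaluate s on the image of X⁺,
where it is a_jγ₁₂₅γ_j. -/
theorem coefSO_eq (p : Param) {v w : Spinor} (hv : Xplus.mulVec (right v) = right v)
    (hw : Xplus.mulVec (right w) = right w) (i j : Fin 9) :
    coefSO p v w i j = (oddData p v w).m i j := by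
  have h1 : (Γ ip * onPlus (sdc p j * γ i + γ i * s p j)).mulVec (snd w) =
      Sum.elim (((Real.sqrt 2 : ℝ) : ℂ) • ((sdc p j).mulVec ((γ i).mulVec (right w))
        + (γ i).mulVec ((s p j).mulVec (right w)))) 0 := by
    rw [← Matrix.mulVec_mulVec, onPlus, snd_eq, fromBlocks_mulVec_elim]
    change (Matrix.fromBlocks 0 (((Real.sqrt 2 : ℝ) : ℂ) • 1) 0 0).mulVec _ = _
    rw [fromBlocks_mulVec_elim]
    simp only [Matrix.add_mulVec, Matrix.smul_mulVec, Matrix.one_mulVec, Matrix.zero_mulVec,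
      zero_add, add_zero, Matrix.mulVec_zero, ← Matrix.mulVec_mulVec]
  have h2 : form (right v) ((wedge i j).mulVec (right w)) =
      form ((γ125 * γ j).mulVec (right v)) ((γ i).mulVec (right w))
        + form (right v) ((γ i).mulVec ((γ125 * γ j).mulVec (right w))) := by
    rw [(isAdj_γ125.mul (isAdj_γ j)).form_left, ← form_add_right, Matrix.mulVec_mulVec,
      Matrix.mulVec_mulVec, ← Matrix.add_mulVec, wedge]
    congr 2
    noncomm_ring
  rw [coefSO, h1, snd_eq, C_elim, form_zero_right, form_smul_right, form_add_right,
    form_comm _ ((sdc p j).mulVec _), (isAdj_sdc p j).form_left, form_comm _ ((s p j).mulVec _),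
    s_mulVec p j hv, s_mulVec p j hw, Matrix.mulVec_smul, form_smul_left, form_smul_right]
  simp only [oddData, Matrix.of_apply, h2]
  ring

/-- The assumption on a_i is used for K_(i*), where B_i⁻¹a_i = -a_i⁻¹. Restricting the double sum to
equal blocks loses nothing, since the other coefficients vanish. -/
theorem oddBr_eq {p : Param} (ha : ∀ i, a p i ≠ 0) {v w : Spinor}
    (hv : Xplus.mulVec (right v) = right v) (hw : Xplus.mulVec (right w) = right w) :
    oddBr p (parallelSpinor p v) (parallelSpinor p w) = field p (oddData p v w) := by
  rw [field_eq_sum p (oddData_valid p hv hw), oddBr]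
  simp only [parallelSpinor_zero]
  have h1 : C (fst v) ((Γ im).mulVec (fst w)) = (oddData p v w).cp := by
    change C (fst v) ((Matrix.fromBlocks 0 0 (-((Real.sqrt 2 : ℝ) : ℂ) • 1) 0).mulVec (fst w)) = _
    rw [fst_eq, fst_eq, fromBlocks_mulVec_elim, C_elim]
    simp only [Matrix.smul_mulVec, Matrix.one_mulVec, Matrix.zero_mulVec, add_zero,
      form_smul_right, form_zero_left, oddData]
    ring
  have h2 : C (snd v) ((Γ ip).mulVec (snd w)) = (oddData p v w).cm := by
    change C (snd v) ((Matrix.fromBlocks 0 (((Real.sqrt 2 : ℝ) : ℂ) • 1) 0 0).mulVec (snd w)) = _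
    rw [snd_eq, snd_eq, fromBlocks_mulVec_elim, C_elim]
    simp only [Matrix.smul_mulVec, Matrix.one_mulVec, Matrix.zero_mulVec, zero_add, add_zero,
      form_smul_right, form_zero_left, oddData]
    ring
  have h3 : ∀ i, coefV v w i = (oddData p v w).u i := by
    intro i
    change C (fst v) ((Matrix.fromBlocks (-γ i) 0 0 (γ i)).mulVec (snd w))
      + C (fst w) ((Matrix.fromBlocks (-γ i) 0 0 (γ i)).mulVec (snd v)) = _
    rw [fst_eq, fst_eq, snd_eq, snd_eq, fromBlocks_mulVec_elim, fromBlocks_mulVec_elim, C_elim,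
      C_elim]
    simp [form_zero_left, oddData]
    ring
  have h4 : ∀ i, coefVstar p v w i = (oddData p v w).v i := by
    intro i
    have : (a p i : ℂ) ≠ 0 := Complex.ofReal_ne_zero.2 (ha i)
    rw [coefVstar, onPlus, fst_eq, fst_eq, snd_eq, snd_eq, fromBlocks_mulVec_elim,
      fromBlocks_mulVec_elim, C_elim, C_elim, s_mulVec p i hv, s_mulVec p i hw]
    simp only [Matrix.zero_mulVec, zero_add, form_zero_right, form_smul_right,
      form_smul_left, oddData, B, form_comm (left w)]
    push_cast
    field_simp
    ring
  have h5 : ∀ i j, (if block i = block j then coefSO p v w i j • killSO i j else 0) =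
      (oddData p v w).m i j • killSO i j := by
    intro i j
    split_ifs with h
    · rw [coefSO_eq p hv hw]
    · rw [(oddData_valid p hv hw).off i j h, zero_smul]
  simp only [h1, h2, h3, h4, h5]

/-! ## Equivariance of the odd bracket -/

theorem form_cbar_left (p : Param) (x y : SV → ℂ) :
    form ((cbar p).mulVec x) y = -form x ((cbar p).mulVec y) := by
  rw [(isAdj_cbar p).form_left, Matrix.neg_mulVec, form_neg_right]

theorem form_dd_left (p : Param) (x y : SV → ℂ) :
    form ((dd p).mulVec x) y = -form x ((dd p).mulVec y) := by
  rw [(isAdj_dd p).form_left, Matrix.neg_mulVec, form_neg_right]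

theorem form_rot_left {A : Even} (hA : A.Valid) (x y : SV → ℂ) :
    form ((rot A.m).mulVec x) y = -form x ((rot A.m).mulVec y) := by
  rw [(isAdj_rot hA).form_left, Matrix.neg_mulVec, form_neg_right]

theorem oddMap_eq (p : Param) (u v : Fin 9 → ℂ) {w : SV → ℂ} (hw : Xplus.mulVec w = w) :
    oddMap p u v w = ∑ i, ((a p i * u i : ℂ) • (γ125 * γ i).mulVec w
      + ((a p i : ℂ) ^ 2 * v i) • (γ i).mulVec w) := by
  refine Finset.sum_congr rfl fun i _ => ?_
  rw [s_mulVec p i hw, smul_smul, mul_comm]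

/-- Symmetrising in y and z produces an anticommutator of Clifford elements. With γ₁₂₅ in one factor
the same symmetrisation yields `wedge`, and with γ₁₂₅ in both the Clifford relation returns with
opposite sign. -/
theorem form_γ_γ (i k : Fin 9) (y z : SV → ℂ) :
    form ((γ k).mulVec y) ((γ i).mulVec z) + form ((γ k).mulVec z) ((γ i).mulVec y) =
      (if k = i then -2 else 0) * form y z := by
  rw [form_comm ((γ k).mulVec z), (isAdj_γ k).form_left, (isAdj_γ i).form_left, ← form_add_right,
    Matrix.mulVec_mulVec, Matrix.mulVec_mulVec, ← Matrix.add_mulVec, γ_anticomm,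
    Matrix.smul_mulVec, Matrix.one_mulVec, form_smul_right]

theorem form_γ125γ_γ (i k : Fin 9) (y z : SV → ℂ) :
    form ((γ125 * γ k).mulVec y) ((γ i).mulVec z) + form ((γ125 * γ k).mulVec z) ((γ i).mulVec y) =
      form y ((wedge i k).mulVec z) := by
  rw [form_comm ((γ125 * γ k).mulVec z), (isAdj_γ125.mul (isAdj_γ k)).form_left,
    (isAdj_γ i).form_left, ← form_add_right,
    Matrix.mulVec_mulVec, Matrix.mulVec_mulVec, ← Matrix.add_mulVec, wedge]
  congr 2
  noncomm_ring

theorem form_γ125γ_γ125γ (i k : Fin 9) (y z : SV → ℂ) :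
    form ((γ125 * γ k).mulVec y) ((γ125 * γ i).mulVec z)
      + form ((γ125 * γ k).mulVec z) ((γ125 * γ i).mulVec y) =
      (if k = i then 2 else 0) * form y z := by
  have h : ∀ x y : SV → ℂ, form ((γ125 * γ k).mulVec x) ((γ125 * γ i).mulVec y) =
      -form ((γ k).mulVec x) ((γ i).mulVec y) := by
    intro x y
    rw [← Matrix.mulVec_mulVec, isAdj_γ125.form_left, Matrix.mulVec_mulVec, neg_mul, ← mul_assoc,
      γ125_sq, one_mul, Matrix.neg_mulVec, form_neg_right]
  rw [h, h, ← neg_add, form_γ_γ]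
  split_ifs <;> ring

theorem form_oddMap_γ (p : Param) (u v : Fin 9 → ℂ) {y z : SV → ℂ} (hy : Xplus.mulVec y = y)
    (hz : Xplus.mulVec z = z) (i : Fin 9) :
    form (oddMap p u v y) ((γ i).mulVec z) + form (oddMap p u v z) ((γ i).mulVec y) =
      ∑ k, a p k * u k * form y ((wedge i k).mulVec z) - 2 * (a p i : ℂ) ^ 2 * v i * form y z := by
  rw [oddMap_eq p u v hy, oddMap_eq p u v hz, form_sum_left, form_sum_left,
    ← Finset.sum_add_distrib]
  simp only [form_add_left, form_smul_left]
  have h : ∀ k, a p k * u k * form ((γ125 * γ k).mulVec y) ((γ i).mulVec z)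
      + (a p k : ℂ) ^ 2 * v k * form ((γ k).mulVec y) ((γ i).mulVec z)
      + (a p k * u k * form ((γ125 * γ k).mulVec z) ((γ i).mulVec y)
      + (a p k : ℂ) ^ 2 * v k * form ((γ k).mulVec z) ((γ i).mulVec y)) =
      a p k * u k * form y ((wedge i k).mulVec z)
        + if k = i then -2 * (a p k : ℂ) ^ 2 * v k * form y z else 0 := by
    intro k
    have h2 := form_γ_γ i k y z
    rw [← form_γ125γ_γ]
    split_ifs at h2 ⊢
    · linear_combination (a p k : ℂ) ^ 2 * v k * h2
    · linear_combination (a p k : ℂ) ^ 2 * v k * h2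
  simp only [h, Finset.sum_add_distrib, Finset.sum_ite_eq', Finset.mem_univ, if_true]
  ring

theorem form_oddMap_γ125γ (p : Param) (u v : Fin 9 → ℂ) {y z : SV → ℂ} (hy : Xplus.mulVec y = y)
    (hz : Xplus.mulVec z = z) (i : Fin 9) :
    form (oddMap p u v y) ((γ125 * γ i).mulVec z) + form (oddMap p u v z) ((γ125 * γ i).mulVec y) =
      2 * a p i * u i * form y z - ∑ k, (a p k : ℂ) ^ 2 * v k * form y ((wedge i k).mulVec z) := by
  rw [oddMap_eq p u v hy, oddMap_eq p u v hz, form_sum_left, form_sum_left,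
    ← Finset.sum_add_distrib]
  simp only [form_add_left, form_smul_left]
  have h : ∀ k, a p k * u k * form ((γ125 * γ k).mulVec y) ((γ125 * γ i).mulVec z)
      + (a p k : ℂ) ^ 2 * v k * form ((γ k).mulVec y) ((γ125 * γ i).mulVec z)
      + (a p k * u k * form ((γ125 * γ k).mulVec z) ((γ125 * γ i).mulVec y)
      + (a p k : ℂ) ^ 2 * v k * form ((γ k).mulVec z) ((γ125 * γ i).mulVec y)) =
      (if k = i then 2 * a p k * u k * form y z else 0)
        - (a p k : ℂ) ^ 2 * v k * form y ((wedge i k).mulVec z) := by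
    intro k
    have h2 := form_γ125γ_γ125γ i k y z
    have h3 := form_γ125γ_γ k i y z
    rw [form_comm _ ((γ k).mulVec z), form_comm _ ((γ k).mulVec y), wedge_swap i k,
      Matrix.neg_mulVec, form_neg_right] at h3
    split_ifs at h2 ⊢
    · linear_combination (a p k : ℂ) * u k * h2 + (a p k : ℂ) ^ 2 * v k * h3
    · linear_combination (a p k : ℂ) * u k * h2 + (a p k : ℂ) ^ 2 * v k * h3
  simp only [h, Finset.sum_sub_distrib, Finset.sum_ite_eq', Finset.mem_univ, if_true]

theorem form_cbar_γ (p : Param) (i : Fin 9) (x : SV → ℂ) {y : SV → ℂ} (hy : Xplus.mulVec y = y) :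
    form ((cbar p).mulVec x) ((γ i).mulVec y) + form x ((γ i).mulVec ((dd p).mulVec y)) =
      -(a p i * form x ((γ125 * γ i).mulVec y)) := by
  rw [form_cbar_left, cbar_γ_mulVec, form_add_right, s_mulVec p i hy, form_smul_right]
  ring

theorem form_cbar_γ125γ (p : Param) (i : Fin 9) (x : SV → ℂ) {y : SV → ℂ}
    (hy : Xplus.mulVec y = y) :
    form ((cbar p).mulVec x) ((γ125 * γ i).mulVec y)
      + form x ((γ125 * γ i).mulVec ((dd p).mulVec y)) = -(a p i * form x ((γ i).mulVec y)) := by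
  have h : (cbar p).mulVec ((γ125 * γ i).mulVec y) =
      (γ125 * γ i).mulVec ((dd p).mulVec y) + (a p i : ℂ) • (γ i).mulVec y := by
    rw [Matrix.mulVec_mulVec, ← mul_assoc, cbar_comm_γ125, mul_assoc, ← Matrix.mulVec_mulVec,
      ← Matrix.mulVec_mulVec, cbar_γ_mulVec, s_mulVec p i hy, Matrix.mulVec_add,
      Matrix.mulVec_smul, Matrix.mulVec_mulVec _ γ125 (γ125 * γ i), ← mul_assoc γ125 γ125, γ125_sq,
      one_mul, Matrix.mulVec_mulVec _ γ125 (γ i)]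
  rw [form_cbar_left, h, form_add_right, form_smul_right]
  ring

theorem form_rot_γ {A : Even} (hA : A.Valid) (i : Fin 9) (x y : SV → ℂ) :
    form ((rot A.m).mulVec x) ((γ i).mulVec y) + form x ((γ i).mulVec ((rot A.m).mulVec y)) =
      ∑ k, A.m k i * form x ((γ k).mulVec y) := by
  rw [form_rot_left hA, rot_γ_mulVec hA, form_sub_right, form_sum_right]
  simp only [form_smul_right]
  ring

theorem form_rot_γ125γ {A : Even} (hA : A.Valid) (i : Fin 9) (x y : SV → ℂ) :
    form ((rot A.m).mulVec x) ((γ125 * γ i).mulVec y)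
      + form x ((γ125 * γ i).mulVec ((rot A.m).mulVec y)) =
      ∑ k, A.m k i * form x ((γ125 * γ k).mulVec y) := by
  have h : (rot A.m).mulVec ((γ125 * γ i).mulVec y) =
      (γ125 * γ i).mulVec ((rot A.m).mulVec y) - ∑ k, A.m k i • (γ125 * γ k).mulVec y := by
    rw [Matrix.mulVec_mulVec, ← mul_assoc, rot_comm_γ125 hA, mul_assoc, ← Matrix.mulVec_mulVec,
      ← Matrix.mulVec_mulVec, rot_γ_mulVec hA, Matrix.mulVec_sub, Matrix.mulVec_sum]
    simp only [Matrix.mulVec_smul, Matrix.mulVec_mulVec, mul_assoc]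
  rw [form_rot_left hA, h, form_sub_right, form_sum_right]
  simp only [form_smul_right]
  ring

theorem dd_mulVec (p : Param) {y : SV → ℂ} (hy : Xplus.mulVec y = y) :
    (dd p).mulVec y = (p 1 : ℂ) • γ125.mulVec y := by
  have := congrArg (fun M => M.mulVec y) (dd_mul_Xplus p)
  simpa only [← Matrix.mulVec_mulVec, Matrix.smul_mulVec, hy] using this

theorem Xplus_dd (p : Param) {y : SV → ℂ} (hy : Xplus.mulVec y = y) :
    Xplus.mulVec ((dd p).mulVec y) = (dd p).mulVec y := by
  rw [Matrix.mulVec_mulVec, ← dd_comm_Xplus, ← Matrix.mulVec_mulVec, hy]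

/-- Within a block γ₁₂₅ commutes with `wedge i j` and is skew for the form; across blocks both terms
vanish. So ∂₋ acts trivially on the rotation part of the odd bracket, as it must, since it commutes
with rotations. -/
theorem form_dd_wedge (p : Param) (i j : Fin 9) {y z : SV → ℂ} (hy : Xplus.mulVec y = y)
    (hz : Xplus.mulVec z = z) :
    form ((dd p).mulVec y) ((wedge i j).mulVec z)
      + form y ((wedge i j).mulVec ((dd p).mulVec z)) = 0 := by
  by_cases h : block i = block j
  · rw [dd_mulVec p hy, dd_mulVec p hz, form_smul_left, isAdj_γ125.form_left, Matrix.mulVec_mulVec,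
      neg_mul, γ125_mul_wedge, ε_eq_of_block h, ε_mul_self, one_smul, Matrix.neg_mulVec,
      form_neg_right, Matrix.mulVec_smul, form_smul_right, Matrix.mulVec_mulVec]
    ring
  · rw [form_wedge_eq_zero h (Xplus_dd p hy) hz, form_wedge_eq_zero h hy (Xplus_dd p hz), add_zero]

theorem rot_wedge {A : Even} (hA : A.Valid) (i j : Fin 9) :
    wedge i j * rot A.m - rot A.m * wedge i j =
      ∑ k, (A.m k i • wedge k j + A.m k j • wedge i k) := by
  have h : ∀ i j, γ i * γ125 * γ j * rot A.m - rot A.m * (γ i * γ125 * γ j) =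
      ∑ k, (A.m k i • (γ k * γ125 * γ j) + A.m k j • (γ i * γ125 * γ k)) := by
    intro i j
    have e : γ i * γ125 * γ j * rot A.m - rot A.m * (γ i * γ125 * γ j) =
        -(γ i * γ125 * (rot A.m * γ j - γ j * rot A.m))
          - (rot A.m * γ i - γ i * rot A.m) * γ125 * γ j
          + γ i * (γ125 * rot A.m - rot A.m * γ125) * γ j := by noncomm_ring
    rw [e, rot_comm_γ125 hA, sub_self, rot_comm_γ hA, rot_comm_γ hA, Finset.sum_add_distrib]
    simp only [mul_neg, neg_mul, Finset.mul_sum, Finset.sum_mul, smul_mul_assoc, mul_smul_comm,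
      mul_zero, zero_mul]
    abel
  have e2 : wedge i j * rot A.m - rot A.m * wedge i j =
      (γ i * γ125 * γ j * rot A.m - rot A.m * (γ i * γ125 * γ j))
        - (γ j * γ125 * γ i * rot A.m - rot A.m * (γ j * γ125 * γ i)) := by
    rw [wedge]; noncomm_ring
  rw [e2, h, h, ← Finset.sum_sub_distrib]
  refine Finset.sum_congr rfl fun k _ => ?_
  rw [wedge, wedge]
  module

theorem form_rot_wedge {A : Even} (hA : A.Valid) (i j : Fin 9) (y z : SV → ℂ) :
    form ((rot A.m).mulVec y) ((wedge i j).mulVec z)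
      + form y ((wedge i j).mulVec ((rot A.m).mulVec z)) =
      ∑ k, (A.m k i * form y ((wedge k j).mulVec z) + A.m k j * form y ((wedge i k).mulVec z)) := by
  have h := congrArg (fun M => form y (M.mulVec z)) (rot_wedge hA i j)
  simp only [Matrix.sub_mulVec, ← Matrix.mulVec_mulVec, form_sub_right, Matrix.sum_mulVec,
    form_sum_right, Matrix.add_mulVec, Matrix.smul_mulVec, form_add_right, form_smul_right] at h
  rw [form_rot_left hA, ← h]
  ring

/-- Equivariance is verified component by component and separately for the generators: ∂₋ through c̄
and d, rotations through `rot`, and K_(i), K_(i*) through `oddMap`. Skewness of c̄, d and `rot`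
disposes of most terms. -/
theorem brk_oddData {p : Param} (ha : ∀ i, a p i ≠ 0) {A : Even} (hA : A.Valid) {v w : Spinor}
    (hv : Xplus.mulVec (right v) = right v) (hw : Xplus.mulVec (right w) = right w) :
    brk p A (oddData p v w) =
      ⟨(oddData p (act p A v) w).cp + (oddData p v (act p A w)).cp,
        (oddData p (act p A v) w).cm + (oddData p v (act p A w)).cm,
        (oddData p (act p A v) w).u + (oddData p v (act p A w)).u,
        (oddData p (act p A v) w).v + (oddData p v (act p A w)).v,
        (oddData p (act p A v) w).m + (oddData p v (act p A w)).m⟩ := by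
  have h2 := ofReal_sqrt_two_sq
  have h3 := ofReal_sqrt_two_ne_zero
  have ha' : ∀ i, (a p i : ℂ) ≠ 0 := fun i => Complex.ofReal_ne_zero.2 (ha i)
  have hr : ((Real.sqrt 2 : ℝ) : ℂ)⁻¹ * ((Real.sqrt 2 : ℝ) : ℂ) = 1 := inv_mul_cancel₀ h3
  have hi : ((Real.sqrt 2 : ℝ) : ℂ)⁻¹ = ((Real.sqrt 2 : ℝ) : ℂ) / 2 := by
    field_simp; linear_combination -h2
  ext
  · simp only [oddData, left_act, form_add_left, form_neg_left, form_smul_left, form_add_right,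
      form_neg_right, form_smul_right, form_cbar_left, form_rot_left hA]
    rw [form_comm (left v) (oddMap _ _ _ _), oddMap_eq p _ _ hv, oddMap_eq p _ _ hw,
      form_sum_left, form_sum_left]
    simp only [brk, form_add_left, form_smul_left, form_comm (left v), form_comm (left w)]
    have e : ∀ i, (a p i : ℂ) ^ 2 * (A.u i * (Complex.I * (a p i : ℂ)⁻¹ *
        (form ((γ125 * γ i).mulVec (right w)) (left v)
          + form ((γ125 * γ i).mulVec (right v)) (left w))) - A.v i * (-Complex.I *
        (form ((γ i).mulVec (right w)) (left v) + form ((γ i).mulVec (right v)) (left w)))) =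
        Complex.I * (a p i * A.u i * form ((γ125 * γ i).mulVec (right v)) (left w)
          + (a p i : ℂ) ^ 2 * A.v i * form ((γ i).mulVec (right v)) (left w))
        + Complex.I * (a p i * A.u i * form ((γ125 * γ i).mulVec (right w)) (left v)
          + (a p i : ℂ) ^ 2 * A.v i * form ((γ i).mulVec (right w)) (left v)) := by
      intro i
      have := ha' i
      field_simp
      ring
    rw [Finset.sum_congr rfl fun i _ => e i, Finset.sum_add_distrib, ← Finset.mul_sum,
      ← Finset.mul_sum]
    linear_combination (-Complex.I * (∑ i, (a p i * A.u i *
      form ((γ125 * γ i).mulVec (right v)) (left w)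
        + (a p i : ℂ) ^ 2 * A.v i * form ((γ i).mulVec (right v)) (left w))
      + ∑ i, (a p i * A.u i * form ((γ125 * γ i).mulVec (right w)) (left v)
        + (a p i : ℂ) ^ 2 * A.v i * form ((γ i).mulVec (right w)) (left v)))) * hr
  · simp only [oddData, right_act, form_add_left, form_neg_left, form_smul_left, form_add_right,
      form_neg_right, form_smul_right, form_dd_left, form_rot_left hA, brk]
    ring
  · rename_i i
    -- The facts named f1, f2 and f3 treat the contributions of ∂₋, of the rotations and of K_(i),
    -- K_(i*); primes exchange `v` and `w`.
    have f1 := form_cbar_γ p i (left v) hw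
    have f1' := form_cbar_γ p i (left w) hv
    have f2 := form_rot_γ hA i (left v) (right w)
    have f2' := form_rot_γ hA i (left w) (right v)
    have f3 := form_oddMap_γ p A.u A.v hv hw i
    have e1 : ∑ k, (oddData p v w).m i k * A.u k = -(Complex.I * (Real.sqrt 2 : ℝ) / 2) *
        ∑ k, a p k * A.u k * form (right v) ((wedge i k).mulVec (right w)) := by
      rw [Finset.mul_sum]
      exact Finset.sum_congr rfl fun k _ => by simp only [oddData, Matrix.of_apply]; ring
    have e2 : ∑ k, A.m i k * (oddData p v w).u k = Complex.I *
        (∑ k, A.m k i * form (left v) ((γ k).mulVec (right w))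
          + ∑ k, A.m k i * form (left w) ((γ k).mulVec (right v))) := by
      rw [← Finset.sum_add_distrib, Finset.mul_sum]
      exact Finset.sum_congr rfl fun k _ => by simp only [oddData]; rw [hA.skew k i]; ring
    change A.cm * negSq p (oddData p v w).v i - (oddData p v w).cm * negSq p A.v i
      + ∑ k, (oddData p v w).m i k * A.u k - ∑ k, A.m i k * (oddData p v w).u k = _
    rw [e1, e2, ← f2, ← f2']
    simp only [oddData, negSq, Pi.add_apply, left_act, right_act, form_add_left, form_neg_left,
      form_smul_left, form_add_right, form_neg_right, form_smul_right, Matrix.mulVec_add,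
      Matrix.mulVec_neg, Matrix.mulVec_smul]
    have haa : (a p i : ℂ) ^ 2 * (a p i : ℂ)⁻¹ = a p i := by have := ha' i; field_simp
    rw [hi]
    linear_combination (-Complex.I * A.cm) * (f1 + f1')
      + Complex.I * (Real.sqrt 2 : ℝ) / 2 * f3
      - A.cm * Complex.I * (form (left v) ((γ125 * γ i).mulVec (right w))
        + form (left w) ((γ125 * γ i).mulVec (right v))) * haa
  · rename_i i
    have f1 := form_cbar_γ125γ p i (left v) hw
    have f1' := form_cbar_γ125γ p i (left w) hv
    have f2 := form_rot_γ125γ hA i (left v) (right w)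
    have f2' := form_rot_γ125γ hA i (left w) (right v)
    have f3 := form_oddMap_γ125γ p A.u A.v hv hw i
    have haa : (a p i : ℂ) * (a p i : ℂ)⁻¹ = 1 := mul_inv_cancel₀ (ha' i)
    have e1 : ∑ k, (oddData p v w).m i k * A.v k =
        -(Complex.I * (Real.sqrt 2 : ℝ) / 2) * (a p i : ℂ)⁻¹ *
        ∑ k, (a p k : ℂ) ^ 2 * A.v k * form (right v) ((wedge i k).mulVec (right w)) := by
      rw [Finset.mul_sum]
      refine Finset.sum_congr rfl fun k _ => ?_
      simp only [oddData, Matrix.of_apply]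
      -- Inside a block a_k = a_i allows a_k to be written as a_i⁻¹a_k²; across blocks the form
      -- vanishes.
      by_cases h : block i = block k
      · rw [← a_eq_of_block p h]
        linear_combination (Complex.I * (Real.sqrt 2 : ℝ) / 2) * a p i * A.v k *
          form (right v) ((wedge i k).mulVec (right w)) * haa
      · rw [form_wedge_eq_zero h hv hw]; ring
    have e2 : ∑ k, A.m i k * (oddData p v w).v k = -Complex.I * (a p i : ℂ)⁻¹ *
        (∑ k, A.m k i * form (left v) ((γ125 * γ k).mulVec (right w))
          + ∑ k, A.m k i * form (left w) ((γ125 * γ k).mulVec (right v))) := by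
      rw [← Finset.sum_add_distrib, Finset.mul_sum]
      refine Finset.sum_congr rfl fun k _ => ?_
      simp only [oddData]
      rw [hA.skew i k]
      by_cases h : block i = block k
      · rw [a_eq_of_block p h]; ring
      · rw [hA.off i k h]; ring
    change -(A.cm * (oddData p v w).u i) + (oddData p v w).cm * A.u i
      + ∑ k, (oddData p v w).m i k * A.v k - ∑ k, A.m i k * (oddData p v w).v k = _
    rw [e1, e2, ← f2, ← f2']
    simp only [oddData, Pi.add_apply, left_act, right_act, form_add_left, form_neg_left,
      form_smul_left, form_add_right, form_neg_right, form_smul_right, Matrix.mulVec_add,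
      Matrix.mulVec_neg, Matrix.mulVec_smul]
    rw [hi]
    linear_combination (Complex.I * (a p i : ℂ)⁻¹ * A.cm) * (f1 + f1')
      - Complex.I * (a p i : ℂ)⁻¹ * (Real.sqrt 2 : ℝ) / 2 * f3
      - (A.cm * Complex.I * (form (left v) ((γ i).mulVec (right w))
        + form (left w) ((γ i).mulVec (right v)))
        + Complex.I * (Real.sqrt 2 : ℝ) * A.u i * form (right v) (right w)) * haa
  · rename_i i j
    have f1 := form_dd_wedge p i j hv hw
    have f2 := form_rot_wedge hA i j (right v) (right w)
    have e1 : ∑ k, (oddData p v w).m i k * A.m k j - ∑ k, A.m i k * (oddData p v w).m k j =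
        -(Complex.I * (Real.sqrt 2 : ℝ) / 2) * a p j *
        ∑ k, (A.m k i * form (right v) ((wedge k j).mulVec (right w))
          + A.m k j * form (right v) ((wedge i k).mulVec (right w))) := by
      rw [← Finset.sum_sub_distrib, Finset.mul_sum]
      refine Finset.sum_congr rfl fun k _ => ?_
      simp only [oddData, Matrix.of_apply]
      rw [hA.skew k i]
      linear_combination (Complex.I * (Real.sqrt 2 : ℝ) / 2) *
        form (right v) ((wedge i k).mulVec (right w)) * hA.mul_a p k j
    change ∑ k, (oddData p v w).m i k * A.m k j - ∑ k, A.m i k * (oddData p v w).m k j = _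
    rw [e1, ← f2]
    simp only [oddData, Matrix.of_apply, Matrix.add_apply, right_act, form_add_left,
      form_neg_left, form_smul_left, form_add_right, form_neg_right, form_smul_right,
      Matrix.mulVec_add, Matrix.mulVec_neg, Matrix.mulVec_smul]
    linear_combination (-(Complex.I * (Real.sqrt 2 : ℝ) / 2) * a p j * A.cm) * f1

/-! ## Spinors in coordinates -/

/-- The spinor with given halves. -/
def sv (x y : Fin 8 → ℂ) : SV → ℂ := fun k => ![x, y] k.1 k.2

theorem kron_mulVec_sv (b c d e : ℂ) (M : Matrix (Fin 8) (Fin 8) ℂ) (x y : Fin 8 → ℂ) :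
    ((!![b, c; d, e] : Matrix (Fin 2) (Fin 2) ℂ) ⊗ₖ M).mulVec (sv x y) =
      sv (b • M.mulVec x + c • M.mulVec y) (d • M.mulVec x + e • M.mulVec y) := by
  ext ⟨s, k⟩
  fin_cases s <;>
    simp [sv, Matrix.mulVec, dotProduct, Fintype.sum_prod_type, Matrix.kroneckerMap_apply,
      Finset.mul_sum, mul_assoc]

theorem γ_mulVec_sv (i : Fin 7) (x y : Fin 8 → ℂ) :
    (γ (Fin.castAdd 2 i)).mulVec (sv x y) = sv ((octC i).mulVec y) ((octC i).mulVec x) := by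
  rw [γ_castAdd, kron_mulVec_sv]
  simp

section
variable (x0 x1 x2 x3 x4 x5 x6 x7 y0 y1 y2 y3 y4 y5 y6 y7 : ℂ)

/-- Together with the analogous tables below, this turns the action of every γ_i on a generic spinor
into a signed permutation of components, up to factors of the imaginary unit, so that the Fierz
identities become polynomial identities. -/
theorem octC_mulVec_0 : (octC 0).mulVec ![x0, x1, x2, x3, x4, x5, x6, x7] =
    ![-x1, x0, -x3, x2, -x5, x4, x7, -x6] := by
  ext k
  fin_cases k <;> simp [octC, octL, Matrix.mulVec, dotProduct, Fin.sum_univ_eight]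

theorem γ0_sv : (γ 0).mulVec
    (sv ![x0, x1, x2, x3, x4, x5, x6, x7] ![y0, y1, y2, y3, y4, y5, y6, y7]) =
    sv ![-y1, y0, -y3, y2, -y5, y4, y7, -y6] ![-x1, x0, -x3, x2, -x5, x4, x7, -x6] := by
  rw [← octC_mulVec_0, ← octC_mulVec_0]
  exact γ_mulVec_sv 0 _ _

theorem octC_mulVec_1 : (octC 1).mulVec ![x0, x1, x2, x3, x4, x5, x6, x7] =
    ![-x2, x3, x0, -x1, -x6, -x7, x4, x5] := by
  ext k
  fin_cases k <;> simp [octC, octL, Matrix.mulVec, dotProduct, Fin.sum_univ_eight]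

theorem γ1_sv : (γ 1).mulVec
    (sv ![x0, x1, x2, x3, x4, x5, x6, x7] ![y0, y1, y2, y3, y4, y5, y6, y7]) =
    sv ![-y2, y3, y0, -y1, -y6, -y7, y4, y5] ![-x2, x3, x0, -x1, -x6, -x7, x4, x5] := by
  rw [← octC_mulVec_1, ← octC_mulVec_1]
  exact γ_mulVec_sv 1 _ _

theorem octC_mulVec_2 : (octC 2).mulVec ![x0, x1, x2, x3, x4, x5, x6, x7] =
    ![-x3, -x2, x1, x0, -x7, x6, -x5, x4] := by
  ext k
  fin_cases k <;> simp [octC, octL, Matrix.mulVec, dotProduct, Fin.sum_univ_eight]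

theorem γ2_sv : (γ 2).mulVec
    (sv ![x0, x1, x2, x3, x4, x5, x6, x7] ![y0, y1, y2, y3, y4, y5, y6, y7]) =
    sv ![-y3, -y2, y1, y0, -y7, y6, -y5, y4] ![-x3, -x2, x1, x0, -x7, x6, -x5, x4] := by
  rw [← octC_mulVec_2, ← octC_mulVec_2]
  exact γ_mulVec_sv 2 _ _

theorem octC_mulVec_3 : (octC 3).mulVec ![x0, x1, x2, x3, x4, x5, x6, x7] =
    ![-x4, x5, x6, x7, x0, -x1, -x2, -x3] := by
  ext k
  fin_cases k <;> simp [octC, octL, Matrix.mulVec, dotProduct, Fin.sum_univ_eight]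

theorem γ3_sv : (γ 3).mulVec
    (sv ![x0, x1, x2, x3, x4, x5, x6, x7] ![y0, y1, y2, y3, y4, y5, y6, y7]) =
    sv ![-y4, y5, y6, y7, y0, -y1, -y2, -y3] ![-x4, x5, x6, x7, x0, -x1, -x2, -x3] := by
  rw [← octC_mulVec_3, ← octC_mulVec_3]
  exact γ_mulVec_sv 3 _ _

theorem octC_mulVec_4 : (octC 4).mulVec ![x0, x1, x2, x3, x4, x5, x6, x7] =
    ![-x5, -x4, x7, -x6, x1, x0, x3, -x2] := by
  ext k
  fin_cases k <;> simp [octC, octL, Matrix.mulVec, dotProduct, Fin.sum_univ_eight]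

theorem γ4_sv : (γ 4).mulVec
    (sv ![x0, x1, x2, x3, x4, x5, x6, x7] ![y0, y1, y2, y3, y4, y5, y6, y7]) =
    sv ![-y5, -y4, y7, -y6, y1, y0, y3, -y2] ![-x5, -x4, x7, -x6, x1, x0, x3, -x2] := by
  rw [← octC_mulVec_4, ← octC_mulVec_4]
  exact γ_mulVec_sv 4 _ _

theorem octC_mulVec_5 : (octC 5).mulVec ![x0, x1, x2, x3, x4, x5, x6, x7] =
    ![-x6, -x7, -x4, x5, x2, -x3, x0, x1] := by
  ext k
  fin_cases k <;> simp [octC, octL, Matrix.mulVec, dotProduct, Fin.sum_univ_eight]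

theorem γ5_sv : (γ 5).mulVec
    (sv ![x0, x1, x2, x3, x4, x5, x6, x7] ![y0, y1, y2, y3, y4, y5, y6, y7]) =
    sv ![-y6, -y7, -y4, y5, y2, -y3, y0, y1] ![-x6, -x7, -x4, x5, x2, -x3, x0, x1] := by
  rw [← octC_mulVec_5, ← octC_mulVec_5]
  exact γ_mulVec_sv 5 _ _

theorem octC_mulVec_6 : (octC 6).mulVec ![x0, x1, x2, x3, x4, x5, x6, x7] =
    ![-x7, x6, -x5, -x4, x3, x2, -x1, x0] := by
  ext k
  fin_cases k <;> simp [octC, octL, Matrix.mulVec, dotProduct, Fin.sum_univ_eight]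

theorem γ6_sv : (γ 6).mulVec
    (sv ![x0, x1, x2, x3, x4, x5, x6, x7] ![y0, y1, y2, y3, y4, y5, y6, y7]) =
    sv ![-y7, y6, -y5, -y4, y3, y2, -y1, y0] ![-x7, x6, -x5, -x4, x3, x2, -x1, x0] := by
  rw [← octC_mulVec_6, ← octC_mulVec_6]
  exact γ_mulVec_sv 6 _ _

theorem γ7_sv : (γ 7).mulVec
    (sv ![x0, x1, x2, x3, x4, x5, x6, x7] ![y0, y1, y2, y3, y4, y5, y6, y7]) =
    sv ![-y0, -y1, -y2, -y3, -y4, -y5, -y6, -y7] ![x0, x1, x2, x3, x4, x5, x6, x7] := by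
  refine (congrArg (fun M => Matrix.mulVec M _) γ_seven).trans ?_
  rw [kron_mulVec_sv]
  simp

theorem γ8_sv : (γ 8).mulVec
    (sv ![x0, x1, x2, x3, x4, x5, x6, x7] ![y0, y1, y2, y3, y4, y5, y6, y7]) =
    sv ![-(Complex.I * x0), -(Complex.I * x1), -(Complex.I * x2), -(Complex.I * x3),
        -(Complex.I * x4), -(Complex.I * x5), -(Complex.I * x6), -(Complex.I * x7)]
      ![Complex.I * y0, Complex.I * y1, Complex.I * y2, Complex.I * y3,
        Complex.I * y4, Complex.I * y5, Complex.I * y6, Complex.I * y7] := by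
  refine (congrArg (fun M => Matrix.mulVec M _) γ_eight).trans ?_
  rw [kron_mulVec_sv]
  simp

theorem γ125_sv : γ125.mulVec
    (sv ![x0, x1, x2, x3, x4, x5, x6, x7] ![y0, y1, y2, y3, y4, y5, y6, y7]) =
    sv ![y6, -y7, -y4, -y5, -y2, -y3, y0, -y1] ![x6, -x7, -x4, -x5, -x2, -x3, x0, -x1] := by
  simp only [γ125, ← Matrix.mulVec_mulVec, γ0_sv, γ1_sv, γ4_sv, neg_neg]

theorem γ1234_sv : γ1234.mulVec
    (sv ![x0, x1, x2, x3, x4, x5, x6, x7] ![y0, y1, y2, y3, y4, y5, y6, y7]) =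
    sv ![x4, -x5, -x6, -x7, x0, -x1, -x2, -x3] ![y4, -y5, -y6, -y7, y0, -y1, -y2, -y3] := by
  simp only [γ1234, ← Matrix.mulVec_mulVec, γ0_sv, γ1_sv, γ2_sv, γ3_sv, neg_neg]

end

theorem form_sv (x y z w : Fin 8 → ℂ) : form (sv x y) (sv z w) = x ⬝ᵥ z - y ⬝ᵥ w := by
  rw [form, CV, kron_mulVec_sv]
  simp [dotProduct, Fintype.sum_prod_type, sv, sub_eq_add_neg]

section
variable (c x0 x1 x2 x3 x4 x5 x6 x7 y0 y1 y2 y3 y4 y5 y6 y7 : ℂ)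
  (z0 z1 z2 z3 z4 z5 z6 z7 w0 w1 w2 w3 w4 w5 w6 w7 : ℂ)

theorem form_sv_sv : form (sv ![x0, x1, x2, x3, x4, x5, x6, x7] ![y0, y1, y2, y3, y4, y5, y6, y7])
    (sv ![z0, z1, z2, z3, z4, z5, z6, z7] ![w0, w1, w2, w3, w4, w5, w6, w7]) =
    x0 * z0 + x1 * z1 + x2 * z2 + x3 * z3 + x4 * z4 + x5 * z5 + x6 * z6 + x7 * z7
      - (y0 * w0 + y1 * w1 + y2 * w2 + y3 * w3 + y4 * w4 + y5 * w5 + y6 * w6 + y7 * w7) := by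
  rw [form_sv]
  simp [dotProduct, Fin.sum_univ_eight]

theorem sv_add_sv : sv ![x0, x1, x2, x3, x4, x5, x6, x7] ![y0, y1, y2, y3, y4, y5, y6, y7]
    + sv ![z0, z1, z2, z3, z4, z5, z6, z7] ![w0, w1, w2, w3, w4, w5, w6, w7] =
    sv ![x0 + z0, x1 + z1, x2 + z2, x3 + z3, x4 + z4, x5 + z5, x6 + z6, x7 + z7]
      ![y0 + w0, y1 + w1, y2 + w2, y3 + w3, y4 + w4, y5 + w5, y6 + w6, y7 + w7] := by
  ext ⟨s, k⟩; fin_cases s <;> fin_cases k <;> rfl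

theorem smul_sv : c • sv ![x0, x1, x2, x3, x4, x5, x6, x7] ![y0, y1, y2, y3, y4, y5, y6, y7] =
    sv ![c * x0, c * x1, c * x2, c * x3, c * x4, c * x5, c * x6, c * x7]
      ![c * y0, c * y1, c * y2, c * y3, c * y4, c * y5, c * y6, c * y7] := by
  ext ⟨s, k⟩; fin_cases s <;> fin_cases k <;> rfl

theorem neg_sv : -sv ![x0, x1, x2, x3, x4, x5, x6, x7] ![y0, y1, y2, y3, y4, y5, y6, y7] =
    sv ![-x0, -x1, -x2, -x3, -x4, -x5, -x6, -x7] ![-y0, -y1, -y2, -y3, -y4, -y5, -y6, -y7] := by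
  ext ⟨s, k⟩; fin_cases s <;> fin_cases k <;> rfl

variable {c x0 x1 x2 x3 x4 x5 x6 x7 y0 y1 y2 y3 y4 y5 y6 y7}
  {z0 z1 z2 z3 z4 z5 z6 z7 w0 w1 w2 w3 w4 w5 w6 w7}

theorem sv_congr (h0 : x0 = z0) (h1 : x1 = z1) (h2 : x2 = z2) (h3 : x3 = z3)
    (h4 : x4 = z4) (h5 : x5 = z5) (h6 : x6 = z6) (h7 : x7 = z7)
    (k0 : y0 = w0) (k1 : y1 = w1) (k2 : y2 = w2) (k3 : y3 = w3)
    (k4 : y4 = w4) (k5 : y5 = w5) (k6 : y6 = w6) (k7 : y7 = w7) :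
    sv ![x0, x1, x2, x3, x4, x5, x6, x7] ![y0, y1, y2, y3, y4, y5, y6, y7] =
      sv ![z0, z1, z2, z3, z4, z5, z6, z7] ![w0, w1, w2, w3, w4, w5, w6, w7] := by
  rw [h0, h1, h2, h3, h4, h5, h6, h7, k0, k1, k2, k3, k4, k5, k6, k7]

end

theorem eq_sv (φ : SV → ℂ) : φ = sv ![φ (0, 0), φ (0, 1), φ (0, 2), φ (0, 3), φ (0, 4), φ (0, 5),
    φ (0, 6), φ (0, 7)] ![φ (1, 0), φ (1, 1), φ (1, 2), φ (1, 3), φ (1, 4), φ (1, 5), φ (1, 6),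
    φ (1, 7)] := by
  ext ⟨s, k⟩; fin_cases s <;> fin_cases k <;> rfl

/-- The elements of the image of `X⁺`. -/
def psv (x0 x1 x2 x3 y0 y1 y2 y3 : ℂ) : SV → ℂ :=
  sv ![x0, x1, x2, x3, x0, -x1, -x2, -x3] ![y0, y1, y2, y3, y0, -y1, -y2, -y3]

/-- The image of X⁺ is fixed by γ₁₂₃₄, whose table determines the last four components of each half
by the first four. -/
theorem eq_psv {ψ : SV → ℂ} (h : Xplus.mulVec ψ = ψ) : ψ = psv (ψ (0, 0)) (ψ (0, 1)) (ψ (0, 2))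
    (ψ (0, 3)) (ψ (1, 0)) (ψ (1, 1)) (ψ (1, 2)) (ψ (1, 3)) := by
  have e := congrFun (((γ1234_sv _ _ _ _ _ _ _ _ _ _ _ _ _ _ _ _).symm.trans
    (congrArg γ1234.mulVec (eq_sv ψ)).symm).trans (γ1234_mulVec h))
  have e1 : ψ (0, 0) = ψ (0, 4) := e (0, 4)
  have e2 : -ψ (0, 1) = ψ (0, 5) := e (0, 5)
  have e3 : -ψ (0, 2) = ψ (0, 6) := e (0, 6)
  have e4 : -ψ (0, 3) = ψ (0, 7) := e (0, 7)
  have f1 : ψ (1, 0) = ψ (1, 4) := e (1, 4)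
  have f2 : -ψ (1, 1) = ψ (1, 5) := e (1, 5)
  have f3 : -ψ (1, 2) = ψ (1, 6) := e (1, 6)
  have f4 : -ψ (1, 3) = ψ (1, 7) := e (1, 7)
  refine (eq_sv ψ).trans ?_
  rw [psv, e1, e2, e3, e4, f1, f2, f3, f4]

/-! ## Fierz identities on the image of `X⁺` -/

/-- The value at `φ` of the rotation in the plane `(i, j)` weighted by its coefficient in
the square of `ψ`. -/
def plane (i j : Fin 9) (ψ φ : SV → ℂ) : SV → ℂ :=
  form ψ ((γ i).mulVec ((γ j).mulVec (γ125.mulVec ψ))) • (γ i).mulVec ((γ j).mulVec φ)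

/-- The sum of `plane i j` over the block `{6, 7, 8, 9}`. -/
def planes (ψ φ : SV → ℂ) : SV → ℂ :=
  plane 5 6 ψ φ + plane 5 7 ψ φ + plane 5 8 ψ φ + plane 6 7 ψ φ + plane 6 8 ψ φ + plane 7 8 ψ φ

/-- The contribution of the direction `e_i`. -/
def dir (i : Fin 9) (ψ φ : SV → ℂ) : SV → ℂ :=
  form φ (γ125.mulVec ((γ i).mulVec ψ)) • (γ i).mulVec ψ
    - form φ ((γ i).mulVec ψ) • γ125.mulVec ((γ i).mulVec ψ)

/-- On the image of X⁺, which contains γ₁₂₅ψ, the products `γ 2 * γ 3` and `γ 0 * γ 1` differ by a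
sign, and the sign occurs twice in `plane`. -/
theorem plane_zero_one {ψ : SV → ℂ} (h : Xplus.mulVec ψ = ψ) : plane 0 1 ψ ψ = plane 2 3 ψ ψ := by
  rw [eq_psv h]
  generalize ψ (0, 0) = x0, ψ (0, 1) = x1, ψ (0, 2) = x2, ψ (0, 3) = x3, ψ (1, 0) = y0,
    ψ (1, 1) = y1, ψ (1, 2) = y2, ψ (1, 3) = y3
  simp only [plane, psv, γ125_sv, γ0_sv, γ1_sv, γ2_sv, γ3_sv, neg_neg, form_sv_sv, smul_sv]
  refine sv_congr ?_ ?_ ?_ ?_ ?_ ?_ ?_ ?_ ?_ ?_ ?_ ?_ ?_ ?_ ?_ ?_ <;> ring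

/-- The cubic Fierz identity behind the constant 3: it replaces the action of d by rotations, which
can then be compared with those of the odd bracket. -/
theorem form_smul_eq_plane {ψ : SV → ℂ} (h : Xplus.mulVec ψ = ψ) :
    form ψ ψ • γ125.mulVec ψ = plane 0 1 ψ ψ - planes ψ ψ := by
  rw [eq_psv h]
  generalize ψ (0, 0) = x0, ψ (0, 1) = x1, ψ (0, 2) = x2, ψ (0, 3) = x3, ψ (1, 0) = y0,
    ψ (1, 1) = y1, ψ (1, 2) = y2, ψ (1, 3) = y3
  simp only [planes, plane, psv, γ125_sv, γ0_sv, γ1_sv, γ5_sv, γ6_sv, γ7_sv, γ8_sv, neg_neg,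
    form_sv_sv, sub_eq_add_neg, smul_sv, neg_sv, sv_add_sv]
  refine sv_congr ?_ ?_ ?_ ?_ ?_ ?_ ?_ ?_ ?_ ?_ ?_ ?_ ?_ ?_ ?_ ?_ <;> ring_nf <;>
    simp only [Complex.I_sq] <;> ring

/-- The image of X⁻ is singled out on the left, since 1 - γ₁₂₃₄ = 2X⁻. The right side collects the
terms of the odd Jacobi identity that carry α₋. -/
theorem dir_identity (φ : SV → ℂ) {ψ : SV → ℂ} (h : Xplus.mulVec ψ = ψ) :
    form ψ ψ • (γ125.mulVec φ - γ1234.mulVec (γ125.mulVec φ)) =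
      plane 2 3 ψ φ - plane 0 1 ψ φ
        + (2 : ℂ) • (dir 0 ψ φ + dir 1 ψ φ + dir 2 ψ φ + dir 3 ψ φ) := by
  rw [eq_psv h, eq_sv φ]
  generalize ψ (0, 0) = x0, ψ (0, 1) = x1, ψ (0, 2) = x2, ψ (0, 3) = x3, ψ (1, 0) = y0,
    ψ (1, 1) = y1, ψ (1, 2) = y2, ψ (1, 3) = y3
  generalize φ (0, 0) = z0, φ (0, 1) = z1, φ (0, 2) = z2, φ (0, 3) = z3, φ (0, 4) = z4,
    φ (0, 5) = z5, φ (0, 6) = z6, φ (0, 7) = z7, φ (1, 0) = w0, φ (1, 1) = w1, φ (1, 2) = w2,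
    φ (1, 3) = w3, φ (1, 4) = w4, φ (1, 5) = w5, φ (1, 6) = w6, φ (1, 7) = w7
  simp only [dir, plane, psv, γ125_sv, γ1234_sv, γ0_sv, γ1_sv, γ2_sv, γ3_sv, neg_neg,
    form_sv_sv, sub_eq_add_neg, smul_sv, neg_sv, sv_add_sv]
  refine sv_congr ?_ ?_ ?_ ?_ ?_ ?_ ?_ ?_ ?_ ?_ ?_ ?_ ?_ ?_ ?_ ?_ <;> ring

/-- The counterpart for 1 + γ₁₂₃₄ = 2X⁺. Its coefficients are those of α₊' in the odd Jacobi
identity after the substitution α₊ = -3α₊'; for instance a₅ becomes -4α₊' and a₆ becomes -2α₊',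
counting from 1. -/
theorem planes_identity (φ : SV → ℂ) {ψ : SV → ℂ} (h : Xplus.mulVec ψ = ψ) :
    (3 * form ψ ψ) • (γ125.mulVec φ + γ1234.mulVec (γ125.mulVec φ)) =
      (2 : ℂ) • planes ψ φ - plane 0 1 ψ φ - plane 2 3 ψ φ
        + (2 : ℂ) • (dir 0 ψ φ + dir 1 ψ φ - dir 2 ψ φ - dir 3 ψ φ)
        + (8 : ℂ) • dir 4 ψ φ
        + (4 : ℂ) • (dir 5 ψ φ + dir 6 ψ φ + dir 7 ψ φ + dir 8 ψ φ) := by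
  rw [eq_psv h, eq_sv φ]
  generalize ψ (0, 0) = x0, ψ (0, 1) = x1, ψ (0, 2) = x2, ψ (0, 3) = x3, ψ (1, 0) = y0,
    ψ (1, 1) = y1, ψ (1, 2) = y2, ψ (1, 3) = y3
  generalize φ (0, 0) = z0, φ (0, 1) = z1, φ (0, 2) = z2, φ (0, 3) = z3, φ (0, 4) = z4,
    φ (0, 5) = z5, φ (0, 6) = z6, φ (0, 7) = z7, φ (1, 0) = w0, φ (1, 1) = w1, φ (1, 2) = w2,
    φ (1, 3) = w3, φ (1, 4) = w4, φ (1, 5) = w5, φ (1, 6) = w6, φ (1, 7) = w7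
  simp only [dir, planes, plane, psv, γ125_sv, γ1234_sv, γ0_sv, γ1_sv, γ2_sv, γ3_sv, γ4_sv, γ5_sv,
    γ6_sv, γ7_sv, γ8_sv, neg_neg, form_sv_sv, sub_eq_add_neg, smul_sv, neg_sv, sv_add_sv]
  refine sv_congr ?_ ?_ ?_ ?_ ?_ ?_ ?_ ?_ ?_ ?_ ?_ ?_ ?_ ?_ ?_ ?_ <;> ring_nf <;>
    simp only [Complex.I_sq] <;> ring

theorem planes_psv_ne_zero : planes (psv 1 0 0 0 0 0 0 0) (psv 1 0 0 0 0 0 0 0) ≠ 0 := by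
  have h : planes (psv 1 0 0 0 0 0 0 0) (psv 1 0 0 0 0 0 0 0) =
      sv ![0, 0, 0, 0, 0, 0, 0, 0] ![0, 0, 2, 0, 0, 0, -2, 0] := by
    simp only [planes, plane, psv, γ125_sv, γ5_sv, γ6_sv, γ7_sv, γ8_sv, neg_neg, neg_zero,
      form_sv_sv, smul_sv, sv_add_sv]
    refine sv_congr ?_ ?_ ?_ ?_ ?_ ?_ ?_ ?_ ?_ ?_ ?_ ?_ ?_ ?_ ?_ ?_ <;> ring_nf <;>
      simp only [Complex.I_sq] <;> ring
  intro h0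
  rw [h] at h0
  exact two_ne_zero (congrFun h0 (1, 2) : (2 : ℂ) = 0)

theorem Xplus_psv (x0 x1 x2 x3 y0 y1 y2 y3 : ℂ) :
    Xplus.mulVec (psv x0 x1 x2 x3 y0 y1 y2 y3) = psv x0 x1 x2 x3 y0 y1 y2 y3 := by
  rw [Xplus_eq, Matrix.smul_mulVec, Matrix.add_mulVec, Matrix.one_mulVec, psv, γ1234_sv]
  simp only [neg_neg]
  module

/-! ## The Jacobi identity of three odd elements -/

/-- The unordered pairs within blocks of sizes 2, 2, 1 and 4 number 1 + 1 + 0 + 6. -/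
theorem sum_sum_block {M : Type*} [AddCommGroup M] [Module ℂ M] {f : Fin 9 → Fin 9 → M}
    (off : ∀ i j, block i ≠ block j → f i j = 0) (diag : ∀ i, f i i = 0)
    (symm : ∀ i j, f j i = f i j) :
    ∑ i, ∑ j, f i j = (2 : ℂ) • (f 0 1 + f 2 3
      + (f 5 6 + f 5 7 + f 5 8 + f 6 7 + f 6 8 + f 7 8)) := by
  have h : ∀ g : Fin 9 → M, ∑ i, g i =
      g 0 + g 1 + g 2 + g 3 + g 4 + g 5 + g 6 + g 7 + g 8 := fun g => by
    rw [Fin.sum_univ_castSucc, Fin.sum_univ_eight]; rfl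
  simp (disch := decide) only [h, diag, off]
  simp only [symm 0 1, symm 2 3, symm 5 6, symm 5 7, symm 5 8, symm 6 7, symm 6 8, symm 7 8]
  module

/-- Within a block `wedge i j` is 2ε_jγ_iγ_jγ₁₂₅, so the signs of the three terms are the values of
ε on the blocks. -/
theorem rot_oddData (p : Param) {w : Spinor} (hw : Xplus.mulVec (right w) = right w)
    (φ : SV → ℂ) : (rot (oddData p w w).m).mulVec φ =
      -(Complex.I * (Real.sqrt 2 : ℝ) / 2) • ((a p 0 : ℂ) • plane 0 1 (right w) φ
        - (a p 2 : ℂ) • plane 2 3 (right w) φ - (a p 5 : ℂ) • planes (right w) φ) := by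
  have hV := oddData_valid p hw hw
  have hd : ∀ i, (oddData p w w).m i i = 0 := fun i => by
    have := hV.skew i i
    linear_combination (1 / 2 : ℂ) * this
  have hp : ∀ i j, i ≠ j → ε i = ε j → (oddData p w w).m i j • (γ i * γ j).mulVec φ =
      (-(Complex.I * (Real.sqrt 2 : ℝ)) * ε j * a p j) • plane i j (right w) φ := by
    intro i j h he
    rw [plane, smul_smul, Matrix.mulVec_mulVec, Matrix.mulVec_mulVec, Matrix.mulVec_mulVec]
    congr 1
    simp only [oddData, Matrix.of_apply, wedge_eq h, Matrix.smul_mulVec, form_smul_right, he,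
      mul_assoc (γ i)]
    ring
  have e : (rot (oddData p w w).m).mulVec φ =
      (1 / 4 : ℂ) • ∑ i, ∑ j, (oddData p w w).m i j • (γ i * γ j).mulVec φ := by
    simp only [rot, Matrix.smul_mulVec, Matrix.sum_mulVec]
  rw [e, sum_sum_block]
  · rw [hp 0 1, hp 2 3, hp 5 6, hp 5 7, hp 5 8, hp 6 7, hp 6 8, hp 7 8]
    · have h1 : ∀ j : Fin 9, 5 ≤ j → a p j = a p 5 ∧ ε j = -1 := by
        intro j hj
        fin_cases j <;> first | exact absurd hj (by decide) | exact ⟨rfl, rfl⟩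
      have h2 : ε 1 = 1 ∧ a p 1 = a p 0 := ⟨rfl, rfl⟩
      have h3 : ε 3 = -1 ∧ a p 3 = a p 2 := ⟨rfl, rfl⟩
      rw [(h1 6 (by decide)).1, (h1 7 (by decide)).1, (h1 8 (by decide)).1,
        (h1 6 (by decide)).2, (h1 7 (by decide)).2, (h1 8 (by decide)).2, h2.1, h2.2, h3.1, h3.2,
        planes]
      module
    all_goals first | decide | rfl
  · intro i j h
    rw [hV.off i j h, zero_smul]
  · intro i
    rw [hd, zero_smul]
  · intro i j
    by_cases h : i = j
    · rw [h]
    · have hs : (γ j * γ i).mulVec φ = -(γ i * γ j).mulVec φ := by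
        rw [γ_swap, swapSign, if_neg h, Matrix.smul_mulVec, neg_one_smul]
      rw [hs, hV.skew i j]
      exact neg_smul_neg _ _

theorem left_jac {p : Param} (ha : ∀ i, a p i ≠ 0) {w : Spinor}
    (hw : Xplus.mulVec (right w) = right w) :
    left (act p (oddData p w w) w) = (Complex.I * (Real.sqrt 2 : ℝ)) •
      (-(form (right w) (right w) • (cbar p).mulVec (left w))
        - (1 / 2 : ℂ) • ((a p 0 : ℂ) • plane 0 1 (right w) (left w)
          - (a p 2 : ℂ) • plane 2 3 (right w) (left w) - (a p 5 : ℂ) • planes (right w) (left w))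
        + ∑ i, (a p i : ℂ) • dir i (right w) (left w)) := by
  have ha' : ∀ i, (a p i : ℂ) ≠ 0 := fun i => Complex.ofReal_ne_zero.2 (ha i)
  have h3 := ofReal_sqrt_two_ne_zero
  have h2 := ofReal_sqrt_two_sq
  have hi : ((Real.sqrt 2 : ℝ) : ℂ)⁻¹ = ((Real.sqrt 2 : ℝ) : ℂ) / 2 := by
    field_simp; linear_combination -h2
  have e : oddMap p (oddData p w w).u (oddData p w w).v (right w) =
      (2 * Complex.I) • ∑ i, (a p i : ℂ) • dir i (right w) (left w) := by
    rw [oddMap_eq p _ _ hw, Finset.smul_sum]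
    refine Finset.sum_congr rfl fun i _ => ?_
    have := ha' i
    have e1 : (a p i : ℂ) ^ 2 * (oddData p w w).v i = 2 * Complex.I * a p i *
        form (left w) (γ125.mulVec ((γ i).mulVec (right w))) := by
      simp only [oddData, Matrix.mulVec_mulVec]
      field_simp
      ring
    have e2 : (oddData p w w).u i = -2 * Complex.I * form (left w) ((γ i).mulVec (right w)) := by
      simp only [oddData]; ring
    rw [e1, e2, dir, Matrix.mulVec_mulVec]
    module
  rw [left_act, e, rot_oddData p hw, hi]
  simp only [oddData]
  module

/-- The contribution of ∂₋ becomes α₊'(plane₁₂ - planes) by the Fierz identity. The rotations of the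
first two blocks combine to -α₊' plane₁₂ because a₁ - a₃ = -2α₊', and cancel its first term. What
remains is `planes` with weight -½(α₊ + 3α₊'), up to the common factor. -/
theorem right_jac {p : Param} {w : Spinor} (hw : Xplus.mulVec (right w) = right w) :
    right (act p (oddData p w w) w) = (Complex.I * (Real.sqrt 2 : ℝ) / 2 * (p 2 + 3 * p 1)) •
      planes (right w) (right w) := by
  have h := form_smul_eq_plane hw
  have e : right (act p (oddData p w w) w) = -(Complex.I * (Real.sqrt 2 : ℝ)) •
      ((p 1 : ℂ) • (form (right w) (right w) • γ125.mulVec (right w))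
        + (1 / 2 : ℂ) • ((a p 0 : ℂ) • plane 0 1 (right w) (right w)
        - (a p 2 : ℂ) • plane 2 3 (right w) (right w)
        - (a p 5 : ℂ) • planes (right w) (right w))) := by
    rw [right_act, rot_oddData p hw, dd_mulVec p hw]
    simp only [oddData]
    module
  have a0 : (a p 0 : ℂ) = p 0 - p 1 := by simp [a]
  have a2 : (a p 2 : ℂ) = p 0 + p 1 := by simp [a]
  have a5 : (a p 5 : ℂ) = p 2 + p 1 := by simp [a]
  rw [e, h, ← plane_zero_one hw, a0, a2, a5]
  module

/-- Once α₊ = -3α₊' is inserted, the expression of `left_jac` is linear in α₋ and α₊'. The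
coefficient of α₋ vanishes by `dir_identity`, that of α₊' by `planes_identity`. -/
theorem left_jac_eq_zero {p : Param} (ha : ∀ i, a p i ≠ 0) (hp : p 2 = -3 * p 1) {w : Spinor}
    (hw : Xplus.mulVec (right w) = right w) : left (act p (oddData p w w) w) = 0 := by
  have h1 := dir_identity (left w) hw
  have h2 := planes_identity (left w) hw
  -- The decomposition of c̄ into its parts on the images of X⁺ and X⁻, in the shape of the two
  -- identities.
  have hc : (cbar p).mulVec (left w) = ((p 2 : ℂ) / 2) • (γ125.mulVec (left w)
      + γ1234.mulVec (γ125.mulVec (left w))) + ((p 0 : ℂ) / 2) • (γ125.mulVec (left w)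
      - γ1234.mulVec (γ125.mulVec (left w))) := by
    simp only [cbar, Xplus_eq, Xminus_eq, ← Matrix.mulVec_mulVec, Matrix.add_mulVec,
      Matrix.smul_mulVec, Matrix.sub_mulVec, Matrix.one_mulVec]
    module
  have hs : ∀ g : Fin 9 → SV → ℂ, ∑ i, g i =
      g 0 + g 1 + g 2 + g 3 + g 4 + g 5 + g 6 + g 7 + g 8 := fun g => by
    rw [Fin.sum_univ_castSucc, Fin.sum_univ_eight]; rfl
  have hp' : (p 2 : ℂ) = -3 * p 1 := by rw [hp]; push_cast; ring
  have e : form (right w) (right w) • (cbar p).mulVec (left w) =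
      (-(p 1 : ℂ) / 2) • ((3 * form (right w) (right w)) • (γ125.mulVec (left w)
        + γ1234.mulVec (γ125.mulVec (left w)))) + ((p 0 : ℂ) / 2) •
        (form (right w) (right w) • (γ125.mulVec (left w)
          - γ1234.mulVec (γ125.mulVec (left w)))) := by
    rw [hc, hp']
    module
  rw [left_jac ha hw, e, h1, h2, hs]
  simp only [a, Matrix.cons_val]
  push_cast
  rw [hp']
  module

/-! ### Polarisation of the odd Jacobi identity -/

theorem rot_add (m m' : Matrix (Fin 9) (Fin 9) ℂ) : rot (m + m') = rot m + rot m' := by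
  simp only [rot, Matrix.add_apply, add_smul, Finset.sum_add_distrib, smul_add]

theorem ext_left_right {w w' : Spinor} (h : left w = left w') (h' : right w = right w') :
    w = w' := by
  rw [← elim_left_right w, h, h', elim_left_right]

theorem act_add_left (p : Param) (A A' : Even) (w : Spinor) :
    act p ⟨A.cp + A'.cp, A.cm + A'.cm, A.u + A'.u, A.v + A'.v, A.m + A'.m⟩ w =
      act p A w + act p A' w := by
  apply ext_left_right
  · change _ = left (act p A w) + left (act p A' w)
    simp only [left_act, rot_add, oddMap_add_left, Matrix.add_mulVec]
    module
  · change _ = right (act p A w) + right (act p A' w)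
    simp only [right_act, rot_add, Matrix.add_mulVec]
    module

theorem act_add_right (p : Param) (A : Even) (w w' : Spinor) :
    act p A (w + w') = act p A w + act p A w' := by
  apply ext_left_right
  · change _ = left (act p A w) + left (act p A w')
    simp only [left_act, show left (w + w') = left w + left w' from rfl,
      show right (w + w') = right w + right w' from rfl, oddMap_add_right, Matrix.mulVec_add]
    module
  · change _ = right (act p A w) + right (act p A w')
    simp only [right_act, show right (w + w') = right w + right w' from rfl, Matrix.mulVec_add]
    module

theorem oddData_add_left (p : Param) (v v' w : Spinor) : oddData p (v + v') w =
    ⟨(oddData p v w).cp + (oddData p v' w).cp, (oddData p v w).cm + (oddData p v' w).cm,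
      (oddData p v w).u + (oddData p v' w).u, (oddData p v w).v + (oddData p v' w).v,
      (oddData p v w).m + (oddData p v' w).m⟩ := by
  have hl : left (v + v') = left v + left v' := rfl
  have hr : right (v + v') = right v + right v' := rfl
  ext <;> simp only [oddData, hl, hr, form_add_left, form_add_right, Matrix.mulVec_add,
    Pi.add_apply, Matrix.add_apply, Matrix.of_apply] <;> ring

/-- The expression is trilinear and symmetric in the two arguments of the bracket, so its cyclic sum
is the polarisation of the cubic map on the diagonal. -/
theorem jacobi_of_diagonal {p : Param} {s : Submodule ℂ Spinor}
    (h : ∀ w ∈ s, act p (oddData p w w) w = 0) {v w z : Spinor} (hv : v ∈ s) (hw : w ∈ s)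
    (hz : z ∈ s) :
    act p (oddData p v w) z + act p (oddData p w z) v + act p (oddData p z v) w = 0 := by
  have l : ∀ a b c d, act p (oddData p (a + b) c) d =
      act p (oddData p a c) d + act p (oddData p b c) d := fun a b c d => by
    rw [oddData_add_left, act_add_left]
  have r : ∀ a b c d, act p (oddData p c (a + b)) d =
      act p (oddData p c a) d + act p (oddData p c b) d := fun a b c d => by
    rw [oddData_symm, l, oddData_symm p a, oddData_symm p b]
  have h1 := h _ (s.add_mem (s.add_mem hv hw) hz)
  have h2 := h _ (s.add_mem hv hw)
  have h3 := h _ (s.add_mem hv hz)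
  have h4 := h _ (s.add_mem hw hz)
  have h5 := h _ hv
  have h6 := h _ hw
  have h7 := h _ hz
  simp only [l, r, act_add_right, h5, h6, h7, oddData_symm p w v, oddData_symm p z w,
    oddData_symm p z v] at h1 h2 h3 h4 ⊢
  -- Inclusion and exclusion over the sums of `v`, `w`, `z`; each cyclic term appears twice, hence
  -- the factor ½.
  linear_combination (norm := module) (1 / 2 : ℂ) • (h1 - h2 - h3 - h4)

/-! ### From identities of data to geometric supersymmetry -/

theorem mem_K1_iff (p : Param) (ξ : SF) :
    ξ ∈ K1 p ↔ ∃ w, Xplus.mulVec (right w) = right w ∧ ξ = parallelSpinor p w := by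
  simp only [K1, Submodule.mem_map, mem_ker_iff, eq_comm]

theorem Xplus_right_act {p : Param} {A : Even} (hA : A.Valid) {w : Spinor}
    (hw : Xplus.mulVec (right w) = right w) :
    Xplus.mulVec (right (act p A w)) = right (act p A w) :=
  (mem_ker_iff _).1 (act_mem hA ((mem_ker_iff _).2 hw))

theorem spinLie_parallelSpinor (p : Param) {A : Even} (hA : A.Valid) {w : Spinor}
    (hw : Xplus.mulVec (right w) = right w) :
    spinLie p (field p A) (parallelSpinor p w) = parallelSpinor p (act p A w) :=
  spinLie_field p hA ((mem_ker_iff w).2 hw)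

/-- Every axiom is an identity of data already established; apart from a_i ≠ 0 the parameters are
free. -/
theorem isGeometricSuperalgebra {p : Param} (ha : ∀ i, a p i ≠ 0) :
    IsGeometricSuperalgebra p where
  killing X hX := by
    obtain ⟨A, hA, rfl⟩ := (mem_K0_iff p X).1 hX
    exact isKilling_field p hA
  even_even X hX Y hY := by
    obtain ⟨A, hA, rfl⟩ := (mem_K0_iff p X).1 hX
    obtain ⟨A', hA', rfl⟩ := (mem_K0_iff p Y).1 hY
    rw [lieBr_field p hA hA']
    exact (mem_K0_iff p _).2 ⟨_, brk_valid hA hA', rfl⟩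
  parallel ξ hξ μ := by
    obtain ⟨w, hw, rfl⟩ := (mem_K1_iff p ξ).1 hξ
    exact parallel p ((mem_ker_iff w).2 hw) μ
  even_odd X hX ξ hξ := by
    obtain ⟨A, hA, rfl⟩ := (mem_K0_iff p X).1 hX
    obtain ⟨w, hw, rfl⟩ := (mem_K1_iff p ξ).1 hξ
    rw [spinLie_parallelSpinor p hA hw]
    exact (mem_K1_iff p _).2 ⟨_, Xplus_right_act hA hw, rfl⟩
  odd_odd ξ hξ η hη := by
    obtain ⟨v, hv, rfl⟩ := (mem_K1_iff p ξ).1 hξ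
    obtain ⟨w, hw, rfl⟩ := (mem_K1_iff p η).1 hη
    rw [oddBr_eq ha hv hw]
    exact (mem_K0_iff p _).2 ⟨_, oddData_valid p hv hw, rfl⟩
  odd_symm ξ hξ η hη := by
    obtain ⟨v, hv, rfl⟩ := (mem_K1_iff p ξ).1 hξ
    obtain ⟨w, hw, rfl⟩ := (mem_K1_iff p η).1 hη
    rw [oddBr_eq ha hv hw, oddBr_eq ha hw hv, oddData_symm]
  even_even_odd X hX Y hY ξ hξ := by
    obtain ⟨A, hA, rfl⟩ := (mem_K0_iff p X).1 hX
    obtain ⟨A', hA', rfl⟩ := (mem_K0_iff p Y).1 hY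
    obtain ⟨w, hw, rfl⟩ := (mem_K1_iff p ξ).1 hξ
    rw [lieBr_field p hA hA', spinLie_parallelSpinor p (brk_valid hA hA') hw,
      spinLie_parallelSpinor p hA hw, spinLie_parallelSpinor p hA' hw,
      spinLie_parallelSpinor p hA (Xplus_right_act hA' hw),
      spinLie_parallelSpinor p hA' (Xplus_right_act hA hw), act_brk hA hA' hw, map_sub]
  even_odd_odd X hX ξ hξ η hη := by
    obtain ⟨A, hA, rfl⟩ := (mem_K0_iff p X).1 hX
    obtain ⟨v, hv, rfl⟩ := (mem_K1_iff p ξ).1 hξ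
    obtain ⟨w, hw, rfl⟩ := (mem_K1_iff p η).1 hη
    rw [oddBr_eq ha hv hw, lieBr_field p hA (oddData_valid p hv hw),
      spinLie_parallelSpinor p hA hv, spinLie_parallelSpinor p hA hw,
      oddBr_eq ha (Xplus_right_act hA hv) hw, oddBr_eq ha hv (Xplus_right_act hA hw),
      brk_oddData ha hA hv hw, field_add]

theorem spinLie_oddBr {p : Param} (ha : ∀ i, a p i ≠ 0) {v w z : Spinor}
    (hv : Xplus.mulVec (right v) = right v) (hw : Xplus.mulVec (right w) = right w)
    (hz : Xplus.mulVec (right z) = right z) :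
    spinLie p (oddBr p (parallelSpinor p v) (parallelSpinor p w)) (parallelSpinor p z) =
      parallelSpinor p (act p (oddData p v w) z) := by
  rw [oddBr_eq ha hv hw, spinLie_parallelSpinor p (oddData_valid p hv hw) hz]

/-- Only the Jacobi identity of three odd elements restricts p. Necessity tests it on a single
spinor, sufficiency reduces it to the diagonal. -/
theorem isGeometricSupersymmetry_iff {p : Param} (ha : ∀ i, a p i ≠ 0) :
    IsGeometricSupersymmetry p ↔ p 2 = -3 * p 1 := by
  constructor
  · intro h
    -- The test spinor has ξ₁⁰ = 0 and ξ₂⁰ in the image of X⁺, chosen so that `planes` does not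
    -- vanish on it.
    have hw : Xplus.mulVec (right (Sum.elim 0 (psv 1 0 0 0 0 0 0 0))) =
        right (Sum.elim 0 (psv 1 0 0 0 0 0 0 0)) := Xplus_psv _ _ _ _ _ _ _ _
    have hm := (mem_K1_iff p _).2 ⟨_, hw, rfl⟩
    have h1 := h.jacobi_odd _ hm _ hm _ hm
    rw [spinLie_oddBr ha hw hw hw, ← map_add, ← map_add] at h1
    -- At the origin a parallel spinor returns its constants; the three cyclic terms coincide,
    -- giving the factor 3.
    have h2 := congrArg right (congrFun h1 0)
    rw [parallelSpinor_zero] at h2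
    have h3 : (3 : ℂ) • right (act p (oddData p _ _) _) = 0 := Eq.trans (by
      rw [show (3 : ℂ) = 1 + 1 + 1 by norm_num, add_smul, add_smul, one_smul]; rfl) h2
    rw [right_jac hw, smul_smul] at h3
    rcases smul_eq_zero.1 h3 with h4 | h4
    · have h5 : (p 2 : ℂ) + 3 * p 1 = 0 := by
        have := ofReal_sqrt_two_ne_zero
        simpa [Complex.I_ne_zero, this] using h4
      have h6 : p 2 + 3 * p 1 = 0 := by
        apply Complex.ofReal_injective
        push_cast
        exact h5
      linarith
    · exact absurd h4 planes_psv_ne_zero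
  · intro hp
    have hp' : (p 2 : ℂ) + 3 * p 1 = 0 := by rw [hp]; push_cast; ring
    have hd : ∀ w ∈ LinearMap.ker (Matrix.mulVecLin (onPlus Xminus)),
        act p (oddData p w w) w = 0 := by
      intro w hw
      have hw := (mem_ker_iff w).1 hw
      refine ext_left_right (left_jac_eq_zero ha hp hw) ?_
      rw [right_jac hw, hp', mul_zero, zero_smul]
      rfl
    refine ⟨isGeometricSuperalgebra ha, ?_, ?_⟩
    · intro X hX Y hY Z hZ
      exact lieBr_jacobi p hX hY hZ
    · intro ξ hξ η hη ζ hζ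
      obtain ⟨v, hv, rfl⟩ := (mem_K1_iff p ξ).1 hξ
      obtain ⟨w, hw, rfl⟩ := (mem_K1_iff p η).1 hη
      obtain ⟨z, hz, rfl⟩ := (mem_K1_iff p ζ).1 hζ
      rw [spinLie_oddBr ha hv hw hz, spinLie_oddBr ha hw hz hv, spinLie_oddBr ha hz hv hw,
        ← map_add, ← map_add, jacobi_of_diagonal hd ((mem_ker_iff v).2 hv) ((mem_ker_iff w).2 hw)
        ((mem_ker_iff z).2 hz), map_zero]

theorem not_decomposable_and_isGeometricSupersymmetry_iff (p : Param) :
    ¬ Decomposable p ∧ IsGeometricSupersymmetry p ↔ (∀ i, a p i ≠ 0) ∧ p 2 = -3 * p 1 := by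
  rw [not_decomposable_iff]
  exact and_congr_right isGeometricSupersymmetry_iff

end CahenWallach
end

theorem mainTheorem7 :
    ∃ Φ : CahenWallach.Configurations ≃ₜ Metric.closedBall (0 : EuclideanSpace ℝ (Fin 3)) 1,
      (∀ p : {p : CahenWallach.Param // p ≠ 0},
        (Φ (Quotient.mk CahenWallach.moduliSetoid p) : EuclideanSpace ℝ (Fin 3)) =
          ‖p.1‖⁻¹ • !₂[p.1 1, p.1 2, p.1 3]) ∧
      (fun z => (Φ z : EuclideanSpace ℝ (Fin 3))) '' CahenWallach.susyModuli =
        {u | ‖u‖ ≤ 1 ∧ u 1 = -3 * u 0 ∧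
          u 1 ≠ u 0 ∧ u 1 ≠ -u 0 ∧ u 1 ^ 2 + 2 * u 0 ^ 2 + u 2 ^ 2 ≠ 1} ∧
      (fun z => (Φ z : EuclideanSpace ℝ (Fin 3))) '' CahenWallach.compactifiedSusyModuli =
        {u | ‖u‖ ≤ 1 ∧ u 1 = -3 * u 0} ∧
      Nonempty (CahenWallach.compactifiedSusyModuli ≃ₜ
        Metric.closedBall (0 : EuclideanSpace ℝ (Fin 2)) 1) := by
  have key := CahenWallach.not_decomposable_and_isGeometricSupersymmetry_iff
  exact ⟨CahenWallach.configurationsHomeo, CahenWallach.configurationsHomeo_mk,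
    CahenWallach.image_susyModuli key, CahenWallach.image_compactifiedSusyModuli key,
    CahenWallach.nonempty_homeo_disc key⟩
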